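/- **Setting.** Fix a set $\mathsf{Act}$ of actions, each named by a distinct bit string. For a set $A$ write $A_{\mathbb N}=A\times\mathbb N$; $\langle a:i\rangle$ is $a$ executed by thread $i$. For $\tau\in A_{\mathbb N}^*$ let $\tau{\downarrow_i}\in A^*$ be the trace of thread $i$. A *control flow graph* $G$ over $\mathsf{Act}\cup S$ ($S$ a set of synchronization symbols disjoint from $\mathsf{Act}$) has a finite set of locations, a finite set of labeled edges, an initial and a different exit location; every location is reachable from the initial one and reaches the exit; each $a\in\mathsf{Act}$ labels at most one edge. $\mathrm{Tr}(G)$ is the set of labels of paths from the initial to the exit location. Let $G$ be a control flow graph over $\mathsf{Act}$; as a program over the trivial synchronization alphabet its interleavings are $$L(G)=\{\tau\in\mathsf{Act}_{\mathbb N}^*\mid \forall i.\ \tau{\downarrow_i}\in \mathrm{Tr}(G)\cup\{\varepsilon\}\}.$$ A *sync-point instrumentation* of $G$ is a control flow graph $G'$ over $\mathsf{Act}\cup\{\bullet\}$ such that erasing $\bullet$ maps $\mathrm{Tr}(G')$ onto $\mathrm{Tr}(G)$ and is injective on $\mathrm{Tr}(G')$. For finite $T\subset\mathbb N$ let $\mathrm{sync}_T$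 be the least predicates such that $\mathrm{sync}_\emptyset(\varepsilon)$ holds, and $\mathrm{sync}_T(\tau_1\tau_2)$ holds whenever $\mathrm{sync}_{T'}(\tau_2)$ holds for some $T'\subsetneq T$ and $\tau_1$ is a concatenation of words over $\mathsf{Act}\times T$ and words $\langle\bullet:t_1\rangle\cdots\langle\bullet:t_n\rangle$, where $t_1,\dots,t_n$ is an enumeration of $T$ without repetition. An *execution* of $G'$ is a word $\hat\tau\in(\mathsf{Act}\cup\{\bullet\})_{\mathbb N}^*$ such that $\mathrm{sync}_T(\hat\tau)$ holds for some finite $T$ and $\hat\tau{\downarrow_i}\in\mathrm{Tr}(G')\cup\{\varepsilon\}$ for all $i$; $L_\bullet(G')$ is the set of executions of $G'$ with all $\bullet$ erased. For a relation $I$ on the actions occurring in $G$, let $\sqsubseteq_I$ be the least reflexive transitive relation with $\rho\langle a:i\rangle\langle b:j\rangle\sigma\sqsubseteq_I\rho\langle b:j\rangle\langle a:i\rangle\sigma$ for $(a,b)\in I$, $i\ne j$. $G'$ is *sound* with respect to $I$ if $L_\bullet(G')\subseteq L(G)$ and for every $\tau\in L(G)$ there is $\tau'\in L_\bullet(G')$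 with $\tau\sqsubseteq_I\tau'$. The *phase order* $\mathrm{PO}$ is the set of pairs $(a,b)$ such that some execution $\hat\tau$ of $G'$ has threads $i\neq j$ with $\hat\tau{\downarrow_i}=\tau_1a\sigma_1$, $\hat\tau{\downarrow_j}=\tau_2b\sigma_2$ and $|\tau_1|_\bullet<|\tau_2|_\bullet$. **Theorem.** 1. There are a Turing machine and a polynomial $p$ such that, for every $G$, every sync-point instrumentation $G'$ of $G$ and every $I$, the machine, started on the encoding of $(G,G',I)$ (edge lists and a list of pairs, with numbers in binary), halts after at most $p(N)$ steps, where $N$ is the length of the encoding, and outputs whether $G'$ is sound with respect to $I$. 2. For all such $(G,G',I)$: $G'$ is sound with respect to $I$ if and only if $\mathrm{PO}\subseteq I^{-1}$; and for all $a,b\in\mathsf{Act}$, $(a,b)\in\mathrm{PO}$ if and only if $\min_\bullet(a)<\max_\bullet(b)$, where $\min_\bullet(a)$ and $\max_\bullet(a)$ are the infimum and the supremum in $\mathbb N\cup\{\infty\}$ of $\{|\tau|_\bullet\mid\exists\sigma.\ \tau a\sigma\in\mathrm{Tr}(G')\}$. -/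

import Mathlib

/-- `LabeledPath Δ p w q`: there is a path from `p` to `q` labeled by the word `w`,
using transitions from `Δ`. -/
inductive LabeledPath {L A : Type} (Δ : List (L × A × L)) : L → List A → L → Prop
  | nil (p : L) : LabeledPath Δ p [] p
  | cons {p q r : L} {x : A} {w : List A} :
      (p, x, q) ∈ Δ → LabeledPath Δ q w r → LabeledPath Δ p (x :: w) r

/-- Control flow graphs over the actions `Act` and the synchronization actions `S`.
The finite set of locations is `Fin numLoc`, the finite transition relation is given by the list of
its elements. -/
structure CFG (Act S : Type) where
  numLoc : ℕ
  edges : List (Fin numLoc × (Act ⊕ S) × Fin numLoc)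
  init : Fin numLoc
  exit : Fin numLoc
  init_ne_exit : init ≠ exit
  /-- every location is reachable from the initial location -/
  reachable : ∀ p, ∃ w, LabeledPath edges init w p
  /-- the exit location is reachable from every location -/
  coreachable : ∀ p, ∃ w, LabeledPath edges p w exit
  /-- at most one edge is labeled by a given action (synchronization actions may repeat) -/
  action_unique : ∀ (a : Act) (p q p' q' : Fin numLoc),
    (p, Sum.inl a, q) ∈ edges → (p', Sum.inl a, q') ∈ edges → p = p' ∧ q = q'

namespace CFG

/-- Labels of the paths from the initial to the exit location. -/
def traces {Act S : Type} (G : CFG Act S) : Set (List (Act ⊕ S)) :=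
  {w | LabeledPath G.edges G.init w G.exit}

/-- The actions in `Act` that occur in the graph. -/
def actions {Act S : Type} (G : CFG Act S) : Set Act :=
  {a | ∃ p q, (p, Sum.inl a, q) ∈ G.edges}

end CFG

/-- Indexed traces: sequences of symbols, each with the index of the thread executing it. -/
abbrev IndexedTrace (X : Type) : Type := List (X × ℕ)

/-- Projection of an indexed trace along a partial map of symbols; symbols that are mapped to
`none` are erased. -/
def IndexedTrace.project {X Y : Type} (f : X → Option Y) (τ : IndexedTrace X) : IndexedTrace Y :=
  τ.filterMap fun s => (f s.1).map fun y => (y, s.2)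

/-- The trace of thread `i`. -/
def IndexedTrace.local {X : Type} (τ : IndexedTrace X) (i : ℕ) : List X :=
  τ.filterMap fun s => if s.2 = i then some s.1 else none

/-- Renaming of the thread indices. -/
def IndexedTrace.permute {X : Type} (π : Equiv.Perm ℕ) (τ : IndexedTrace X) : IndexedTrace X :=
  τ.map fun s => (s.1, π s.2)

theorem IndexedTrace.project_permute {X Y : Type} (f : X → Option Y) (π : Equiv.Perm ℕ)
    (τ : IndexedTrace X) : (τ.permute π).project f = (τ.project f).permute π := by
  simp only [project, permute, List.filterMap_map, List.map_filterMap]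
  congr 1
  funext s
  cases h : f s.1 <;> simp [h]

/-- A synchronization alphabet: synchronization actions (disjoint from `Act` by construction of
`Act ⊕ S`) and a predicate on indexed traces that is preserved by permutations of threads. -/
structure SyncAlphabet (Act : Type) where
  S : Type
  sync : IndexedTrace (Act ⊕ S) → Prop
  sync_permute : ∀ (π : Equiv.Perm ℕ) (τ : IndexedTrace (Act ⊕ S)), sync τ → sync (τ.permute π)

namespace SyncAlphabet

/-- The trivial synchronization alphabet. -/
abbrev trivial (Act : Type) : SyncAlphabet Act where
  S := Empty
  sync := fun _ => True
  sync_permute := fun _ _ h => h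

/-- Erase the synchronization actions of the second alphabet. -/
def eraseRight {Act S₁ S₂ : Type} : Act ⊕ (S₁ ⊕ S₂) → Option (Act ⊕ S₁)
  | Sum.inl a => some (Sum.inl a)
  | Sum.inr (Sum.inl s) => some (Sum.inr s)
  | Sum.inr (Sum.inr _) => none

/-- Erase the synchronization actions of the first alphabet. -/
def eraseLeft {Act S₁ S₂ : Type} : Act ⊕ (S₁ ⊕ S₂) → Option (Act ⊕ S₂)
  | Sum.inl a => some (Sum.inl a)
  | Sum.inr (Sum.inl _) => none
  | Sum.inr (Sum.inr s) => some (Sum.inr s)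

/-- The combination of two (disjoint) synchronization alphabets. -/
abbrev combine {Act : Type} (A B : SyncAlphabet Act) : SyncAlphabet Act where
  S := A.S ⊕ B.S
  sync := fun τ => A.sync (τ.project eraseRight) ∧ B.sync (τ.project eraseLeft)
  sync_permute := fun π τ h => by
    rw [IndexedTrace.project_permute, IndexedTrace.project_permute]
    exact ⟨A.sync_permute π _ h.1, B.sync_permute π _ h.2⟩

end SyncAlphabet

/-- Traces without sync-points, executed by threads in `T`. -/
def actionWords (Act : Type) (T : Finset ℕ) : Language ((Act ⊕ Unit) × ℕ) :=
  {w | ∀ s ∈ w, (∃ a : Act, s.1 = Sum.inl a) ∧ s.2 ∈ T}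

/-- One sync-point passed by every thread in `T` exactly once, in some order. -/
def syncWords (Act : Type) (T : Finset ℕ) : Language ((Act ⊕ Unit) × ℕ) :=
  {w | ∃ l : List ℕ, l.Nodup ∧ l.toFinset = T ∧ w = l.map fun t => (Sum.inr (), t)}

/-- `SyncPointTrace T τ`: starting with `T` as the set of running threads, `τ` respects the
sync-points. The running threads execute actions and pass sync-points together, then some of them
terminate and only the smaller set `T'` keeps running; the trace is over when no thread is left. -/
inductive SyncPointTrace {Act : Type} : Finset ℕ → IndexedTrace (Act ⊕ Unit) → Prop
  | done : SyncPointTrace ∅ []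
  | phase {T T' : Finset ℕ} {τ₁ τ₂ : IndexedTrace (Act ⊕ Unit)} :
      τ₁ ∈ KStar.kstar (actionWords Act T + syncWords Act T) → T' ⊂ T →
      SyncPointTrace T' τ₂ → SyncPointTrace T (τ₁ ++ τ₂)

theorem SyncPointTrace.permute {Act : Type} (π : Equiv.Perm ℕ) {T : Finset ℕ}
    {τ : IndexedTrace (Act ⊕ Unit)} (h : SyncPointTrace T τ) :
    SyncPointTrace (T.map π.toEmbedding) (IndexedTrace.permute π τ) := by
  induction h with
  | done => exact SyncPointTrace.done
  | @phase T T' τ₁ τ₂ h₁ hT _ ih =>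
    have hsplit : IndexedTrace.permute π (τ₁ ++ τ₂)
        = IndexedTrace.permute π τ₁ ++ IndexedTrace.permute π τ₂ := by
      simp [IndexedTrace.permute]
    rw [hsplit]
    refine SyncPointTrace.phase ?_ (Finset.map_ssubset_map.mpr hT) ih
    rw [Language.mem_kstar] at h₁ ⊢
    obtain ⟨L, rfl, hL⟩ := h₁
    refine ⟨L.map (IndexedTrace.permute π), ?_, ?_⟩
    · simp only [IndexedTrace.permute, List.map_flatten]
      rfl
    · intro y hy
      obtain ⟨w, hw, rfl⟩ := List.mem_map.mp hy
      rcases (Language.mem_add _ _ _).mp (hL w hw) with h | ⟨l, hl, hlT, rfl⟩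
      · refine (Language.mem_add _ _ _).mpr (Or.inl ?_)
        intro s hs
        obtain ⟨s', hs', rfl⟩ := List.mem_map.mp hs
        exact ⟨(h s' hs').1, by simpa using (h s' hs').2⟩
      · refine (Language.mem_add _ _ _).mpr (Or.inr
          ⟨l.map π, hl.map π.injective, ?_, ?_⟩)
        · ext t
          simp [← hlT, ← Equiv.eq_symm_apply]
        · simp [IndexedTrace.permute]

/-- The synchronization alphabet of sync-points, with a unique sync-point symbol. -/
abbrev SyncAlphabet.syncPoint (Act : Type) : SyncAlphabet Act where
  S := Unit
  sync := fun τ => ∃ T : Finset ℕ, SyncPointTrace T τ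
  sync_permute := fun π _ ⟨T, h⟩ => ⟨T.map π.toEmbedding, h.permute π⟩

/-- A parameterized program: a synchronization alphabet and a thread template. -/
structure Program (Act : Type) where
  alphabet : SyncAlphabet Act
  template : CFG Act alphabet.S

namespace Program

variable {Act : Type}

/-- Traces, including synchronization actions, that respect the synchronization discipline and in
which every thread runs from the initial to the exit location or does not run at all. -/
def IsExecution (P : Program Act) (τ : IndexedTrace (Act ⊕ P.alphabet.S)) : Prop :=
  P.alphabet.sync τ ∧ ∀ i, τ.local i ∈ P.template.traces ∪ {[]}

/-- The interleavings of a program. -/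
def lang (P : Program Act) : Set (IndexedTrace Act) :=
  {τ | ∃ τ' : IndexedTrace (Act ⊕ P.alphabet.S), τ = τ'.project Sum.getLeft? ∧ P.IsExecution τ'}

/-- `G'` is a sync-point instrumentation of `P`: erasing the sync-points from the traces of `G'`
gives the traces of the thread template, and traces of `G'` are determined by their actions. -/
def IsSyncPointInstrumentation (P : Program Act) (G' : CFG Act (P.alphabet.S ⊕ Unit)) : Prop :=
  P.template.traces = (fun τ => τ.filterMap SyncAlphabet.eraseRight) '' G'.traces ∧
  ∀ τ₁ ∈ G'.traces, ∀ τ₂ ∈ G'.traces,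
    τ₁.filterMap Sum.getLeft? = τ₂.filterMap Sum.getLeft? → τ₁ = τ₂

/-- The program induced by the sync-point instrumentation `G'` of `P`. -/
abbrev withSyncPoints (P : Program Act) (G' : CFG Act (P.alphabet.S ⊕ Unit)) : Program Act where
  alphabet := P.alphabet.combine (SyncAlphabet.syncPoint Act)
  template := G'

end Program

/-- One swap of adjacent actions `a`, `b` of different threads with `(a, b) ∈ I`. -/
inductive SwapStep {Act : Type} (I : Set (Act × Act)) : IndexedTrace Act → IndexedTrace Act → Prop
  | swap (ρ σ : IndexedTrace Act) (a b : Act) (i j : ℕ) : (a, b) ∈ I → i ≠ j →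
      SwapStep I (ρ ++ (a, i) :: (b, j) :: σ) (ρ ++ (b, j) :: (a, i) :: σ)

/-- The covering preorder of the (semi-)commutativity relation `I`. -/
def CoveredBy {Act : Type} (I : Set (Act × Act)) : IndexedTrace Act → IndexedTrace Act → Prop :=
  Relation.ReflTransGen (SwapStep I)

/-- `L₁` is a Mazurkiewicz reduction of `L₂` up to `I`. -/
def IsMazurkiewiczReduction {Act : Type} (I : Set (Act × Act))
    (L₁ L₂ : Set (IndexedTrace Act)) : Prop :=
  L₁ ⊆ L₂ ∧ ∀ τ ∈ L₂, ∃ τ' ∈ L₁, CoveredBy I τ τ'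

/-- Soundness of the sync-point instrumentation `G'` of `P` with respect to `I`. -/
def SoundInstrumentation {Act : Type} (P : Program Act) (G' : CFG Act (P.alphabet.S ⊕ Unit))
    (I : Set (Act × Act)) : Prop :=
  IsMazurkiewiczReduction I (P.withSyncPoints G').lang P.lang

/-- The number of sync-points in a trace. -/
def syncCount {Act S : Type} (τ : List (Act ⊕ (S ⊕ Unit))) : ℕ :=
  τ.countP fun s => match s with
    | Sum.inr (Sum.inr _) => true
    | _ => false

/-- The phase order: in some execution of the instrumented program, two different threads execute
`a` and `b`, and strictly fewer sync-points precede `a` in its thread than precede `b` in its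
thread. -/
def PhaseOrder {Act : Type} (P : Program Act) (G' : CFG Act (P.alphabet.S ⊕ Unit)) :
    Set (Act × Act) :=
  {p | ∃ τ : IndexedTrace (Act ⊕ (P.alphabet.S ⊕ Unit)), (P.withSyncPoints G').IsExecution τ ∧
    ∃ i j : ℕ, i ≠ j ∧ ∃ τ₁ σ₁ τ₂ σ₂ : List (Act ⊕ (P.alphabet.S ⊕ Unit)),
      τ.local i = τ₁ ++ Sum.inl p.1 :: σ₁ ∧ τ.local j = τ₂ ++ Sum.inl p.2 :: σ₂ ∧
      syncCount τ₁ < syncCount τ₂}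

/-- The numbers of sync-points that can precede an occurrence of `a` in a trace of `G'`. -/
def syncCounts {Act S : Type} (G' : CFG Act (S ⊕ Unit)) (a : Act) : Set ℕ∞ :=
  {c | ∃ τ σ : List (Act ⊕ (S ⊕ Unit)), τ ++ Sum.inl a :: σ ∈ G'.traces ∧ c = (syncCount τ : ℕ∞)}

/-- The minimal number of sync-points before an occurrence of `a`. -/
noncomputable def minSync {Act S : Type} (G' : CFG Act (S ⊕ Unit)) (a : Act) : ℕ∞ :=
  sInf (syncCounts G' a)

/-- The maximal number of sync-points before an occurrence of `a`, possibly infinite. -/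
noncomputable def maxSync {Act S : Type} (G' : CFG Act (S ⊕ Unit)) (a : Act) : ℕ∞ :=
  sSup (syncCounts G' a)

/-- An input of the decision problem: a program over the trivial synchronization alphabet with
thread template `G`, a sync-point instrumentation `G'` of it, and a finite (semi-)commutativity
relation on the actions of `G`, given by the list of its elements. -/
structure SoundnessInput (Act : Type) where
  G : CFG Act Empty
  G' : CFG Act (Empty ⊕ Unit)
  comm : List (Act × Act)
  comm_actions : ∀ p ∈ comm, p.1 ∈ G.actions ∧ p.2 ∈ G.actions
  isInstrumentation :
    Program.IsSyncPointInstrumentation ⟨SyncAlphabet.trivial Act, G⟩ G'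

namespace SoundnessInput

variable {Act : Type}

/-- The program of the input. -/
abbrev program (x : SoundnessInput Act) : Program Act := ⟨SyncAlphabet.trivial Act, x.G⟩

/-- The commutativity relation of the input. -/
def I (x : SoundnessInput Act) : Set (Act × Act) := {p | p ∈ x.comm}

/-- The sync-point instrumentation of the input is sound. -/
def Sound (x : SoundnessInput Act) : Prop := SoundInstrumentation x.program x.G' x.I

/-- The characteristic function of the decision problem. -/
noncomputable def soundness (x : SoundnessInput Act) : Bool :=
  @decide x.Sound (Classical.propDecidable _)

end SoundnessInput

/-- The alphabet in which inputs are written down. -/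
inductive InputSymbol
  | bit (b : Bool)
  | sync
  | comma
  | semicolon
  | bar

/-- A bit string, terminated by a comma. -/
def encodeName (w : List Bool) : List InputSymbol := w.map InputSymbol.bit ++ [InputSymbol.comma]

/-- Encoding of edge labels, for action names given by `name`. -/
def encodeLabel {Act S : Type} (name : Act → List Bool) : Act ⊕ S → List InputSymbol
  | Sum.inl a => encodeName (name a)
  | Sum.inr _ => [InputSymbol.sync, InputSymbol.comma]

/-- Encoding of control flow graphs as edge lists. Numbers are written in binary. The encoding is
used only where there is at most one synchronization action. -/
def encodeCFG {Act S : Type} (name : Act → List Bool) (G : CFG Act S) : List InputSymbol :=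
  encodeName (Computability.encodeNat G.numLoc) ++ encodeName (Computability.encodeNat G.init) ++
    encodeName (Computability.encodeNat G.exit) ++
    (G.edges.flatMap fun e => encodeName (Computability.encodeNat e.1) ++ encodeLabel name e.2.1 ++
      encodeName (Computability.encodeNat e.2.2) ++ [InputSymbol.semicolon]) ++
    [InputSymbol.bar]

/-- Encoding of the inputs of the decision problem. -/
def encodeInput {Act : Type} (name : Act → List Bool) (x : SoundnessInput Act) :
    List InputSymbol :=
  encodeCFG name x.G ++ encodeCFG name x.G' ++
    (x.comm.flatMap fun p => encodeName (name p.1) ++ encodeName (name p.2) ++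
      [InputSymbol.semicolon]) ++
    [InputSymbol.bar]

/-!
Part 2 rests on two observations about sync-points.

* Any two traces of the instrumentation can be executed together, since a thread that has
  terminated no longer takes part in sync-points (`exists_execution`). Hence `(a, b)` is in the
  phase order iff some trace has fewer sync-points before `a` than some trace has before `b`
  (`SyncBefore`), which says that the minimum for `a` is less than the maximum for `b`
  (`SoundnessInput.mem_phaseOrder_iff`, `minSync_lt_maxSync_iff`).
* In an execution, when a thread executes an action, every thread with actions left to execute has
  passed the same number of sync-points (`SyncPointTrace.threadSyncs_eq`). So an
  action that comes after more sync-points of its thread than an action of another thread does is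
  also executed later.

If the instrumentation is sound and `(a, b)` is in the phase order, consider the interleaving in
which the thread with `b` runs to completion before the thread with `a` starts. By the second
observation, and since the sync-points of a thread are determined by its actions, a covering
execution performs the two actions in the opposite order. Swaps preserve the order of these two
occurrences unless `b` may be swapped with `a` (`ExecutesBefore.coveredBy`), so `(b, a) ∈ I`.
Conversely, if the phase order is contained in the inverse of `I`, then the actions before the first
sync-point of every thread can be moved to the front of a given interleaving
(`exists_coveredBy_append`), and induction on the number of sync-points gives an execution that
covers it (`exists_execution` again). In summary, soundness is the condition that
`SyncBefore a b` implies `(b, a) ∈ I` (`SoundnessInput.sound_iff`).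

For part 1, `SyncBefore a b` is a reachability question in the product of the instrumentation with
itself. The first component follows a path to `a`, the second one a path to `b`; both may wait, and
a sync-point in the first component is permitted only together with one in the second. To obtain a
strict inequality, the first component has to pass an additional sync-point before it starts
(`reachablePairs`, `checkSound_iff`). The exit location is reachable from everywhere, so only the
paths up to `a` and `b` matter (`syncBefore_iff_exists_edges`).

That the resulting procedure takes polynomial time is shown by composition. `StackProgram` is a
small structured language for stacks of bits, whose semantics `StackProgram.Runs` counts exactly
the steps of the machine to which a program is compiled (`StackProgram.Runs.reaches`,
`StackProgram.machineOutputs`). Data are binary trees written as words on a stack, and `PolyTime`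
says that a function on data is computed by such programs within polynomially many steps. This
notion is closed under composition, pairing, case distinction and recursion on lists with
intermediate results of polynomial size (`PolyTime.foldl`), which suffices for the parser, the
reachability computation and the final test (`PolyTime.checkParsed`).
-/

/-! ### Structured programs on stacks of bits -/

/-- Structured programs operating on stacks of bits that are numbered by `ℕ`. -/
inductive StackProgram
  | skip
  /-- push a bit on a stack -/
  | push (v : ℕ) (b : Bool)
  | seq (P Q : StackProgram)
  /-- if the stack is empty run `P`, otherwise pop a bit `b` and run `Q b` -/
  | case (v : ℕ) (P : StackProgram) (Q : Bool → StackProgram)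
  /-- as long as the stack is nonempty, pop a bit `b` and run `P b` -/
  | loop (v : ℕ) (P : Bool → StackProgram)

namespace StackProgram

/-- Big-step semantics: `Runs P s s' t` means that `P`, started with the stacks `s`, ends with the
stacks `s'` after exactly `t` steps. -/
inductive Runs : StackProgram → (ℕ → List Bool) → (ℕ → List Bool) → ℕ → Prop
  | skip (s) : Runs skip s s 1
  | push (s v b) : Runs (push v b) s (Function.update s v (b :: s v)) 1
  | seq {P Q s s' s'' t t'} : Runs P s s' t → Runs Q s' s'' t' → Runs (seq P Q) s s'' (t + t')
  | caseNil {v P Q s s' t} : s v = [] → Runs P s s' t → Runs (case v P Q) s s' (t + 1)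
  | caseCons {v P Q s s' t b l} : s v = b :: l → Runs (Q b) (Function.update s v l) s' t →
      Runs (case v P Q) s s' (t + 1)
  | loopNil {v P s} : s v = [] → Runs (loop v P) s s 1
  | loopCons {v P s s' s'' t t' b l} : s v = b :: l →
      Runs (P b) (Function.update s v l) s' t → Runs (loop v P) s' s'' t' →
      Runs (loop v P) s s'' (t' + (t + 1))

/-- All stacks used by the program have numbers below `n`. -/
def UsesBelow (n : ℕ) : StackProgram → Prop
  | skip => True
  | push v _ => v < n
  | seq P Q => UsesBelow n P ∧ UsesBelow n Q
  | case v P Q => v < n ∧ UsesBelow n P ∧ ∀ b, UsesBelow n (Q b)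
  | loop v P => v < n ∧ ∀ b, UsesBelow n (P b)

theorem UsesBelow.mono {m n : ℕ} (hmn : m ≤ n) {P : StackProgram} (h : UsesBelow m P) :
    UsesBelow n P := by
  induction P with
  | skip => trivial
  | push v b => exact lt_of_lt_of_le h hmn
  | seq P Q ihP ihQ => exact ⟨ihP h.1, ihQ h.2⟩
  | case v P Q ihP ihQ => exact ⟨lt_of_lt_of_le h.1 hmn, ihP h.2.1, fun b => ihQ b (h.2.2 b)⟩
  | loop v P ih => exact ⟨lt_of_lt_of_le h.1 hmn, fun b => ih b (h.2 b)⟩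

theorem Runs.length_le {P : StackProgram} {s s' : ℕ → List Bool} {t : ℕ} (h : Runs P s s' t)
    (v : ℕ) : (s' v).length ≤ (s v).length + t := by
  have pop : ∀ {s : ℕ → List Bool} {w : ℕ} {b : Bool} {l : List Bool}, s w = b :: l →
      (Function.update s w l v).length ≤ (s v).length := by
    intro s w b l hs
    rcases eq_or_ne v w with rfl | hv
    · simp [hs]
    · simp [hv]
  induction h with
  | skip => omega
  | push s w b =>
    rcases eq_or_ne v w with rfl | hv
    · simp
    · simp [hv]
  | seq _ _ ih ih' => omega
  | caseNil _ _ ih => omega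
  | caseCons hs _ ih => have := pop hs; omega
  | loopNil _ => omega
  | loopCons hs _ _ ih ih' => have := pop hs; omega

/-! ### Compilation to Turing machines with stacks -/

/-- The labels of the machine code of a program. -/
def Lab : StackProgram → Type
  | skip => Unit
  | push _ _ => Unit
  | seq P Q => Lab P ⊕ Lab Q
  | case _ P Q => Option (Lab P ⊕ (Σ b, Lab (Q b)))
  | loop _ P => Option (Σ b, Lab (P b))

noncomputable instance Lab.fintype : ∀ P : StackProgram, Fintype (Lab P)
  | skip => inferInstanceAs (Fintype Unit)
  | push _ _ => inferInstanceAs (Fintype Unit)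
  | seq P Q =>
    haveI := Lab.fintype P
    haveI := Lab.fintype Q
    inferInstanceAs (Fintype (Lab P ⊕ Lab Q))
  | case _ P Q =>
    haveI := Lab.fintype P
    haveI := fun b => Lab.fintype (Q b)
    inferInstanceAs (Fintype (Option (Lab P ⊕ (Σ b, Lab (Q b)))))
  | loop _ P =>
    haveI := fun b => Lab.fintype (P b)
    inferInstanceAs (Fintype (Option (Σ b, Lab (P b))))

/-- The label at which the execution of a program starts. -/
def entry : ∀ P : StackProgram, Lab P
  | skip => ()
  | push _ _ => ()
  | seq P _ => Sum.inl (entry P)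
  | case _ _ _ => none
  | loop _ _ => none

/-- The stacks of the machine: `none` is the input stack, the other stacks hold bits. -/
abbrev StackSymbol (n : ℕ) : Option (Fin (n + 1)) → Type
  | none => InputSymbol
  | some _ => Bool

/-- The number of a stack as an index of a stack of the machine; it has its intended meaning if
the number is at most `n`. -/
abbrev stackIndex (n v : ℕ) : Option (Fin (n + 1)) := some (Fin.ofNat (n + 1) v)

/-- The stacks of the machine, given the contents of the input stack and of the stacks of bits. -/
def contents (n : ℕ) (inp : List InputSymbol) (s : ℕ → List Bool) :
    ∀ k : Option (Fin (n + 1)), List (StackSymbol n k)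
  | none => inp
  | some i => s i

theorem contents_stackIndex {n v : ℕ} (hv : v < n + 1) (inp : List InputSymbol)
    (s : ℕ → List Bool) : contents n inp s (stackIndex n v) = s v := by
  simp [contents, Nat.mod_eq_of_lt hv]

theorem update_contents_stackIndex {n v : ℕ} (hv : v < n + 1) (inp : List InputSymbol)
    (s : ℕ → List Bool) (l : List Bool) :
    Function.update (contents n inp s) (stackIndex n v) l =
      contents n inp (Function.update s v l) := by
  funext k
  rcases k with _ | i
  · simp [contents]
  · by_cases h : i = Fin.ofNat (n + 1) v
    · subst h
      rw [Function.update_self]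
      simp [contents, Nat.mod_eq_of_lt hv]
    · have h' : (i : ℕ) ≠ v := by
        rintro rfl
        exact h (by simp)
      rw [Function.update_of_ne (by simpa using h)]
      simp [contents, h']

/-- Pop a bit, remember it in the internal state, and jump to a label that depends on it. -/
def popGoto {Λ : Type} (n v : ℕ) (f : Option Bool → Λ) :
    Turing.TM2.Stmt (StackSymbol n) Λ (Option InputSymbol) :=
  .pop (stackIndex n v) (fun _ o => o.map InputSymbol.bit) <| .goto fun x =>
    match x with
    | some (InputSymbol.bit b) => f (some b)
    | _ => f none

/-- The statements of the machine code of a program, whose labels are embedded by `emb` into the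
labels of the whole machine, and which jumps to `exit` in the end. -/
def labelStmt (n : ℕ) {Λ : Type} : ∀ P : StackProgram, (Lab P → Λ) → Λ → Lab P →
    Turing.TM2.Stmt (StackSymbol n) Λ (Option InputSymbol)
  | skip, _, exit => fun _ => .goto fun _ => exit
  | push v b, _, exit => fun _ => .push (stackIndex n v) (fun _ => b) <| .goto fun _ => exit
  | seq P Q, emb, exit => fun l =>
    match l with
    | Sum.inl l => labelStmt n P (fun l => emb (Sum.inl l)) (emb (Sum.inr (entry Q))) l
    | Sum.inr l => labelStmt n Q (fun l => emb (Sum.inr l)) exit l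
  | case v P Q, emb, exit => fun l =>
    match l with
    | none => popGoto n v fun o =>
      match o with
      | none => emb (some (Sum.inl (entry P)))
      | some b => emb (some (Sum.inr ⟨b, entry (Q b)⟩))
    | some (Sum.inl l) => labelStmt n P (fun l => emb (some (Sum.inl l))) exit l
    | some (Sum.inr ⟨b, l⟩) => labelStmt n (Q b) (fun l => emb (some (Sum.inr ⟨b, l⟩))) exit l
  | loop v P, emb, exit => fun l =>
    match l with
    | none => popGoto n v fun o =>
      match o with
      | none => exit
      | some b => emb (some ⟨b, entry (P b)⟩)
    | some ⟨b, l⟩ => labelStmt n (P b) (fun l => emb (some ⟨b, l⟩)) (emb none) l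

/-- The machine `M` goes from the configuration `c` to the configuration `c'` in `t` steps. -/
def Reaches {n : ℕ} {Λ : Type} (M : Λ → Turing.TM2.Stmt (StackSymbol n) Λ (Option InputSymbol))
    (c c' : Turing.TM2.Cfg (StackSymbol n) Λ (Option InputSymbol)) (t : ℕ) : Prop :=
  (flip bind (Turing.TM2.step M))^[t] (some c) = some c'

section Reaches

variable {n : ℕ} {Λ : Type} {M : Λ → Turing.TM2.Stmt (StackSymbol n) Λ (Option InputSymbol)}

theorem Reaches.trans {c c' c'' : Turing.TM2.Cfg (StackSymbol n) Λ (Option InputSymbol)}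
    {t t' : ℕ} (h : Reaches M c c' t) (h' : Reaches M c' c'' t') :
    Reaches M c c'' (t' + t) := by
  unfold Reaches at *
  rw [Function.iterate_add_apply, h, h']

theorem Reaches.single {c c' : Turing.TM2.Cfg (StackSymbol n) Λ (Option InputSymbol)}
    (h : Turing.TM2.step M c = some c') : Reaches M c c' 1 := by
  simp [Reaches, flip, h]

theorem reaches_popGoto_nil {v : ℕ} (hv : v < n + 1) {f : Option Bool → Λ} {l : Λ}
    (hl : M l = popGoto n v f) (inp : List InputSymbol) {s : ℕ → List Bool} (hs : s v = [])
    (x : Option InputSymbol) :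
    Reaches M ⟨some l, x, contents n inp s⟩ ⟨some (f none), none, contents n inp s⟩ 1 := by
  apply Reaches.single
  simp only [Turing.TM2.step, hl, popGoto, Turing.TM2.stepAux, contents_stackIndex hv]
  rw [hs, List.tail_nil, update_contents_stackIndex hv, ← hs, Function.update_eq_self, hs]
  rfl

theorem reaches_popGoto_cons {v : ℕ} (hv : v < n + 1) {f : Option Bool → Λ} {l : Λ}
    (hl : M l = popGoto n v f) (inp : List InputSymbol) {s : ℕ → List Bool} {b : Bool}
    {w : List Bool} (hs : s v = b :: w) (x : Option InputSymbol) :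
    Reaches M ⟨some l, x, contents n inp s⟩
      ⟨some (f (some b)), some (InputSymbol.bit b), contents n inp (Function.update s v w)⟩ 1 := by
  apply Reaches.single
  simp only [Turing.TM2.step, hl, popGoto, Turing.TM2.stepAux, contents_stackIndex hv]
  rw [hs, List.tail_cons, update_contents_stackIndex hv]
  rfl

/-- Correctness of the compilation: the machine code takes exactly the number of steps that the
semantics counts. -/
theorem Runs.reaches {P : StackProgram} {s s' : ℕ → List Bool} {t : ℕ} (h : Runs P s s' t)
    (hP : P.UsesBelow (n + 1)) (inp : List InputSymbol) (emb : Lab P → Λ) (exit : Λ)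
    (hM : ∀ l, M (emb l) = labelStmt n P emb exit l) (x : Option InputSymbol) :
    ∃ x', Reaches M ⟨some (emb (entry P)), x, contents n inp s⟩
      ⟨some exit, x', contents n inp s'⟩ t := by
  induction h generalizing exit x with
  | skip s =>
    exact ⟨x, Reaches.single (by simp [hM, labelStmt])⟩
  | push s v b =>
    refine ⟨x, Reaches.single ?_⟩
    simp only [Turing.TM2.step, hM, labelStmt, Turing.TM2.stepAux, contents_stackIndex hP]
    rw [update_contents_stackIndex hP]
  | @seq P Q s s' s'' t t' _ _ ih ih' =>
    obtain ⟨x₁, h₁⟩ := ih hP.1 (fun l => emb (Sum.inl l)) (emb (Sum.inr (entry Q)))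
      (fun l => (hM (Sum.inl l)).trans (by simp only [labelStmt])) x
    obtain ⟨x₂, h₂⟩ := ih' hP.2 (fun l => emb (Sum.inr l)) exit
      (fun l => (hM (Sum.inr l)).trans (by simp only [labelStmt])) x₁
    exact ⟨x₂, by simpa [add_comm, entry] using h₁.trans h₂⟩
  | @caseNil v P Q s s' t hs _ ih =>
    obtain ⟨x₁, h₁⟩ := ih hP.2.1 (fun l => emb (some (Sum.inl l))) exit
      (fun l => (hM (some (Sum.inl l))).trans (by simp only [labelStmt])) none
    exact ⟨x₁, (reaches_popGoto_nil hP.1 ((hM none).trans (by simp only [labelStmt]; rfl))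
      inp hs x).trans h₁⟩
  | @caseCons v P Q s s' t b l hs _ ih =>
    obtain ⟨x₁, h₁⟩ := ih (hP.2.2 b) (fun l => emb (some (Sum.inr ⟨b, l⟩))) exit
      (fun l => (hM (some (Sum.inr ⟨b, l⟩))).trans (by simp only [labelStmt])) (some (InputSymbol.bit b))
    exact ⟨x₁, (reaches_popGoto_cons hP.1 ((hM none).trans (by simp only [labelStmt]; rfl))
      inp hs x).trans h₁⟩
  | @loopNil v P s hs =>
    refine ⟨none, ?_⟩
    have := reaches_popGoto_nil hP.1 ((hM none).trans (by simp only [labelStmt]; rfl)) inp hs x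
    exact this
  | @loopCons v P s s' s'' t t' b l hs _ _ ih ih' =>
    obtain ⟨x₁, h₁⟩ := ih (hP.2 b) (fun l => emb (some ⟨b, l⟩)) (emb none)
      (fun l => (hM (some ⟨b, l⟩)).trans (by simp only [labelStmt])) (some (InputSymbol.bit b))
    obtain ⟨x₂, h₂⟩ := ih' hP emb exit hM x₁
    exact ⟨x₂, ((reaches_popGoto_cons hP.1 ((hM none).trans (by simp only [labelStmt]; rfl))
      inp hs x).trans h₁).trans h₂⟩

end Reaches

/-! ### The machine that loads its input and runs a program -/

instance : Fintype InputSymbol where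
  elems := ⟨([InputSymbol.bit true, InputSymbol.bit false, InputSymbol.sync, InputSymbol.comma,
    InputSymbol.semicolon, InputSymbol.bar] : List InputSymbol), by simp⟩
  complete := by
    rintro (b | _ | _ | _ | _)
    · cases b <;> simp
    all_goals simp

/-- The labels of the machine that loads its input and runs a program. -/
inductive MachineLabel (P : StackProgram)
  | start
  /-- read one input symbol -/
  | load
  /-- translate an input symbol to bits -/
  | emit (c : InputSymbol)
  /-- run the program -/
  | run (l : Lab P)
  | finish

/-- The labels of the machine as a sum type. -/
def MachineLabel.toSum {P : StackProgram} :
    MachineLabel P → (Unit ⊕ Unit ⊕ Unit) ⊕ (InputSymbol ⊕ Lab P)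
  | start => .inl (.inl ())
  | load => .inl (.inr (.inl ()))
  | finish => .inl (.inr (.inr ()))
  | emit c => .inr (.inl c)
  | run l => .inr (.inr l)

theorem MachineLabel.toSum_injective {P : StackProgram} :
    Function.Injective (MachineLabel.toSum (P := P)) := by
  intro a b h
  cases a <;> cases b <;> simp_all [toSum]

noncomputable instance (P : StackProgram) : Fintype (MachineLabel P) :=
  Fintype.ofInjective _ MachineLabel.toSum_injective

/-- Push a word on a stack, then continue with `q`. -/
def pushWord {Λ : Type} (n v : ℕ) (w : List Bool)
    (q : Turing.TM2.Stmt (StackSymbol n) Λ (Option InputSymbol)) :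
    Turing.TM2.Stmt (StackSymbol n) Λ (Option InputSymbol) :=
  w.foldr (fun b q => .push (stackIndex n v) (fun _ => b) q) q

theorem stepAux_pushWord {Λ : Type} {n v : ℕ} (hv : v < n + 1) (w : List Bool)
    (q : Turing.TM2.Stmt (StackSymbol n) Λ (Option InputSymbol)) (x : Option InputSymbol)
    (inp : List InputSymbol) (s : ℕ → List Bool) :
    Turing.TM2.stepAux (pushWord n v w q) x (contents n inp s) =
      Turing.TM2.stepAux q x (contents n inp (Function.update s v (w.reverse ++ s v))) := by
  induction w generalizing s with
  | nil => simp [pushWord]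
  | cons b w ih =>
    have := ih (Function.update s v (b :: s v))
    simp only [pushWord, List.foldr_cons, Turing.TM2.stepAux, contents_stackIndex hv] at this ⊢
    rw [update_contents_stackIndex hv, this]
    simp

/-- The statements of the machine that translates each input symbol `c` to the word `w c`, writes
these words on stack `0` on top of the word `w₀`, and then runs a program. -/
def machineCode (n : ℕ) (P : StackProgram) (w₀ : List Bool) (w : InputSymbol → List Bool) :
    MachineLabel P → Turing.TM2.Stmt (StackSymbol n) (MachineLabel P) (Option InputSymbol)
  | .start => pushWord n 0 w₀.reverse (.goto fun _ => .load)
  | .load => .pop none (fun _ o => o) <| .goto fun x =>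
    match x with
    | none => .run (entry P)
    | some c => .emit c
  | .emit c => pushWord n 0 (w c).reverse (.goto fun _ => .load)
  | .run l => labelStmt n P .run .finish l
  | .finish => .load (fun _ => none) .halt

/-- The input is read from its front, so its translation ends up in reverse order. -/
theorem reaches_load (n : ℕ) (P : StackProgram) (w₀ : List Bool) (w : InputSymbol → List Bool)
    (inp : List InputSymbol) (s : ℕ → List Bool) (x : Option InputSymbol) :
    Reaches (machineCode n P w₀ w) ⟨some .load, x, contents n inp s⟩
      ⟨some (.run (entry P)), none,
        contents n [] (Function.update s 0 (inp.reverse.flatMap w ++ s 0))⟩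
      (2 * inp.length + 1) := by
  induction inp generalizing s x with
  | nil =>
    apply Reaches.single
    simp [machineCode, contents]
  | cons c inp ih =>
    have h₁ : Reaches (machineCode n P w₀ w) ⟨some .load, x, contents n (c :: inp) s⟩
        ⟨some (.emit c), some c, contents n inp s⟩ 1 := by
      apply Reaches.single
      simp only [machineCode, Turing.TM2.step, Turing.TM2.stepAux]
      congr 2
      funext k
      cases k <;> simp [contents]
    have h₂ : Reaches (machineCode n P w₀ w) ⟨some (.emit c), some c, contents n inp s⟩
        ⟨some .load, some c, contents n inp (Function.update s 0 (w c ++ s 0))⟩ 1 := by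
      apply Reaches.single
      simp [machineCode, stepAux_pushWord]
    have := (h₁.trans h₂).trans (ih (Function.update s 0 (w c ++ s 0)) (some c))
    simpa [mul_add, add_assoc] using this

/-- The machine that loads its input and runs a program. -/
noncomputable def machine (n : ℕ) (P : StackProgram) (w₀ : List Bool)
    (w : InputSymbol → List Bool) : Turing.FinTM2 where
  K := Option (Fin (n + 1))
  k₀ := none
  k₁ := stackIndex n 0
  Γ := StackSymbol n
  Λ := MachineLabel P
  main := .start
  σ := Option InputSymbol
  initialState := none
  Γk₀Fin := inferInstanceAs (Fintype InputSymbol)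
  m := machineCode n P w₀ w

/-- A program that turns the translated input into the output and clears all other stacks gives
rise to a Turing machine. -/
noncomputable def machineOutputs {n : ℕ} {P : StackProgram} (hP : P.UsesBelow (n + 1))
    (w₀ : List Bool) (w : InputSymbol → List Bool) (inp : List InputSymbol) (out : List Bool)
    (T : ℕ)
    (h : ∃ t ≤ T, Runs P (Function.update (fun _ => []) 0 (inp.reverse.flatMap w ++ w₀))
      (Function.update (fun _ => []) 0 out) t) :
    Turing.TM2OutputsInTime (machine n P w₀ w) inp (some out) (T + (2 * inp.length + 3)) := by
  let t := h.choose
  have ht : t ≤ T := h.choose_spec.1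
  have hrun := h.choose_spec.2
  refine ⟨⟨t + (2 * inp.length + 3), ?_⟩, Nat.add_le_add_right ht _⟩
  have h₁ : Reaches (machineCode n P w₀ w) ⟨some .start, none, contents n inp (fun _ => [])⟩
      ⟨some .load, none, contents n inp (Function.update (fun _ => []) 0 w₀)⟩ 1 := by
    apply Reaches.single
    simp [machineCode, stepAux_pushWord]
  have h₂ := reaches_load n P w₀ w inp (Function.update (fun _ => []) 0 w₀) none
  simp only [Function.update_idem, Function.update_self] at h₂
  obtain ⟨x, h₃⟩ := hrun.reaches (M := machineCode n P w₀ w) hP [] MachineLabel.run .finish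
    (fun l => rfl) none
  have h₄ : Reaches (machineCode n P w₀ w)
      ⟨some .finish, x, contents n [] (Function.update (fun _ => []) 0 out)⟩
      ⟨none, none, contents n [] (Function.update (fun _ => []) 0 out)⟩ 1 := by
    apply Reaches.single
    simp [machineCode]
  have h₅ := ((h₁.trans h₂).trans h₃).trans h₄
  have hsteps : 1 + (t + (2 * inp.length + 1 + 1)) = t + (2 * inp.length + 3) := by omega
  have hinit : Turing.initList (machine n P w₀ w) inp =
      ⟨some .start, none, contents n inp (fun _ => [])⟩ := by
    refine congrArg (Turing.TM2.Cfg.mk _ _) ?_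
    funext k
    cases k <;> rfl
  have hhalt : Turing.haltList (machine n P w₀ w) out =
      ⟨none, none, contents n [] (Function.update (fun _ => []) 0 out)⟩ := by
    refine congrArg (Turing.TM2.Cfg.mk _ _) ?_
    funext k
    rcases k with _ | i
    · rfl
    · by_cases hi : i = 0
      · subst hi
        rfl
      · have h0 : (some i : Option (Fin (n + 1))) ≠ stackIndex n 0 := by
          simpa [stackIndex] using hi
        have h0' : (i : ℕ) ≠ 0 := fun h => hi (Fin.ext h)
        refine (dif_neg h0).trans ?_
        simp only [contents, Function.update_of_ne h0']
        rfl
  have h₆ : Reaches (machineCode n P w₀ w) (Turing.initList (machine n P w₀ w) inp)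
      (Turing.haltList (machine n P w₀ w) out) (t + (2 * inp.length + 3)) := by
    rw [← hsteps]
    exact hinit ▸ hhalt ▸ h₅
  exact h₆

end StackProgram

namespace StackProgram

/-! ### Running times of basic programs -/

/-- `Terminates P s s' T`: the program `P` turns the stacks `s` into `s'` within `T` steps. -/
def Terminates (P : StackProgram) (s s' : ℕ → List Bool) (T : ℕ) : Prop :=
  ∃ t ≤ T, Runs P s s' t

namespace Terminates

variable {P Q : StackProgram} {s s' s'' : ℕ → List Bool} {T T' : ℕ}

theorem mono (h : Terminates P s s' T) (hT : T ≤ T') : Terminates P s s' T' :=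
  let ⟨t, ht, hr⟩ := h
  ⟨t, ht.trans hT, hr⟩

theorem skip (s : ℕ → List Bool) : Terminates skip s s 1 := ⟨1, le_rfl, .skip s⟩

theorem push (s : ℕ → List Bool) (v : ℕ) (b : Bool) :
    Terminates (push v b) s (Function.update s v (b :: s v)) 1 := ⟨1, le_rfl, .push s v b⟩

theorem seq (h : Terminates P s s' T) (h' : Terminates Q s' s'' T') :
    Terminates (seq P Q) s s'' (T + T') :=
  let ⟨t, ht, hr⟩ := h
  let ⟨t', ht', hr'⟩ := h'
  ⟨t + t', add_le_add ht ht', .seq hr hr'⟩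

theorem case_nil {v : ℕ} {Q : Bool → StackProgram} (hs : s v = []) (h : Terminates P s s' T) :
    Terminates (case v P Q) s s' (T + 1) :=
  let ⟨t, ht, hr⟩ := h
  ⟨t + 1, by omega, .caseNil hs hr⟩

theorem case_cons {v : ℕ} {Q : Bool → StackProgram} {b : Bool} {l : List Bool}
    (hs : s v = b :: l) (h : Terminates (Q b) (Function.update s v l) s' T) :
    Terminates (case v P Q) s s' (T + 1) :=
  let ⟨t, ht, hr⟩ := h
  ⟨t + 1, by omega, .caseCons hs hr⟩

theorem loop_nil {v : ℕ} {Q : Bool → StackProgram} (hs : s v = []) :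
    Terminates (loop v Q) s s 1 :=
  ⟨1, le_rfl, .loopNil hs⟩

theorem loop_cons {v : ℕ} {Q : Bool → StackProgram} {b : Bool} {l : List Bool}
    (hs : s v = b :: l) (h : Terminates (Q b) (Function.update s v l) s' T)
    (h' : Terminates (loop v Q) s' s'' T') : Terminates (loop v Q) s s'' (T + T' + 1) :=
  let ⟨t, ht, hr⟩ := h
  let ⟨t', ht', hr'⟩ := h'
  ⟨t' + (t + 1), by omega, .loopCons hs hr hr'⟩

end Terminates

/-- Remove all symbols from a stack. -/
def clear (v : ℕ) : StackProgram := loop v fun _ => skip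

/-- Move all symbols of the stack `v` to the stack `w`, which reverses their order. -/
def move (v w : ℕ) : StackProgram := loop v fun b => push w b

/-- Move all symbols of the stack `v` both to `w` and to `w'`. -/
def moveTwo (v w w' : ℕ) : StackProgram := loop v fun b => seq (push w b) (push w' b)

theorem terminates_clear (s : ℕ → List Bool) (v : ℕ) :
    Terminates (clear v) s (Function.update s v []) (2 * (s v).length + 1) := by
  generalize hl : s v = l
  induction l generalizing s with
  | nil =>
    rw [← hl, Function.update_eq_self]
    exact (Terminates.loop_nil hl).mono (by simp)
  | cons b l ih =>
    have := Terminates.loop_cons (Q := fun _ => skip) hl (.skip _)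
      (ih (Function.update s v l) (by simp))
    rw [Function.update_idem] at this
    exact this.mono (by simp; omega)

theorem terminates_move (s : ℕ → List Bool) {v w : ℕ} (hvw : v ≠ w) :
    Terminates (move v w) s
      (Function.update (Function.update s v []) w ((s v).reverse ++ s w))
      (2 * (s v).length + 1) := by
  generalize hl : s v = l
  induction l generalizing s with
  | nil =>
    have : Function.update s v [] = s := by rw [← hl, Function.update_eq_self]
    simp only [this, List.reverse_nil, List.nil_append, Function.update_eq_self]
    exact .loop_nil hl
  | cons b l ih =>
    have := Terminates.loop_cons (Q := fun b => push w b) hl (.push _ _ _)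
      (ih (Function.update (Function.update s v l) w
        (b :: Function.update s v l w)) (by simp [hvw]))
    simp only [Function.update_comm hvw, Function.update_idem, Function.update_self,
      Function.update_of_ne hvw.symm] at this
    rw [Function.update_comm hvw]
    simp only [List.reverse_cons, List.append_assoc, List.singleton_append]
    exact this.mono (by simp; omega)

theorem terminates_moveTwo (s : ℕ → List Bool) {v w w' : ℕ} (hvw : v ≠ w) (hvw' : v ≠ w')
    (hww' : w ≠ w') :
    Terminates (moveTwo v w w') s
      (Function.update (Function.update (Function.update s v []) w ((s v).reverse ++ s w))
        w' ((s v).reverse ++ s w')) (3 * (s v).length + 1) := by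
  generalize hl : s v = l
  induction l generalizing s with
  | nil =>
    have : Function.update s v [] = s := by rw [← hl, Function.update_eq_self]
    simp only [this, List.reverse_nil, List.nil_append, Function.update_eq_self]
    exact .loop_nil hl
  | cons b l ih =>
    have h := Terminates.loop_cons (Q := fun b => seq (push w b) (push w' b)) hl
      ((Terminates.push _ _ _).seq (.push _ _ _)) (ih _ (by simp [hvw, hvw']))
    refine Eq.subst (motive := fun s'' => Terminates _ s s'' _) ?_ (h.mono ?_)
    · funext j
      by_cases h1 : j = w' <;> by_cases h2 : j = w <;> by_cases h3 : j = v <;>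
        simp_all [Function.update_apply]
    · simp
      omega

/-! ### Frames of four stacks -/

/-- The stacks below `k` are given by `L`, the four stacks from `k` on hold `a`, `b`, `c`, `d`, and
all other stacks are empty. -/
def frame (L : ℕ → List Bool) (k : ℕ) (a b c d : List Bool) : ℕ → List Bool := fun j =>
  if j < k then L j else if j = k then a else if j = k + 1 then b else if j = k + 2 then c
  else if j = k + 3 then d else []

section frame

variable (L : ℕ → List Bool) (k : ℕ) (a b c d x : List Bool)

@[simp] theorem frame_zero : frame L k a b c d k = a := by simp [frame]
@[simp] theorem frame_one : frame L k a b c d (k + 1) = b := by simp [frame]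
@[simp] theorem frame_two : frame L k a b c d (k + 2) = c := by simp [frame]
@[simp] theorem frame_three : frame L k a b c d (k + 3) = d := by simp [frame]

@[simp] theorem update_frame_zero :
    Function.update (frame L k a b c d) k x = frame L k x b c d := by
  funext j
  simp only [Function.update_apply, frame]
  split_ifs <;> first | rfl | omega

@[simp] theorem update_frame_one :
    Function.update (frame L k a b c d) (k + 1) x = frame L k a x c d := by
  funext j
  simp only [Function.update_apply, frame]
  split_ifs <;> first | rfl | omega

@[simp] theorem update_frame_two :
    Function.update (frame L k a b c d) (k + 2) x = frame L k a b x d := by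
  funext j
  simp only [Function.update_apply, frame]
  split_ifs <;> first | rfl | omega

@[simp] theorem update_frame_three :
    Function.update (frame L k a b c d) (k + 3) x = frame L k a b c x := by
  funext j
  simp only [Function.update_apply, frame]
  split_ifs <;> first | rfl | omega

theorem frame_eq_frame_succ :
    frame L k a b c d = frame (Function.update L k a) (k + 1) b c d [] := by
  funext j
  simp only [Function.update_apply, frame]
  split_ifs <;> first | rfl | omega

variable {L k a b c d} in
theorem Terminates.case_frame {P : StackProgram} {Q : Bool → StackProgram} {s' : ℕ → List Bool}
    {T : ℕ} {x : Bool} (h : Terminates (Q x) (frame L k a b c d) s' T) :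
    Terminates (case k P Q) (frame L k (x :: a) b c d) s' (T + 1) :=
  .case_cons (frame_zero ..) (by rwa [update_frame_zero])

theorem update_eq_frame_zero :
    Function.update (fun _ => []) 0 a = frame L 0 a [] [] [] := by
  funext j
  simp only [Function.update_apply, frame]
  split_ifs <;> first | rfl | omega

end frame

end StackProgram

/-! ### Binary trees as words -/

/-- Binary trees, the universal data type of the polynomial-time computations below. -/
inductive BinTree
  | nil
  | node (a b : BinTree)

/-- A tree as a word, in preorder. -/
def BinTree.word : BinTree → List Bool
  | nil => [false]
  | node a b => true :: (a.word ++ b.word)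

theorem BinTree.word_append_inj {a b : BinTree} {u v : List Bool}
    (h : a.word ++ u = b.word ++ v) : a = b ∧ u = v := by
  induction a generalizing b u v with
  | nil => cases b <;> simp_all [word]
  | node a a' ih ih' =>
    cases b with
    | nil => simp [word] at h
    | node b b' =>
      simp only [word, List.cons_append, List.append_assoc, List.cons.injEq, true_and] at h
      obtain ⟨rfl, h₁⟩ := ih h
      obtain ⟨rfl, h₂⟩ := ih' h₁
      exact ⟨rfl, h₂⟩

theorem BinTree.word_injective : Function.Injective BinTree.word := fun a b h =>
  (word_append_inj (u := []) (v := []) (by simpa using h)).1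

theorem BinTree.word_ne_nil (a : BinTree) : a.word ≠ [] := by
  cases a <;> simp [word]

namespace StackProgram

/-- Move the first of several consecutive trees on stack `k` to the stack `k + 2`. The stack
`k + 1` holds one symbol for each subtree that still has to be read. -/
def split (k : ℕ) : StackProgram :=
  seq (push (k + 1) true) <| loop (k + 1) fun _ => case k skip fun c =>
    seq (push (k + 2) c) (if c then seq (push (k + 1) true) (push (k + 1) true) else skip)

/-- One symbol of the stack `k + 1` pays for the tree on top of the stack `k`; the rest of the
computation is described by `h`. -/
theorem terminates_split_loop (L : ℕ → List Bool) (k : ℕ) (a : BinTree) (r u v w : List Bool)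
    (x : Bool) {s' : ℕ → List Bool} {T : ℕ}
    (h : Terminates (loop (k + 1) fun _ => case k skip fun c => seq (push (k + 2) c)
      (if c then seq (push (k + 1) true) (push (k + 1) true) else skip))
      (frame L k r u (a.word.reverse ++ v) w) s' T) :
    Terminates (loop (k + 1) fun _ => case k skip fun c => seq (push (k + 2) c)
      (if c then seq (push (k + 1) true) (push (k + 1) true) else skip))
      (frame L k (a.word ++ r) (x :: u) v w) s' (T + 5 * a.word.length) := by
  induction a generalizing r u v x T with
  | nil =>
    refine Terminates.mono (.loop_cons (s' := frame L k r u (false :: v) w) (T := 1 + 1 + 1)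
      (b := x) (l := u) (by simp) ?_ (by simpa [BinTree.word] using h)) (by
        simp [BinTree.word]; omega)
    rw [update_frame_one]
    refine .case_cons (b := false) (l := r) (by simp [BinTree.word]) ?_
    rw [update_frame_zero]
    refine .seq (.push _ _ _) ?_
    simpa using Terminates.skip (frame L k r u (false :: v) w)
  | node a b iha ihb =>
    have h₁ := ihb r u (a.word.reverse ++ true :: v) true (by simpa [BinTree.word] using h)
    have h₂ := iha (b.word ++ r) (true :: u) (true :: v) true h₁
    refine Terminates.mono (.loop_cons (b := x) (l := u)
      (s' := frame L k (a.word ++ (b.word ++ r)) (true :: true :: u) (true :: v) w)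
      (T := 1 + (1 + 1) + 1) (by simp) ?_ h₂) (by simp [BinTree.word]; omega)
    rw [update_frame_one]
    refine .case_cons (b := true) (l := a.word ++ (b.word ++ r)) (by simp [BinTree.word]) ?_
    rw [update_frame_zero]
    refine .seq (T' := 1 + 1) (.push _ _ _) ?_
    simp only [if_true]
    refine .seq (.push _ _ _) ?_
    simpa using Terminates.push
      (frame L k (a.word ++ (b.word ++ r)) (true :: u) (true :: v) w) (k + 1) true

theorem terminates_split (L : ℕ → List Bool) (k : ℕ) (a : BinTree) (r w : List Bool) :
    Terminates (split k) (frame L k (a.word ++ r) [] [] w)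
      (frame L k r [] a.word.reverse w) (5 * a.word.length + 2) := by
  have h₁ := Terminates.push (frame L k (a.word ++ r) [] [] w) (k + 1) true
  have h₂ := terminates_split_loop L k a r [] [] w true
    (s' := frame L k r [] a.word.reverse w) (T := 1)
    (by simpa using Terminates.loop_nil (s := frame L k r [] a.word.reverse w) (by simp))
  rw [update_frame_one] at h₁
  exact (h₁.seq (by simpa using h₂)).mono (by omega)

/-- Replace a tree `node a b` on stack `k` by `a`. -/
def left (k : ℕ) : StackProgram :=
  case k skip fun c => if c then seq (split k) (seq (clear k) (move (k + 2) k)) else push k false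

/-- Replace a tree `node a b` on stack `k` by `b`. -/
def right (k : ℕ) : StackProgram :=
  case k skip fun c => if c then seq (split k) (clear (k + 2)) else push k false

end StackProgram

/-- The left subtree. -/
def BinTree.left : BinTree → BinTree
  | nil => nil
  | node a _ => a

/-- The right subtree. -/
def BinTree.right : BinTree → BinTree
  | nil => nil
  | node _ b => b

namespace StackProgram

theorem terminates_left (L : ℕ → List Bool) (k : ℕ) (a : BinTree) :
    Terminates (left k) (frame L k a.word [] [] []) (frame L k a.left.word [] [] [])
      (9 * a.word.length + 9) := by
  cases a with
  | nil =>
    refine Terminates.mono (.case_cons (b := false) (l := []) (T := 1) (by simp [BinTree.word]) ?_)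
      (by omega)
    simpa [BinTree.word, BinTree.left] using Terminates.push (frame L k [] [] [] []) k false
  | node a b =>
    have h₁ := terminates_clear (frame L k b.word [] a.word.reverse []) k
    have h₂ := terminates_move (frame L k [] [] a.word.reverse []) (v := k + 2) (w := k) (by omega)
    simp only [frame_zero, frame_two, update_frame_zero, update_frame_two, List.append_nil,
      List.reverse_reverse, List.length_reverse] at h₁ h₂
    have h₃ := (terminates_split L k a b.word []).seq (h₁.seq h₂)
    exact (Terminates.case_frame (x := true) h₃).mono (by simp [BinTree.word]; omega)

theorem terminates_right (L : ℕ → List Bool) (k : ℕ) (a : BinTree) :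
    Terminates (right k) (frame L k a.word [] [] []) (frame L k a.right.word [] [] [])
      (9 * a.word.length + 9) := by
  cases a with
  | nil =>
    refine Terminates.mono (.case_cons (b := false) (l := []) (T := 1) (by simp [BinTree.word]) ?_)
      (by omega)
    simpa [BinTree.word, BinTree.right] using Terminates.push (frame L k [] [] [] []) k false
  | node a b =>
    have h₁ := terminates_clear (frame L k b.word [] a.word.reverse []) (k + 2)
    simp only [frame_two, update_frame_two, List.length_reverse] at h₁
    have h₂ := (terminates_split L k a b.word []).seq h₁
    exact (Terminates.case_frame (x := true) h₂).mono (by simp [BinTree.word]; omega)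

/-- Push a word on a stack. -/
def pushList (v : ℕ) (w : List Bool) : StackProgram := w.foldr (fun b P => seq P (push v b)) skip

theorem terminates_pushList (s : ℕ → List Bool) (v : ℕ) (w : List Bool) :
    Terminates (pushList v w) s (Function.update s v (w ++ s v)) (w.length + 1) := by
  induction w with
  | nil => simpa [pushList] using Terminates.skip s
  | cons b w ih => simpa [pushList] using ih.seq (.push _ v b)

theorem usesBelow_pushList {n v : ℕ} (hv : v < n) (w : List Bool) :
    (pushList v w).UsesBelow n := by
  induction w with
  | nil => trivial
  | cons b w ih => exact ⟨ih, hv⟩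

/-- Replace the content of the stack `k` by a fixed word. -/
def const (w : List Bool) (k : ℕ) : StackProgram := seq (clear k) (pushList k w)

theorem terminates_const (L : ℕ → List Bool) (k : ℕ) (a w : List Bool) :
    Terminates (const w k) (frame L k a [] [] []) (frame L k w [] [] [])
      (2 * a.length + w.length + 2) := by
  have h₁ := terminates_clear (frame L k a [] [] []) k
  have h₂ := terminates_pushList (frame L k [] [] [] []) k w
  simp only [update_frame_zero, frame_zero, List.append_nil] at h₁ h₂
  exact (h₁.seq h₂).mono (by omega)

/-- Apply `P` and `Q` to the content of stack `k`, and combine the two results to a tree. Both run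
on a copy on stack `k + 1`, where they may use all higher stacks; the other copy and then the first
result wait on stack `k`. -/
def pair (P Q : ℕ → StackProgram) (k : ℕ) : StackProgram :=
  seq (move k (k + 2)) <| seq (moveTwo (k + 2) k (k + 1)) <| seq (P (k + 1)) <|
  seq (move (k + 1) (k + 2)) <| seq (move k (k + 3)) <| seq (move (k + 2) k) <|
  seq (move (k + 3) (k + 1)) <| seq (Q (k + 1)) <|
  seq (move k (k + 2)) <| seq (move (k + 1) (k + 3)) <| seq (move (k + 3) k) <|
  seq (move (k + 2) k) (push k true)

theorem terminates_pair {P Q : ℕ → StackProgram} {a x y : List Bool} {T T' : ℕ}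
    (hP : ∀ k L, Terminates (P k) (frame L k a [] [] []) (frame L k x [] [] []) T)
    (hQ : ∀ k L, Terminates (Q k) (frame L k a [] [] []) (frame L k y [] [] []) T')
    (L : ℕ → List Bool) (k : ℕ) :
    Terminates (pair P Q k) (frame L k a [] [] []) (frame L k (true :: (x ++ y)) [] [] [])
      (T + T' + 9 * a.length + 8 * x.length + 4 * y.length + 12) := by
  have h₁ := terminates_move (frame L k a [] [] []) (v := k) (w := k + 2) (by omega)
  have h₂ := terminates_moveTwo (frame L k [] [] a.reverse []) (v := k + 2) (w := k)
    (w' := k + 1) (by omega) (by omega) (by omega)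
  have h₃ := hP (k + 1) (Function.update L k a)
  rw [← frame_eq_frame_succ, ← frame_eq_frame_succ] at h₃
  have h₄ := terminates_move (frame L k a x [] []) (v := k + 1) (w := k + 2) (by omega)
  have h₅ := terminates_move (frame L k a [] x.reverse []) (v := k) (w := k + 3) (by omega)
  have h₆ := terminates_move (frame L k [] [] x.reverse a.reverse) (v := k + 2) (w := k)
    (by omega)
  have h₇ := terminates_move (frame L k x [] [] a.reverse) (v := k + 3) (w := k + 1) (by omega)
  have h₈ := hQ (k + 1) (Function.update L k x)
  rw [← frame_eq_frame_succ, ← frame_eq_frame_succ] at h₈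
  have h₉ := terminates_move (frame L k x y [] []) (v := k) (w := k + 2) (by omega)
  have h₁₀ := terminates_move (frame L k [] y x.reverse []) (v := k + 1) (w := k + 3) (by omega)
  have h₁₁ := terminates_move (frame L k [] [] x.reverse y.reverse) (v := k + 3) (w := k)
    (by omega)
  have h₁₂ := terminates_move (frame L k y [] x.reverse []) (v := k + 2) (w := k) (by omega)
  have h₁₃ := Terminates.push (frame L k (x ++ y) [] [] []) k true
  simp only [frame_zero, frame_one, frame_two, frame_three, update_frame_zero, update_frame_one,
    update_frame_two, update_frame_three, List.append_nil, List.reverse_reverse,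
    List.length_reverse] at h₁ h₂ h₄ h₅ h₆ h₇ h₉ h₁₀ h₁₁ h₁₂ h₁₃
  exact (h₁.seq <| h₂.seq <| h₃.seq <| h₄.seq <| h₅.seq <| h₆.seq <| h₇.seq <| h₈.seq <|
    h₉.seq <| h₁₀.seq <| h₁₁.seq <| h₁₂.seq h₁₃).mono (by omega)

/-- Compare the words on the stacks `k` and `k + 1`, as far as the latter reaches. The stack
`k + 2` becomes nonempty if a difference is found. -/
def compare (k : ℕ) : StackProgram :=
  loop (k + 1) fun c => case k (push (k + 2) true) fun d =>
    if c = d then skip else push (k + 2) true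

theorem terminates_compare (L : ℕ → List Bool) (k : ℕ) (a b c : List Bool) :
    ∃ a' c', (a = b ∧ c = [] ↔ a' = [] ∧ c' = []) ∧ a'.length ≤ a.length ∧
      c'.length ≤ c.length + b.length ∧
      Terminates (compare k) (frame L k a b c []) (frame L k a' [] c' []) (3 * b.length + 1) := by
  induction b generalizing a c with
  | nil => exact ⟨a, c, Iff.rfl, le_rfl, by simp, Terminates.loop_nil (by simp)⟩
  | cons x b ih =>
    have step : ∀ {a₁ a₂ c₂ : List Bool},
        Terminates (case k (push (k + 2) true) fun d => if x = d then skip else push (k + 2) true)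
          (frame L k a₁ b c []) (frame L k a₂ b c₂ []) 2 →
        a₂.length ≤ a₁.length → c₂.length ≤ c.length + 1 →
        (a₁ = x :: b ∧ c = [] ↔ a₂ = b ∧ c₂ = []) →
        ∃ a' c', (a₁ = x :: b ∧ c = [] ↔ a' = [] ∧ c' = []) ∧ a'.length ≤ a₁.length ∧
          c'.length ≤ c.length + (x :: b).length ∧
          Terminates (compare k) (frame L k a₁ (x :: b) c []) (frame L k a' [] c' [])
            (3 * (x :: b).length + 1) := by
      intro a₁ a₂ c₂ hstep ha₂ hc₂ hiff
      obtain ⟨a', c', hiff', ha', hc', hterm⟩ := ih a₂ c₂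
      refine ⟨a', c', hiff.trans hiff', ha'.trans ha₂, by simp; omega, ?_⟩
      refine (Terminates.loop_cons (b := x) (l := b) (by simp) ?_ hterm).mono
        (T := 2 + (3 * b.length + 1) + 1) (by simp; omega)
      rw [update_frame_one]
      exact hstep
    rcases a with _ | ⟨y, a⟩
    · refine step (a₂ := []) (c₂ := true :: c) (.case_nil (by simp) ?_) le_rfl (by simp) (by simp)
      simpa using Terminates.push (frame L k [] b c []) (k + 2) true
    · by_cases hxy : x = y
      · refine step (a₂ := a) (c₂ := c) (.case_cons (frame_zero ..) ?_) (by simp) (by simp)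
          (by simp [hxy])
        simpa [hxy] using Terminates.skip (frame L k a b c [])
      · refine step (a₂ := a) (c₂ := true :: c) (.case_cons (frame_zero ..) ?_) (by simp) (by simp)
          (by simp [Ne.symm hxy])
        simpa [hxy] using Terminates.push (frame L k a b c []) (k + 2) true

end StackProgram

/-- The tree that represents a truth value. -/
def BinTree.ofBool : Bool → BinTree
  | true => node nil nil
  | false => nil

namespace StackProgram

/-- Replace a tree `node a b` on stack `k` by the truth value of `a = b`. -/
def equal (k : ℕ) : StackProgram :=
  case k skip fun _ => seq (split k) <| seq (move (k + 2) (k + 1)) <| seq (compare k) <|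
    seq (case k skip fun _ => seq (clear k) (push (k + 2) true))
      (case (k + 2) (pushList k (BinTree.ofBool true).word) fun _ =>
        seq (clear (k + 2)) (pushList k (BinTree.ofBool false).word))

open Classical in
theorem terminates_equal (L : ℕ → List Bool) (k : ℕ) (a b : BinTree) :
    Terminates (equal k) (frame L k (a.node b).word [] [] [])
      (frame L k (BinTree.ofBool (decide (a = b))).word [] [] [])
      (20 * (a.node b).word.length + 20) := by
  have h₁ := terminates_split L k a b.word []
  have h₂ := terminates_move (frame L k b.word [] a.word.reverse []) (v := k + 2) (w := k + 1)
    (by omega)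
  obtain ⟨x, c, hiff, hx, hc, h₃⟩ := terminates_compare L k b.word a.word []
  have hiff' : a = b ↔ x = [] ∧ c = [] := by
    rw [← hiff]
    simp [BinTree.word_injective.eq_iff, eq_comm]
  simp only [frame_one, frame_two, update_frame_one, update_frame_two, List.append_nil,
    List.reverse_reverse, List.length_reverse] at h₂
  simp only [List.length_nil, zero_add] at hc
  obtain ⟨c', hc', hiff'', h₄⟩ : ∃ c' : List Bool, c'.length ≤ c.length + 1 ∧ (a = b ↔ c' = []) ∧
      Terminates (case k skip fun _ => seq (clear k) (push (k + 2) true))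
        (frame L k x [] c []) (frame L k [] [] c' []) (2 * x.length + 3) := by
    rcases x with _ | ⟨y, x⟩
    · exact ⟨c, by omega, by simpa using hiff', (Terminates.case_nil (by simp) (.skip _)).mono
        (by simp)⟩
    · refine ⟨true :: c, by simp, by simpa using hiff', (Terminates.case_cons (frame_zero ..)
        (T := 2 * x.length + 1 + 1) ?_).mono (by simp)⟩
      have h₅ := terminates_clear (frame L k x [] c []) k
      have h₆ := Terminates.push (frame L k [] [] c []) (k + 2) true
      simp only [frame_zero, frame_two, update_frame_zero, update_frame_two] at h₅ h₆ ⊢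
      exact h₅.seq h₆
  have h₅ : Terminates (case (k + 2) (pushList k (BinTree.ofBool true).word) fun _ =>
        seq (clear (k + 2)) (pushList k (BinTree.ofBool false).word)) (frame L k [] [] c' [])
        (frame L k (BinTree.ofBool (decide (a = b))).word [] [] []) (2 * c'.length + 6) := by
    rcases c' with _ | ⟨y, c'⟩
    · have hab : a = b := by simpa using hiff''
      have := terminates_pushList (frame L k [] [] [] []) k (BinTree.ofBool true).word
      refine (Terminates.case_nil (by simp) (by simpa [hab] using this)).mono ?_
      simp [BinTree.ofBool, BinTree.word]
    · have hab : a ≠ b := by simpa using hiff''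
      have h₆ := terminates_clear (frame L k [] [] c' []) (k + 2)
      have h₇ := terminates_pushList (frame L k [] [] [] []) k (BinTree.ofBool false).word
      simp only [update_frame_two] at h₆
      refine (Terminates.case_cons (b := y) (l := c') (by simp) ?_).mono
        (T := (2 * c'.length + 1) + 2 + 1) (by simp; omega)
      rw [update_frame_two]
      simpa [hab, BinTree.ofBool, BinTree.word] using h₆.seq h₇
  exact (Terminates.case_frame (x := true) (h₁.seq (h₂.seq (h₃.seq (h₄.seq h₅))))).mono
    (by simp [BinTree.word]; omega)

/-- If the stack `k` holds a tree `node c a`, then replace it by `a` and run `P` if `c` represents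
the truth value `true`, and `Q` otherwise. -/
def ite (P Q : ℕ → StackProgram) (k : ℕ) : StackProgram :=
  case k skip fun _ => case k skip fun c =>
    if c then seq (case k skip fun _ => skip) (seq (case k skip fun _ => skip) (P k)) else Q k

theorem terminates_ite {P Q : ℕ → StackProgram} {c : Bool} {a x : List Bool} {T : ℕ}
    (L : ℕ → List Bool) (k : ℕ)
    (hP : c = true → Terminates (P k) (frame L k a [] [] []) (frame L k x [] [] []) T)
    (hQ : c = false → Terminates (Q k) (frame L k a [] [] []) (frame L k x [] [] []) T) :
    Terminates (ite P Q k) (frame L k (true :: ((BinTree.ofBool c).word ++ a)) [] [] [])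
      (frame L k x [] [] []) (T + 6) := by
  refine .case_cons (frame_zero ..) ?_ (T := T + 5)
  rw [update_frame_zero]
  cases c
  · refine Terminates.mono (.case_cons (T := T) (b := false) (l := a)
      (by simp [BinTree.ofBool, BinTree.word]) ?_) (by omega)
    simpa using hQ rfl
  · refine Terminates.mono (.case_cons (T := 1 + 1 + (1 + 1 + T)) (b := true)
      (l := false :: false :: a) (by simp [BinTree.ofBool, BinTree.word]) ?_) (by omega)
    rw [update_frame_zero]
    refine .seq (s' := frame L k (false :: a) [] [] []) (.case_cons (frame_zero ..)
      (by simpa using .skip _)) (.seq (s' := frame L k a [] [] []) (.case_cons (frame_zero ..)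
      (by simpa using .skip _)) (hP rfl))

/-- Run `P k` as long as the stack `k` holds a tree `node c a` with `c ≠ nil`. -/
def whileLeft (P : ℕ → StackProgram) (k : ℕ) : StackProgram :=
  seq (push (k + 1) true) <| loop (k + 1) fun _ => case k skip fun b => case k skip fun c =>
    seq (push k c) <| seq (push k b) <| if c then seq (P k) (push (k + 1) true) else skip

/-- The contents of the stack `k` before the successive rounds of the loop are `a 0, …, a m`. -/
theorem terminates_whileLeft {P : ℕ → StackProgram} {L : ℕ → List Bool} {k : ℕ} {m T : ℕ}
    (a : ℕ → List Bool)
    (hP : ∀ i < m, Terminates (P k) (frame L k (a i) [] [] []) (frame L k (a (i + 1)) [] [] []) T)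
    (ha : ∀ i < m, ∃ w, a i = true :: true :: w) (ham : ∃ w, a m = true :: false :: w) :
    Terminates (whileLeft P k) (frame L k (a 0) [] [] []) (frame L k (a m) [] [] [])
      (m * (T + 7) + 8) := by
  have key : ∀ j ≤ m, Terminates (loop (k + 1) fun _ => case k skip fun b => case k skip fun c =>
      seq (push k c) <| seq (push k b) <| if c then seq (P k) (push (k + 1) true) else skip)
      (frame L k (a (m - j)) [true] [] []) (frame L k (a m) [] [] []) (j * (T + 7) + 7) := by
    intro j
    induction j with
    | zero =>
      intro _
      obtain ⟨w, hw⟩ := ham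
      refine (Terminates.loop_cons (b := true) (l := []) (T := 5) (T' := 1)
        (s' := frame L k (a m) [] [] []) (by simp) ?_ (.loop_nil (by simp))).mono (by omega)
      rw [update_frame_one, Nat.sub_zero, hw]
      refine .case_cons (frame_zero ..) ?_
      rw [update_frame_zero]
      refine .case_cons (frame_zero ..) ?_ (T := 1 + (1 + 1))
      rw [update_frame_zero]
      refine .seq (.push _ _ _) (.seq (.push _ _ _) ?_)
      simpa using .skip _
    | succ j ih =>
      intro hj
      obtain ⟨w, hw⟩ := ha (m - (j + 1)) (by omega)
      have h₁ := hP (m - (j + 1)) (by omega)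
      rw [show m - (j + 1) + 1 = m - j by omega] at h₁
      refine (Terminates.loop_cons (b := true) (l := []) (T := T + 5)
        (s' := frame L k (a (m - j)) [true] [] []) (by simp) ?_ (ih (by omega))).mono (by
          rw [Nat.succ_mul]; omega)
      rw [update_frame_one, hw]
      refine .case_cons (frame_zero ..) ?_ (T := T + 4)
      rw [update_frame_zero]
      refine .case_cons (frame_zero ..) ?_ (T := T + 3)
      rw [update_frame_zero]
      refine Terminates.mono (.seq (T := 1) (.push _ _ _) (.seq (T := 1) (T' := T + 1)
        (.push _ _ _) ?_)) (by omega)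
      simp only [frame_zero, update_frame_zero, if_true]
      rw [← hw]
      refine h₁.seq ?_
      simpa using Terminates.push (frame L k (a (m - j)) [] [] []) (k + 1) true
  have h₁ := Terminates.push (frame L k (a 0) [] [] []) (k + 1) true
  rw [update_frame_one] at h₁
  exact (h₁.seq (by simpa using key m le_rfl)).mono (by omega)

end StackProgram

/-! ### Functions computable in polynomial time -/

/-- Types whose elements are represented by binary trees. -/
class TreeCode (α : Type) where
  code : α → BinTree
  code_injective : Function.Injective code

namespace TreeCode

instance : TreeCode Bool where
  code := BinTree.ofBool
  code_injective := by
    intro a b h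
    cases a <;> cases b <;> simp_all [BinTree.ofBool]

instance {α β : Type} [TreeCode α] [TreeCode β] : TreeCode (α × β) where
  code x := .node (code x.1) (code x.2)
  code_injective := by
    rintro ⟨a, b⟩ ⟨a', b'⟩ h
    simp only [BinTree.node.injEq] at h
    rw [code_injective h.1, code_injective h.2]

instance {α : Type} [TreeCode α] {p : α → Prop} : TreeCode {x // p x} where
  code x := code x.1
  code_injective _ _ h := Subtype.ext (code_injective h)

/-- The tree that represents a list. -/
def codeList {α : Type} [TreeCode α] : List α → BinTree
  | [] => .nil
  | a :: l => .node (code a) (codeList l)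

instance {α : Type} [TreeCode α] : TreeCode (List α) where
  code := codeList
  code_injective := by
    intro l l' h
    induction l generalizing l' with
    | nil => cases l' <;> simp_all [codeList]
    | cons a l ih =>
      cases l' with
      | nil => simp [codeList] at h
      | cons a' l' =>
        simp only [codeList, BinTree.node.injEq] at h
        rw [code_injective h.1, ih h.2]

/-- Input symbols as words of bits. -/
def symbolBits : InputSymbol → List Bool
  | .bit b => [b]
  | .sync => []
  | .comma => [true, true]
  | .semicolon => [true, false]
  | .bar => [false, false]

instance : TreeCode InputSymbol where
  code c := code (symbolBits c)
  code_injective := by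
    intro a b h
    have := code_injective h
    cases a <;> cases b <;> simp_all [symbolBits]

variable {α β : Type} [TreeCode α] [TreeCode β]

/-- The word on a stack that represents an element. -/
def word (x : α) : List Bool := (code x).word

/-- The length of the word that represents an element. -/
def size (x : α) : ℕ := (word x).length

theorem size_pos (x : α) : 0 < size x := List.length_pos_iff.mpr (code x).word_ne_nil

theorem size_prod (x : α × β) : size x = size x.1 + size x.2 + 1 := by
  simp [size, word, code, BinTree.word]

theorem size_nil : size ([] : List α) = 1 := rfl

theorem size_cons (a : α) (l : List α) : size (a :: l) = size a + size l + 1 := by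
  simp [size, word, code, codeList, BinTree.word]

theorem size_append (l l' : List α) : size (l ++ l') + 1 = size l + size l' := by
  induction l with
  | nil => simp [size_nil]; omega
  | cons a l ih => simp only [List.cons_append, size_cons]; omega

theorem size_reverse (l : List α) : size l.reverse = size l := by
  induction l with
  | nil => rfl
  | cons a l ih =>
    have := size_append l.reverse [a]
    rw [List.reverse_cons]
    simp only [size_cons, size_nil] at this ⊢
    omega

theorem length_lt_size (l : List α) : l.length < size l := by
  induction l with
  | nil => simp [size_nil]
  | cons a l ih => simp only [List.length_cons, size_cons]; omega

theorem size_le_of_mem {a : α} {l : List α} (h : a ∈ l) : size a ≤ size l := by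
  induction l with
  | nil => simp at h
  | cons b l ih =>
    rw [size_cons]
    rcases List.mem_cons.mp h with rfl | h
    · omega
    · have := ih h
      omega

theorem size_le_of_sublist {l l' : List α} (h : l.Sublist l') : size l ≤ size l' := by
  induction h with
  | slnil => exact le_rfl
  | cons a _ ih => rw [size_cons]; omega
  | cons_cons a _ ih => rw [size_cons, size_cons]; omega

end TreeCode

open TreeCode StackProgram in
/-- A function is computable in polynomial time if there are programs that, for every `k`, replace
the word of `x` on stack `k` by the word of `f x`, using a bounded number of stacks from `k` on as
auxiliary memory, within a number of steps that is polynomial in the length of the word. -/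
def PolyTime {α β : Type} [TreeCode α] [TreeCode β] (f : α → β) : Prop :=
  ∃ (P : ℕ → StackProgram) (w : ℕ) (p : Polynomial ℕ), (∀ k, (P k).UsesBelow (k + w)) ∧
    ∀ x k L, Terminates (P k) (frame L k (word x) [] [] []) (frame L k (word (f x)) [] [] [])
      (p.eval (size x))

theorem Polynomial.eval_le_eval (p : Polynomial ℕ) {m n : ℕ} (h : m ≤ n) :
    p.eval m ≤ p.eval n := by
  rw [Polynomial.eval_eq_sum, Polynomial.eval_eq_sum]
  exact Finset.sum_le_sum fun i _ => Nat.mul_le_mul_left _ (Nat.pow_le_pow_left h i)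

namespace PolyTime

open TreeCode StackProgram

variable {α β γ δ : Type} [TreeCode α] [TreeCode β] [TreeCode γ] [TreeCode δ]

theorem exists_size_le {f : α → β} (hf : PolyTime f) :
    ∃ p : Polynomial ℕ, ∀ x, size (f x) ≤ p.eval (size x) := by
  obtain ⟨P, w, p, _, hP⟩ := hf
  refine ⟨Polynomial.X + p, fun x => ?_⟩
  obtain ⟨t, ht, hr⟩ := hP x 0 (fun _ => [])
  have := hr.length_le 0
  simp only [frame_zero] at this
  simp only [Polynomial.eval_add, Polynomial.eval_X, size] at ht ⊢
  omega

/-- A function that does not change the representing tree. -/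
theorem of_code_eq {f : α → β} (h : ∀ x, code (f x) = code x) : PolyTime f := by
  refine ⟨fun _ => skip, 0, 1, fun _ => trivial, fun x k L => ?_⟩
  rw [word, word, h, Polynomial.eval_one]
  exact .skip _

protected theorem id : PolyTime (fun x : α => x) := of_code_eq fun _ => rfl

/-- A function that selects the left subtree of the representing tree. -/
theorem of_code_eq_left {f : α → β} (h : ∀ x, code (f x) = (code x).left) : PolyTime f := by
  refine ⟨StackProgram.left, 3, 9 * Polynomial.X + 9, fun k => ?_, fun x k L => ?_⟩
  · simp [StackProgram.left, UsesBelow, split, clear, move]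
  · rw [word, word, h]
    exact (terminates_left L k (code x)).mono (by simp [size, word])

/-- A function that selects the right subtree of the representing tree. -/
theorem of_code_eq_right {f : α → β} (h : ∀ x, code (f x) = (code x).right) : PolyTime f := by
  refine ⟨StackProgram.right, 3, 9 * Polynomial.X + 9, fun k => ?_, fun x k L => ?_⟩
  · simp [StackProgram.right, UsesBelow, split, clear]
  · rw [word, word, h]
    exact (terminates_right L k (code x)).mono (by simp [size, word])

theorem comp {g : β → γ} {f : α → β} (hg : PolyTime g) (hf : PolyTime f) :
    PolyTime (fun x => g (f x)) := by
  obtain ⟨r, hr⟩ := hf.exists_size_le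
  obtain ⟨P, v, p, hPv, hP⟩ := hf
  obtain ⟨Q, w, q, hQw, hQ⟩ := hg
  refine ⟨fun k => seq (P k) (Q k), v + w, p + q.comp r,
    fun k => ⟨(hPv k).mono (by omega), (hQw k).mono (by omega)⟩, fun x k L => ?_⟩
  refine ((hP x k L).seq (hQ (f x) k L)).mono ?_
  rw [Polynomial.eval_add, Polynomial.eval_comp]
  exact Nat.add_le_add_left (q.eval_le_eval (hr x)) _

theorem const (y : β) : PolyTime (fun _ : α => y) := by
  refine ⟨StackProgram.const (word y), 1, 2 * Polynomial.X + Polynomial.C (size y + 2),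
    fun k => ⟨⟨by simp, fun _ => trivial⟩, usesBelow_pushList (by simp) _⟩, fun x k L => ?_⟩
  exact (terminates_const L k (word x) (word y)).mono (by simp [size]; omega)

/-- A function whose value is represented by a tree composed of two trees that can be computed. -/
theorem node {f : α → β} {g : α → γ} {h : α → δ} (hf : PolyTime f) (hg : PolyTime g)
    (hh : ∀ x, code (h x) = (code (f x)).node (code (g x))) : PolyTime h := by
  obtain ⟨r, hr⟩ := hf.exists_size_le
  obtain ⟨r', hr'⟩ := hg.exists_size_le
  obtain ⟨P, v, p, hPv, hP⟩ := hf
  obtain ⟨Q, w, q, hQw, hQ⟩ := hg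
  refine ⟨StackProgram.pair P Q, v + w + 4,
    p + q + 9 * Polynomial.X + 8 * r + 4 * r' + 12, fun k => ?_, fun x k L => ?_⟩
  · simp [StackProgram.pair, UsesBelow, move, moveTwo]
    exact ⟨(hPv (k + 1)).mono (by omega), (hQw (k + 1)).mono (by omega)⟩
  · have h₁ := terminates_pair (fun k L => hP x k L) (fun k L => hQ x k L) L k
    have h₂ := hr x
    have h₃ := hr' x
    have h₄ : word (h x) = true :: (word (f x) ++ word (g x)) := by
      simp [word, hh, BinTree.word]
    rw [h₄]
    refine h₁.mono ?_
    simp only [size] at h₂ h₃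
    simp [size]
    omega

theorem pair {f : α → β} {g : α → γ} (hf : PolyTime f) (hg : PolyTime g) :
    PolyTime (fun x => (f x, g x)) :=
  hf.node hg fun _ => rfl

theorem cons {f : α → β} {g : α → List β} (hf : PolyTime f) (hg : PolyTime g) :
    PolyTime (fun x => f x :: g x) :=
  hf.node hg fun _ => rfl

theorem fst {f : α → β × γ} (hf : PolyTime f) : PolyTime (fun x => (f x).1) :=
  (of_code_eq_left (f := Prod.fst) fun _ => rfl).comp hf

theorem snd {f : α → β × γ} (hf : PolyTime f) : PolyTime (fun x => (f x).2) :=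
  (of_code_eq_right (f := Prod.snd) fun _ => rfl).comp hf

theorem tail {f : α → List β} (hf : PolyTime f) : PolyTime (fun x => (f x).tail) :=
  (of_code_eq_right (f := List.tail) fun l => by cases l <;> rfl).comp hf

/-- The first element of a list of lists, or the empty list if there is none. -/
theorem headI {f : α → List (List β)} (hf : PolyTime f) : PolyTime (fun x => (f x).headI) :=
  (of_code_eq_left (f := List.headI) fun l => by cases l <;> rfl).comp hf

theorem decide_eq [DecidableEq β] {f g : α → β} (hf : PolyTime f) (hg : PolyTime g) :
    PolyTime (fun x => decide (f x = g x)) := by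
  refine PolyTime.comp (f := fun x => (f x, g x)) (g := fun x => decide (x.1 = x.2)) ?_
    (hf.pair hg)
  refine ⟨equal, 3, 20 * Polynomial.X + 20, fun k => ?_, fun x k L => ?_⟩
  · have hpush : ∀ w : List Bool, (pushList k w).UsesBelow (k + 3) := usesBelow_pushList (by simp)
    simp [StackProgram.equal, UsesBelow, split, clear, move, StackProgram.compare, hpush]
  · have h := terminates_equal L k (code x.1) (code x.2)
    simp only [code_injective.eq_iff] at h
    have hT : (20 * Polynomial.X + 20 : Polynomial ℕ).eval (size x) =
        20 * ((code x.1).node (code x.2)).word.length + 20 := by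
      simp only [Polynomial.eval_add, Polynomial.eval_mul, Polynomial.eval_X,
        Polynomial.eval_ofNat]
      rfl
    rw [hT]
    exact h

theorem ite {c : α → Bool} {f g : α → β} (hc : PolyTime c) (hf : PolyTime f)
    (hg : PolyTime g) : PolyTime (fun x => if c x then f x else g x) := by
  refine PolyTime.comp (f := fun x => (c x, x)) (g := fun x => if x.1 then f x.2 else g x.2) ?_
    (hc.pair .id)
  obtain ⟨P, v, p, hPv, hP⟩ := hf
  obtain ⟨Q, w, q, hQw, hQ⟩ := hg
  refine ⟨StackProgram.ite P Q, v + w + 1, p + q + 6, fun k => ?_, fun x k L => ?_⟩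
  · simp [StackProgram.ite, UsesBelow]
    refine ⟨(hQw k).mono (by omega), (hPv k).mono (by omega)⟩
  · have hx : size x.2 ≤ size x := by rw [size_prod]; omega
    have hp := p.eval_le_eval hx
    have hq := q.eval_le_eval hx
    have h := terminates_ite (P := P) (Q := Q) (c := x.1) (a := word x.2)
      (x := word (if x.1 then f x.2 else g x.2)) (T := p.eval (size x) + q.eval (size x)) L k
      (fun h => by simpa [h] using (hP x.2 k L).mono (by omega))
      (fun h => by simpa [h] using (hQ x.2 k L).mono (by omega))
    exact h.mono (by simp)

/-- Recursion on a list. The condition is that the intermediate results have polynomial size. -/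
theorem foldl {l : γ → List α} {init : γ → β} {step : γ → β → α → β} (hl : PolyTime l)
    (hinit : PolyTime init) (hstep : PolyTime fun x : γ × β × α => step x.1 x.2.1 x.2.2)
    (q : Polynomial ℕ)
    (hq : ∀ c l₁ l₂, l c = l₁ ++ l₂ → size (l₁.foldl (step c) (init c)) ≤ q.eval (size c)) :
    PolyTime fun c => (l c).foldl (step c) (init c) := by
  let next : {x : List α × β × γ // x.1 ≠ []} → List α × β × γ := fun x =>
    (x.1.1.tail, step x.1.2.2 x.1.2.1 (x.1.1.head x.2), x.1.2.2)
  have hnext : PolyTime next := by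
    have hval : PolyTime (fun x : {x : List α × β × γ // x.1 ≠ []} => x.1) :=
      of_code_eq fun _ => rfl
    have hhead : PolyTime (fun x : {x : List α × β × γ // x.1 ≠ []} => x.1.1.head x.2) := by
      refine (of_code_eq_left (α := {l : List α // l ≠ []}) (f := fun l => l.1.head l.2) ?_).comp
        (f := fun x : {x : List α × β × γ // x.1 ≠ []} => ⟨x.1.1, x.2⟩)
        (of_code_eq_left fun _ => rfl)
      rintro ⟨_ | ⟨a, l⟩, h⟩
      · exact absurd rfl h
      · rfl
    exact hval.fst.tail.pair
      ((hstep.comp (hval.snd.snd.pair (hval.snd.fst.pair hhead))).pair hval.snd.snd)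
  obtain ⟨N, v, p, hNv, hN⟩ := hnext
  obtain ⟨G, w, r, hGw, hG⟩ := hl.pair (hinit.pair .id)
  obtain ⟨r', hr'⟩ := hl.exists_size_le
  suffices h : PolyTime fun c => (([] : List α), (l c).foldl (step c) (init c), c) from h.snd.fst
  refine ⟨fun k => seq (G k) (whileLeft N k), v + w + 2,
    r + (r' * (p.comp (r' + q + Polynomial.X + 2) + 7) + 8), fun k => ?_, fun c k L => ?_⟩
  · refine ⟨(hGw k).mono (by omega), ?_⟩
    simp [whileLeft, UsesBelow]
    exact (hNv k).mono (by omega)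
  let state : ℕ → List α × β × γ := fun i =>
    ((l c).drop i, ((l c).take i).foldl (step c) (init c), c)
  have hstate : ∀ i, size (state i) ≤ (r' + q + Polynomial.X + 2).eval (size c) := by
    intro i
    have h₁ := hr' c
    have h₂ := hq c ((l c).take i) ((l c).drop i) (List.take_append_drop i (l c)).symm
    have h₃ : size ((l c).drop i) ≤ size (l c) := size_le_of_sublist (List.drop_sublist i _)
    simp only [state, size_prod, Polynomial.eval_add, Polynomial.eval_X, Polynomial.eval_ofNat]
    omega
  have h := terminates_whileLeft (P := N) (L := L) (k := k) (m := (l c).length)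
    (T := (p.comp (r' + q + Polynomial.X + 2)).eval (size c)) (fun i => word (state i)) ?_ ?_ ?_
  · have h₀ := hG c k L
    simp only [state, List.drop_zero, List.take_zero, List.foldl_nil, List.drop_length,
      List.take_length] at h
    refine (h₀.seq h).mono ?_
    have h₁ := (length_lt_size (l c)).le.trans (hr' c)
    simp only [Polynomial.eval_add, Polynomial.eval_mul, Polynomial.eval_ofNat]
    gcongr
  · intro i hi
    have hne : (state i).1 ≠ [] := by simpa [state] using hi
    have hnext : next ⟨state i, hne⟩ = state (i + 1) := by
      simp only [next, state, List.tail_drop, List.head_drop]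
      rw [List.take_add_one, List.foldl_append, List.getElem?_eq_getElem hi]
      rfl
    have h := hN ⟨state i, hne⟩ k L
    rw [hnext] at h
    refine h.mono ?_
    rw [Polynomial.eval_comp]
    exact p.eval_le_eval (hstate i)
  · intro i hi
    simp only [state, List.drop_eq_getElem_cons hi]
    exact ⟨_, rfl⟩
  · simp only [state, List.drop_length]
    exact ⟨_, rfl⟩

/-! ### List functions -/

theorem reverse {l : γ → List α} (hl : PolyTime l) : PolyTime fun c => (l c).reverse := by
  obtain ⟨r, hr⟩ := hl.exists_size_le
  have h := foldl (step := fun _ b a => a :: b) (init := fun _ => []) hl (.const [])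
    (.cons (PolyTime.id.snd.snd) (PolyTime.id.snd.fst)) r ?_
  · simpa using h
  · intro c l₁ l₂ h
    have h₁ : size l₁ ≤ size (l c) := by
      rw [h]
      exact size_le_of_sublist (List.sublist_append_left l₁ l₂)
    simpa [size_reverse] using h₁.trans (hr c)

theorem append {l l' : γ → List α} (hl : PolyTime l) (hl' : PolyTime l') :
    PolyTime fun c => l c ++ l' c := by
  obtain ⟨r, hr⟩ := hl.exists_size_le
  obtain ⟨r', hr'⟩ := hl'.exists_size_le
  have h := foldl (step := fun _ b a => a :: b) (init := l') hl.reverse hl'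
    (.cons (PolyTime.id.snd.snd) (PolyTime.id.snd.fst)) (r + r') ?_
  · simpa using h
  · intro c l₁ l₂ h
    have h₁ : size l₁ ≤ size (l c) := by
      rw [← size_reverse (l c), h]
      exact size_le_of_sublist (List.sublist_append_left l₁ l₂)
    have h₂ := size_append l₁.reverse (l' c)
    rw [size_reverse] at h₂
    have h₃ := hr c
    have h₄ := hr' c
    simp only [List.foldl_flip_cons_eq_append', Polynomial.eval_add]
    omega

theorem flatMap {l : γ → List α} {f : γ → α → List β} (hl : PolyTime l)
    (hf : PolyTime fun x : γ × α => f x.1 x.2) : PolyTime fun c => (l c).flatMap (f c) := by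
  obtain ⟨r, hr⟩ := hl.exists_size_le
  obtain ⟨q, hq⟩ := hf.exists_size_le
  have hfold : ∀ c (l : List α) (b : List β),
      l.foldl (fun b a => b ++ f c a) b = b ++ l.flatMap (f c) := by
    intro c l
    induction l with
    | nil => simp
    | cons a l ih => intro b; simp [ih]
  have h := foldl (step := fun c b a => b ++ f c a) (init := fun _ => []) hl (.const [])
    (.append (PolyTime.id.snd.fst) (hf.comp (PolyTime.id.fst.pair PolyTime.id.snd.snd)))
    (1 + r * q.comp (Polynomial.X + r + 1)) ?_
  · simpa [hfold] using h
  · intro c l₁ l₂ h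
    have h₁ := hr c
    have hmem : ∀ a ∈ l₁, size (f c a) ≤ (q.comp (Polynomial.X + r + 1)).eval (size c) := by
      intro a ha
      have h₂ : size a ≤ size (l c) := size_le_of_mem (by rw [h]; exact List.mem_append_left _ ha)
      refine (hq (c, a)).trans ?_
      rw [Polynomial.eval_comp]
      refine q.eval_le_eval ?_
      simp only [size_prod, Polynomial.eval_add, Polynomial.eval_X, Polynomial.eval_one]
      omega
    have hsize : ∀ l₁ : List α,
        (∀ a ∈ l₁, size (f c a) ≤ (q.comp (Polynomial.X + r + 1)).eval (size c)) →
        size (l₁.flatMap (f c)) ≤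
          1 + l₁.length * (q.comp (Polynomial.X + r + 1)).eval (size c) := by
      intro l₁ hl₁
      induction l₁ with
      | nil => simp [size_nil]
      | cons a l₁ ih =>
        have h₂ := ih fun a ha => hl₁ a (List.mem_cons_of_mem _ ha)
        have h₃ := hl₁ a List.mem_cons_self
        have h₄ := size_append (f c a) (l₁.flatMap (f c))
        rw [List.flatMap_cons, List.length_cons, Nat.succ_mul]
        omega
    rw [hfold, List.nil_append]
    refine (hsize l₁ hmem).trans ?_
    have h₅ : l₁.length ≤ r.eval (size c) := by
      have h₂ := length_lt_size (l c)
      rw [h, List.length_append] at h₂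
      rw [h] at h₁
      omega
    rw [Polynomial.eval_add, Polynomial.eval_mul, Polynomial.eval_one]
    gcongr

theorem map {l : γ → List α} {f : γ → α → β} (hl : PolyTime l)
    (hf : PolyTime fun x : γ × α => f x.1 x.2) : PolyTime fun c => (l c).map (f c) := by
  have h := hl.flatMap (f := fun c a => [f c a]) (hf.cons (.const []))
  have h' : ∀ c (l : List α), l.flatMap (fun a => [f c a]) = l.map (f c) := by
    intro c l
    induction l <;> simp_all
  simpa only [h'] using h

theorem filter {l : γ → List α} {f : γ → α → Bool} (hl : PolyTime l)
    (hf : PolyTime fun x : γ × α => f x.1 x.2) : PolyTime fun c => (l c).filter (f c) := by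
  have h := hl.flatMap (f := fun c a => if f c a then [a] else [])
    (hf.ite (PolyTime.id.snd.cons (.const [])) (.const []))
  have h' : ∀ c (l : List α), l.flatMap (fun a => if f c a then [a] else []) = l.filter (f c) := by
    intro c l
    induction l with
    | nil => rfl
    | cons a l ih => by_cases hfa : f c a <;> simp [hfa, ih]
  simpa only [h'] using h

theorem not {f : γ → Bool} (hf : PolyTime f) : PolyTime fun c => !f c := by
  have h := hf.ite (.const false) (.const true)
  have h' : ∀ b : Bool, (if b then false else true) = !b := by decide
  simpa only [h'] using h

theorem and {f g : γ → Bool} (hf : PolyTime f) (hg : PolyTime g) :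
    PolyTime fun c => f c && g c := by
  have h := hf.ite hg (.const false)
  have h' : ∀ b b' : Bool, (if b then b' else false) = (b && b') := by decide
  simpa only [h'] using h

theorem or {f g : γ → Bool} (hf : PolyTime f) (hg : PolyTime g) :
    PolyTime fun c => f c || g c := by
  have h := hf.ite (.const true) hg
  have h' : ∀ b b' : Bool, (if b then true else b') = (b || b') := by decide
  simpa only [h'] using h

theorem any {l : γ → List α} {f : γ → α → Bool} (hl : PolyTime l)
    (hf : PolyTime fun x : γ × α => f x.1 x.2) : PolyTime fun c => (l c).any (f c) := by
  classical
  have h := ((hl.filter hf).decide_eq (.const [])).not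
  have h' : ∀ c (l : List α), (!decide (l.filter (f c) = [])) = l.any (f c) := by
    intro c l
    rw [Bool.eq_iff_iff]
    simp
  simpa only [h'] using h

theorem all {l : γ → List α} {f : γ → α → Bool} (hl : PolyTime l)
    (hf : PolyTime fun x : γ × α => f x.1 x.2) : PolyTime fun c => (l c).all (f c) := by
  have h := (hl.any (f := fun c a => !f c a) hf.not).not
  simpa only [List.not_any_eq_all_not, Bool.not_not] using h

theorem decide_mem [DecidableEq α] {f : γ → α} {l : γ → List α} (hf : PolyTime f)
    (hl : PolyTime l) : PolyTime fun c => decide (f c ∈ l c) := by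
  have h := hl.any (f := fun c a => decide (a = f c))
    (PolyTime.id.snd.decide_eq (hf.comp PolyTime.id.fst))
  have h' : ∀ (a : α) (l : List α), (l.any fun b => decide (b = a)) = decide (a ∈ l) := by
    intro a l
    rw [Bool.eq_iff_iff]
    simp
  simpa only [h'] using h

/-- Iteration of a function. The condition is that the intermediate results have polynomial
size. -/
theorem iterate_length {l : γ → List α} {init : γ → β} {step : γ → β → β} (hl : PolyTime l)
    (hinit : PolyTime init) (hstep : PolyTime fun x : γ × β => step x.1 x.2)
    (q : Polynomial ℕ) (hq : ∀ c n, size ((step c)^[n] (init c)) ≤ q.eval (size c)) :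
    PolyTime fun c => (step c)^[(l c).length] (init c) := by
  have h' : ∀ c (l : List α) (b : β), l.foldl (fun b _ => step c b) b = (step c)^[l.length] b := by
    intro c l
    induction l with
    | nil => simp
    | cons a l ih => intro b; simp [ih]
  have h := foldl (step := fun c b _ => step c b) hl hinit
    (hstep.comp (PolyTime.id.fst.pair PolyTime.id.snd.fst)) q
    (fun c l₁ _ _ => by rw [h']; exact hq c l₁.length)
  simpa only [h'] using h

end PolyTime

namespace PolyTime

open TreeCode StackProgram

variable {α β γ δ : Type} [TreeCode α] [TreeCode β] [TreeCode γ] [TreeCode δ]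

theorem size_symbol_le (c : InputSymbol) : size c ≤ 11 := by
  rcases c with (_ | _) | _ | _ | _ | _ <;> decide

/-- A truth value that is computable in polynomial time from the reverse of the input is computable
in polynomial time by a Turing machine. -/
theorem nonempty_tm2ComputableInPolyTime {X : Type} {encode : X → List InputSymbol}
    {f : X → Bool} {g : List InputSymbol → Bool} (hg : PolyTime g)
    (hfg : ∀ x, f x = g (encode x).reverse) :
    Nonempty (Turing.TM2ComputableInPolyTime encode Computability.encodeBool f) := by
  obtain ⟨P, w, p, hPw, hP⟩ := hg
  -- The word of a truth value starts with that truth value.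
  let Q : StackProgram := seq (P 0) (case 0 skip fun b => seq (clear 0) (push 0 b))
  have hQ : Q.UsesBelow (w + 1) := by
    refine ⟨(hPw 0).mono (by omega), ?_⟩
    simp [UsesBelow, clear]
  have hload : ∀ l : List InputSymbol,
      (l.flatMap fun c => true :: word c) ++ [false] = word l := by
    intro l
    induction l with
    | nil => rfl
    | cons c l ih =>
      rw [List.flatMap_cons, List.append_assoc, ih]
      simp [word, code, codeList, BinTree.word]
  have hsize : ∀ l : List InputSymbol, size l ≤ 12 * l.length + 1 := by
    intro l
    induction l with
    | nil => rfl
    | cons c l ih =>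
      have := size_symbol_le c
      rw [size_cons, List.length_cons]
      omega
  have hrun : ∀ l : List InputSymbol,
      Terminates Q (Function.update (fun _ => []) 0 (word l))
        (Function.update (fun _ => []) 0 [g l]) (p.eval (12 * l.length + 1) + 9) := by
    intro l
    have h₁ := hP l 0 (fun _ => [])
    rw [update_eq_frame_zero, update_eq_frame_zero]
    have hp := p.eval_le_eval (hsize l)
    have h₂ : ∀ b : Bool, Terminates (case 0 skip fun b => seq (clear 0) (push 0 b))
        (frame (fun _ => []) 0 (word b) [] [] []) (frame (fun _ => []) 0 [b] [] [] []) 9 := by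
      intro b
      obtain ⟨r, hr, hlen⟩ : ∃ r, word b = b :: r ∧ r.length ≤ 2 := by
        cases b
        · exact ⟨[], rfl, by simp⟩
        · exact ⟨[false, false], rfl, by simp⟩
      have h₃ := terminates_clear (frame (fun _ => []) 0 r [] [] []) 0
      have h₄ := Terminates.push (frame (fun _ => []) 0 [] [] [] []) 0 b
      simp only [frame_zero, update_frame_zero] at h₃ h₄
      rw [hr]
      exact (Terminates.case_frame (Q := fun b => seq (clear 0) (push 0 b)) (h₃.seq h₄)).mono
        (by omega)
    exact (h₁.seq (h₂ (g l))).mono (by omega)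
  refine ⟨⟨⟨machine w Q [false] fun c => true :: word c, Equiv.refl _, Equiv.refl _⟩,
    p.comp (12 * Polynomial.X + 1) + 2 * Polynomial.X + 12, fun x => ?_⟩⟩
  have h := machineOutputs hQ [false] (fun c => true :: word c) (encode x) [g (encode x).reverse]
    _ (by rw [hload]; exact hrun (encode x).reverse)
  have hinp : List.map (Equiv.refl InputSymbol).invFun (encode x) = encode x :=
    List.map_id _
  have hout : List.map (Equiv.refl Bool).invFun (Computability.encodeBool (f x)) =
      [g (encode x).reverse] := by
    rw [hfg]
    rfl
  have hT : p.eval (12 * (encode x).reverse.length + 1) + 9 + (2 * (encode x).length + 3) =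
      (p.comp (12 * Polynomial.X + 1) + 2 * Polynomial.X + 12).eval (encode x).length := by
    simp
    ring
  rw [hT, ← hout] at h
  conv at h => enter [2]; rw [← hinp]
  exact h

end PolyTime

/-! ### Reachability -/

/-- The elements of `Q` that are in `R` or have a predecessor in `R`. -/
def reachStep {α : Type} [DecidableEq α] (r : α → α → Bool) (Q R : List α) : List α :=
  Q.filter fun x => decide (x ∈ R) || R.any fun y => r y x

/-- The elements of `Q` that can be reached from `x₀` by `r` within `Q`. Every step before the
iteration becomes stationary adds an element, so `Q.length` steps suffice. -/
def reachList {α : Type} [DecidableEq α] (r : α → α → Bool) (Q : List α) (x₀ : α) : List α :=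
  (reachStep r Q)^[Q.length] (Q.filter fun x => decide (x = x₀))

section reachList

variable {α : Type} [DecidableEq α] {r : α → α → Bool} {Q : List α} {x₀ : α}

theorem iterate_reachStep_sublist (n : ℕ) :
    ((reachStep r Q)^[n] (Q.filter fun x => decide (x = x₀))).Sublist Q := by
  cases n with
  | zero => exact List.filter_sublist
  | succ n =>
    rw [Function.iterate_succ_apply']
    exact List.filter_sublist

theorem iterate_reachStep_sublist_succ (n : ℕ) :
    ((reachStep r Q)^[n] (Q.filter fun x => decide (x = x₀))).Sublist
      ((reachStep r Q)^[n + 1] (Q.filter fun x => decide (x = x₀))) := by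
  have key : ∀ f : α → Bool, (Q.filter f).Sublist (reachStep r Q (Q.filter f)) := by
    intro f
    have : Q.filter f =
        (reachStep r Q (Q.filter f)).filter f := by
      rw [reachStep, List.filter_filter]
      refine List.filter_congr fun x hx => ?_
      by_cases hf : f x <;> simp [hf, hx]
    conv_lhs => rw [this]
    exact List.filter_sublist
  rw [Function.iterate_succ_apply']
  cases n with
  | zero => exact key _
  | succ n =>
    rw [Function.iterate_succ_apply']
    exact key _

theorem reachStep_reachList : reachStep r Q (reachList r Q x₀) = reachList r Q x₀ := by
  set R := fun n => (reachStep r Q)^[n] (Q.filter fun x => decide (x = x₀)) with hR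
  have hsucc : ∀ n, R (n + 1) = reachStep r Q (R n) := fun n =>
    Function.iterate_succ_apply' _ _ _
  -- Until the sequence becomes stationary, the length increases.
  have key : ∀ n, R (n + 1) = R n ∨ n ≤ (R n).length := by
    intro n
    induction n with
    | zero => exact Or.inr (Nat.zero_le _)
    | succ n ih =>
      by_cases h : R (n + 1) = R n
      · left
        rw [hsucc (n + 1), h, ← hsucc n]
        exact h
      · right
        have h₁ := ih.resolve_left h
        have h₂ : (R n).Sublist (R (n + 1)) := iterate_reachStep_sublist_succ n
        have h₃ : (R n).length ≠ (R (n + 1)).length := fun h₄ => h (h₂.eq_of_length h₄).symm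
        have := h₂.length_le
        omega
  rcases key Q.length with h | h
  · rw [hsucc] at h
    exact h
  · have h₁ : R Q.length = Q :=
      (iterate_reachStep_sublist Q.length).eq_of_length_le h
    have h₂ : (R Q.length).Sublist (R (Q.length + 1)) := iterate_reachStep_sublist_succ _
    have h₃ : R (Q.length + 1) = Q := by
      refine (iterate_reachStep_sublist (Q.length + 1)).eq_of_length_le ?_
      rw [h₁] at h₂
      exact h₂.length_le
    rw [hsucc, h₁] at h₃
    change reachStep r Q (R Q.length) = R Q.length
    rw [h₁]
    exact h₃

theorem mem_reachList_self (h : x₀ ∈ Q) : x₀ ∈ reachList r Q x₀ := by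
  have key : ∀ n, x₀ ∈ (reachStep r Q)^[n] (Q.filter fun x => decide (x = x₀)) := by
    intro n
    induction n with
    | zero => simpa using h
    | succ n ih => exact (iterate_reachStep_sublist_succ n).subset ih
  exact key _

theorem mem_reachList_of_mem {x y : α} (hy : y ∈ reachList r Q x₀) (hx : x ∈ Q)
    (hr : r y x = true) : x ∈ reachList r Q x₀ := by
  rw [← reachStep_reachList, reachStep, List.mem_filter]
  refine ⟨hx, ?_⟩
  rw [Bool.or_eq_true, List.any_eq_true]
  exact Or.inr ⟨y, hy, hr⟩

theorem reachList_induction {p : α → Prop} (h₀ : p x₀)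
    (h : ∀ y x, p y → x ∈ Q → r y x = true → p x) : ∀ x ∈ reachList r Q x₀, p x := by
  have key : ∀ n, ∀ x ∈ (reachStep r Q)^[n] (Q.filter fun x => decide (x = x₀)), p x := by
    intro n
    induction n with
    | zero =>
      intro x hx
      rw [Function.iterate_zero_apply, List.mem_filter, decide_eq_true_eq] at hx
      exact hx.2 ▸ h₀
    | succ n ih =>
      intro x hx
      rw [Function.iterate_succ_apply', reachStep, List.mem_filter, Bool.or_eq_true,
        List.any_eq_true, decide_eq_true_eq] at hx
      rcases hx.2 with hx' | ⟨y, hy, hr⟩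
      · exact ih x hx'
      · exact h y x (ih y hy) hx.1 hr
  exact key _

end reachList

namespace PolyTime

open TreeCode StackProgram

variable {α β γ δ : Type} [TreeCode α] [TreeCode β] [TreeCode γ] [TreeCode δ]

theorem reachList [DecidableEq α] {r : γ → α → α → Bool} {Q : γ → List α} {x₀ : γ → α}
    (hr : PolyTime fun x : γ × α × α => r x.1 x.2.1 x.2.2) (hQ : PolyTime Q)
    (hx₀ : PolyTime x₀) : PolyTime fun c => reachList (r c) (Q c) (x₀ c) := by
  obtain ⟨q, hq⟩ := hQ.exists_size_le
  refine iterate_length (step := fun c => reachStep (r c) (Q c)) hQ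
    (hQ.filter (f := fun c x => decide (x = x₀ c))
      (PolyTime.id.snd.decide_eq (hx₀.comp PolyTime.id.fst)))
    ?_ q fun c n => ?_
  · have hany : PolyTime fun x : (γ × List α) × α => x.1.2.any fun y => r x.1.1 y x.2 :=
      PolyTime.any (f := fun x y => r x.1.1 y x.2) PolyTime.id.fst.snd
        (hr.comp (PolyTime.id.fst.fst.fst.pair (PolyTime.id.snd.pair PolyTime.id.fst.snd)))
    exact filter (f := fun (x : γ × List α) (a : α) => decide (a ∈ x.2) ||
      x.2.any fun y => r x.1 y a) (hQ.comp PolyTime.id.fst)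
      ((PolyTime.id.snd.decide_mem PolyTime.id.fst.snd).or hany)
  · exact (size_le_of_sublist (iterate_reachStep_sublist n)).trans (hq c)

end PolyTime

/-! ### Parsing the input -/

namespace InputSymbol

instance : DecidableEq InputSymbol := fun a b =>
  decidable_of_iff (TreeCode.symbolBits a = TreeCode.symbolBits b) <| by
    constructor
    · intro h
      cases a <;> cases b <;> simp_all [TreeCode.symbolBits]
    · rintro rfl
      rfl

/-- Add a symbol in front of an input that has already been parsed. The parsed input is a list of
sections ending with bars, which consist of records separated by semicolons, which consist of
words ending with commas. -/
def parseCons (c : InputSymbol) (l : List (List (List (List InputSymbol)))) :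
    List (List (List (List InputSymbol))) :=
  if c = bar then [] :: l
  else if c = semicolon then l.modifyHead fun s => [] :: s
  else if c = comma then l.modifyHead fun s => s.modifyHead fun r => [] :: r
  else l.modifyHead fun s => s.modifyHead fun r => r.modifyHead fun w => c :: w

/-- Parse the reverse of an input. -/
def parseReverse (w : List InputSymbol) : List (List (List (List InputSymbol))) :=
  w.foldl (fun l c => c.parseCons l) []

end InputSymbol

namespace PolyTime

open TreeCode StackProgram InputSymbol

variable {α β γ δ : Type} [TreeCode α] [TreeCode β] [TreeCode γ] [TreeCode δ]

theorem modifyHead {l : γ → List (List α)} {f : γ → List α → List α} (hl : PolyTime l)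
    (hf : PolyTime fun x : γ × List α => f x.1 x.2) :
    PolyTime fun c => (l c).modifyHead (f c) := by
  classical
  have h := (hl.decide_eq (.const [])).ite (.const [])
    ((hf.comp (PolyTime.id.pair hl.headI)).cons hl.tail)
  have h' : ∀ c (l : List (List α)),
      (if decide (l = []) then [] else f c l.headI :: l.tail) = l.modifyHead (f c) := by
    intro c l
    cases l <;> simp
  simpa only [h'] using h

theorem parseCons : PolyTime fun x : InputSymbol × List (List (List (List InputSymbol))) =>
    x.1.parseCons x.2 := by
  have hc : ∀ c : InputSymbol,
      PolyTime fun x : InputSymbol × List (List (List (List InputSymbol))) => decide (x.1 = c) :=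
    fun c => PolyTime.id.fst.decide_eq (.const c)
  have hword : PolyTime fun x : InputSymbol × List (List (List (List InputSymbol))) =>
      x.2.modifyHead fun s => s.modifyHead fun r => r.modifyHead fun w => x.1 :: w :=
    .modifyHead (f := fun x (s : List (List (List InputSymbol))) =>
      s.modifyHead fun r => r.modifyHead fun w => x.1 :: w) PolyTime.id.snd <|
    .modifyHead (f := fun x : (InputSymbol × List (List (List (List InputSymbol)))) ×
      List (List (List InputSymbol)) => fun r => r.modifyHead fun w => x.1.1 :: w)
      PolyTime.id.snd <|
    .modifyHead (f := fun x : ((InputSymbol × List (List (List (List InputSymbol)))) ×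
      List (List (List InputSymbol))) × List (List InputSymbol) => fun w => x.1.1.1 :: w)
      PolyTime.id.snd <|
    .cons PolyTime.id.fst.fst.fst.fst PolyTime.id.snd
  have h := (hc bar).ite (.cons (.const []) PolyTime.id.snd) <|
    (hc semicolon).ite (.modifyHead (f := fun _ s => [] :: s) PolyTime.id.snd
      (.cons (.const []) PolyTime.id.snd)) <|
    (hc comma).ite (.modifyHead (f := fun _ s => s.modifyHead fun r => [] :: r) PolyTime.id.snd
      (.modifyHead (f := fun _ r => [] :: r) PolyTime.id.snd
        (.cons (.const []) PolyTime.id.snd))) <|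
    hword
  simpa only [decide_eq_true_eq, InputSymbol.parseCons] using h

theorem size_modifyHead_le {f : α → α} {l : List α} {n : ℕ} (h : ∀ a, size (f a) ≤ size a + n) :
    size (l.modifyHead f) ≤ size l + n := by
  cases l with
  | nil => simp
  | cons a l =>
    have := h a
    simp only [List.modifyHead_cons, size_cons]
    omega

theorem size_parseCons_le (c : InputSymbol) (l : List (List (List (List InputSymbol)))) :
    size (c.parseCons l) ≤ size l + (size c + 1) := by
  have := size_pos c
  have hnil : ∀ {α : Type} [TreeCode α] (l : List (List α)),
      size ([] :: l) ≤ size l + (size c + 1) := by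
    intro α _ l
    rw [size_cons, size_nil]
    omega
  unfold InputSymbol.parseCons
  split_ifs
  · exact hnil l
  · exact size_modifyHead_le fun s => hnil s
  · exact size_modifyHead_le fun s => size_modifyHead_le fun r => hnil r
  · refine size_modifyHead_le fun s => size_modifyHead_le fun r => size_modifyHead_le fun w => ?_
    rw [size_cons]
    omega

theorem parseReverse : PolyTime parseReverse := by
  refine foldl (γ := List InputSymbol) (l := fun w => w) (init := fun _ => [])
    (step := fun _ l c => c.parseCons l) .id (.const [])
    (parseCons.comp (PolyTime.id.snd.snd.pair PolyTime.id.snd.fst)) Polynomial.X fun c l₁ l₂ h => ?_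
  have key : ∀ l : List InputSymbol,
      size (l.reverse.foldl (fun l c => c.parseCons l) []) ≤ size l := by
    intro l
    induction l with
    | nil => exact le_rfl
    | cons c l ih =>
      have := size_parseCons_le c (l.reverse.foldl (fun l c => c.parseCons l) [])
      rw [List.reverse_cons, List.foldl_append, size_cons]
      simp only [List.foldl_cons, List.foldl_nil]
      omega
  have h₁ := key l₁.reverse
  rw [List.reverse_reverse, size_reverse] at h₁
  rw [Polynomial.eval_X, h]
  exact h₁.trans (size_le_of_sublist (List.sublist_append_left l₁ l₂))

end PolyTime

/-! ### The decision procedure -/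

open InputSymbol

/-- Edges whose locations and labels are words, in the order source, label, target. -/
abbrev WordEdge : Type := List InputSymbol × List InputSymbol × List InputSymbol

/-- The label of sync-points; also used as the name of an additional location. -/
def syncWord : List InputSymbol := [sync]

/-- The label of additional loops. -/
def stayWord : List InputSymbol := [comma]

/-- Add a location `syncWord`, an edge from it to the initial location that is labeled by a
sync-point, and loops labeled `stayWord` at all locations. -/
def extendEdges (init : List InputSymbol) (E : List WordEdge) : List WordEdge :=
  ((syncWord, syncWord, init) :: E) ++ ((syncWord, syncWord, init) :: E).flatMap fun e =>
    [(e.1, stayWord, e.1), (e.2.2, stayWord, e.2.2)]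

/-- Pairs of edges such that a sync-point in the first component occurs only together with a
sync-point in the second component. -/
def edgePairs (E : List WordEdge) : List (WordEdge × WordEdge) :=
  (E.flatMap fun e => E.map fun e' => (e, e')).filter fun x =>
    !decide (x.1.2.1 = syncWord) || decide (x.2.2.1 = syncWord)

/-- The pairs of edges that can be traversed at the same time if the first component starts in the
additional location and the second component in the initial location. Before the first component
reaches the initial location, the second one has to pass one sync-point more, so afterwards it is
strictly ahead. -/
def reachablePairs (init : List InputSymbol) (E : List WordEdge) : List (WordEdge × WordEdge) :=
  reachList (fun y x => decide (y.1.2.2 = x.1.1) && decide (y.2.2.2 = x.2.1))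
    (edgePairs (extendEdges init E)) ((syncWord, stayWord, syncWord), (init, stayWord, init))

/-- Whether a label is an action. -/
def isAction (l : List InputSymbol) : Bool := !decide (l = syncWord) && !decide (l = stayWord)

/-- Decide soundness, given the initial location and the edges of the instrumentation and the
commutativity relation. -/
def checkSound (init : List InputSymbol) (E : List WordEdge)
    (comm : List (List InputSymbol × List InputSymbol)) : Bool :=
  (reachablePairs init E).all fun x =>
    !isAction x.1.2.1 || (!isAction x.2.2.1 || decide ((x.2.2.1, x.1.2.1) ∈ comm))

/-- The edge described by a record. -/
def recordEdge (r : List (List InputSymbol)) : WordEdge :=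
  (r.headI, r.tail.headI, r.tail.tail.headI)

/-- Decide soundness, given the parsed input. The first record of each graph also contains the
number of locations and the initial and the exit location. -/
def checkParsed (l : List (List (List (List InputSymbol)))) : Bool :=
  checkSound l.tail.headI.headI.tail.headI
    ((l.tail.headI.headI.tail.tail.tail :: l.tail.headI.tail).map recordEdge)
    (l.tail.tail.headI.map fun r => (r.headI, r.tail.headI))

namespace PolyTime

open TreeCode StackProgram

variable {γ : Type} [TreeCode γ]

theorem extendEdges {init : γ → List InputSymbol} {E : γ → List WordEdge} (hinit : PolyTime init)
    (hE : PolyTime E) : PolyTime fun c => extendEdges (init c) (E c) := by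
  have h : PolyTime fun c => ((syncWord, syncWord, init c) :: E c) :=
    .cons (.pair (.const _) (.pair (.const _) hinit)) hE
  refine h.append (h.flatMap (f := fun _ e => [(e.1, stayWord, e.1), (e.2.2, stayWord, e.2.2)]) ?_)
  have he : PolyTime fun x : γ × WordEdge => x.2 := PolyTime.id.snd
  exact .cons (he.fst.pair (.pair (.const _) he.fst))
    (.cons (he.snd.snd.pair (.pair (.const _) he.snd.snd)) (.const _))

theorem edgePairs {E : γ → List WordEdge} (hE : PolyTime E) :
    PolyTime fun c => edgePairs (E c) := by
  have hpair : PolyTime fun x : (γ × WordEdge) × WordEdge => (x.1.2, x.2) :=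
    PolyTime.id.fst.snd.pair PolyTime.id.snd
  have hmap : PolyTime fun x : γ × WordEdge => (E x.1).map fun e' => (x.2, e') :=
    (hE.comp PolyTime.id.fst).map (f := fun (x : γ × WordEdge) e' => (x.2, e')) hpair
  have hprod : PolyTime fun c => (E c).flatMap fun e => (E c).map fun e' => (e, e') :=
    hE.flatMap (f := fun c e => (E c).map fun e' => (e, e')) hmap
  refine hprod.filter (f := fun _ x =>
    !decide (x.1.2.1 = syncWord) || decide (x.2.2.1 = syncWord)) ?_
  have hx : PolyTime fun x : γ × WordEdge × WordEdge => x.2 := PolyTime.id.snd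
  exact (hx.fst.snd.fst.decide_eq (.const _)).not.or (hx.snd.snd.fst.decide_eq (.const _))

theorem reachablePairs {init : γ → List InputSymbol} {E : γ → List WordEdge}
    (hinit : PolyTime init) (hE : PolyTime E) :
    PolyTime fun c => reachablePairs (init c) (E c) := by
  have hy : PolyTime fun x : γ × (WordEdge × WordEdge) × (WordEdge × WordEdge) => x.2.1 :=
    PolyTime.id.snd.fst
  have hx : PolyTime fun x : γ × (WordEdge × WordEdge) × (WordEdge × WordEdge) => x.2.2 :=
    PolyTime.id.snd.snd
  have hr : PolyTime fun x : γ × (WordEdge × WordEdge) × (WordEdge × WordEdge) =>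
      decide (x.2.1.1.2.2 = x.2.2.1.1) && decide (x.2.1.2.2.2 = x.2.2.2.1) :=
    (hy.fst.snd.snd.decide_eq hx.fst.fst).and (hy.snd.snd.snd.decide_eq hx.snd.fst)
  have hQ : PolyTime fun c => _root_.edgePairs (_root_.extendEdges (init c) (E c)) :=
    (hinit.extendEdges hE).edgePairs
  have hx₀ : PolyTime fun c =>
      (((syncWord, stayWord, syncWord), (init c, stayWord, init c)) : WordEdge × WordEdge) :=
    (const _).pair (hinit.pair ((const _).pair hinit))
  have h := PolyTime.reachList (α := WordEdge × WordEdge)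
    (r := fun _ y x => decide (y.1.2.2 = x.1.1) && decide (y.2.2.2 = x.2.1)) hr hQ hx₀
  unfold _root_.reachablePairs
  exact h

theorem isAction {l : γ → List InputSymbol} (hl : PolyTime l) :
    PolyTime fun c => isAction (l c) :=
  (hl.decide_eq (.const _)).not.and (hl.decide_eq (.const _)).not

theorem checkSound {init : γ → List InputSymbol} {E : γ → List WordEdge}
    {comm : γ → List (List InputSymbol × List InputSymbol)}
    (hinit : PolyTime init) (hE : PolyTime E) (hcomm : PolyTime comm) :
    PolyTime fun c => checkSound (init c) (E c) (comm c) := by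
  refine (hinit.reachablePairs hE).all (f := fun c x =>
    !_root_.isAction x.1.2.1 || (!_root_.isAction x.2.2.1 ||
      decide ((x.2.2.1, x.1.2.1) ∈ comm c))) ?_
  have hx : PolyTime fun x : γ × WordEdge × WordEdge => x.2 := PolyTime.id.snd
  have hmem : PolyTime fun x : γ × WordEdge × WordEdge =>
      decide ((x.2.2.2.1, x.2.1.2.1) ∈ comm x.1) := by
    convert PolyTime.decide_mem (hx.snd.snd.fst.pair hx.fst.snd.fst) (hcomm.comp PolyTime.id.fst)
  exact hx.fst.snd.fst.isAction.not.or (hx.snd.snd.fst.isAction.not.or hmem)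

theorem checkParsed : PolyTime checkParsed := by
  have hl : PolyTime fun l : List (List (List (List InputSymbol))) => l := .id
  have hs := hl.tail.headI
  refine checkSound hs.headI.tail.headI ?_ ?_
  · have hr : PolyTime fun x : List (List (List (List InputSymbol))) × List (List InputSymbol) =>
        x.2 := PolyTime.id.snd
    exact (hs.headI.tail.tail.tail.cons hs.tail).map (f := fun _ r => recordEdge r)
      (hr.headI.pair (hr.tail.headI.pair hr.tail.tail.headI))
  · have hr : PolyTime fun x : List (List (List (List InputSymbol))) × List (List InputSymbol) =>
        x.2 := PolyTime.id.snd
    exact hl.tail.tail.headI.map (f := fun _ r => (r.headI, r.tail.headI))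
      (hr.headI.pair hr.tail.headI)

end PolyTime

/-! ### Paths of control flow graphs -/

theorem LabeledPath.append {L A : Type} {Δ : List (L × A × L)} {p q r : L} {u v : List A}
    (h : LabeledPath Δ p u q) (h' : LabeledPath Δ q v r) : LabeledPath Δ p (u ++ v) r := by
  induction h with
  | nil => exact h'
  | cons he _ ih => exact .cons he (ih h')

theorem LabeledPath.snoc {L A : Type} {Δ : List (L × A × L)} {p q r : L} {u : List A} {x : A}
    (h : LabeledPath Δ p u q) (he : (q, x, r) ∈ Δ) : LabeledPath Δ p (u ++ [x]) r :=
  h.append (.cons he (.nil r))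

theorem LabeledPath.exists_of_append {L A : Type} {Δ : List (L × A × L)} {p r : L}
    {u v : List A} (h : LabeledPath Δ p (u ++ v) r) :
    ∃ q, LabeledPath Δ p u q ∧ LabeledPath Δ q v r := by
  induction u generalizing p with
  | nil => exact ⟨p, .nil p, h⟩
  | cons x u ih =>
    rcases h with _ | ⟨he, h⟩
    obtain ⟨q, h₁, h₂⟩ := ih h
    exact ⟨q, .cons he h₁, h₂⟩

theorem LabeledPath.eq_of_nil {L A : Type} {Δ : List (L × A × L)} {p q : L}
    (h : LabeledPath Δ p [] q) : p = q := by
  cases h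
  rfl

theorem LabeledPath.exists_of_cons {L A : Type} {Δ : List (L × A × L)} {p r : L} {x : A}
    {u : List A} (h : LabeledPath Δ p (x :: u) r) :
    ∃ q, (p, x, q) ∈ Δ ∧ LabeledPath Δ q u r := by
  rcases h with _ | ⟨he, h⟩
  exact ⟨_, he, h⟩

theorem LabeledPath.exists_of_snoc {L A : Type} {Δ : List (L × A × L)} {p r : L} {x : A}
    {u : List A} (h : LabeledPath Δ p (u ++ [x]) r) :
    ∃ q, LabeledPath Δ p u q ∧ (q, x, r) ∈ Δ := by
  obtain ⟨q, h₁, h₂⟩ := h.exists_of_append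
  obtain ⟨r', he, h₃⟩ := h₂.exists_of_cons
  obtain rfl := h₃.eq_of_nil
  exact ⟨q, h₁, he⟩

section syncCount

variable {Act S : Type}

@[simp] theorem syncCount_nil : syncCount ([] : List (Act ⊕ (S ⊕ Unit))) = 0 := rfl

@[simp] theorem syncCount_append (τ σ : List (Act ⊕ (S ⊕ Unit))) :
    syncCount (τ ++ σ) = syncCount τ + syncCount σ := List.countP_append

@[simp] theorem syncCount_cons_action (a : Act) (τ : List (Act ⊕ (S ⊕ Unit))) :
    syncCount (Sum.inl a :: τ) = syncCount τ := by
  simp [syncCount]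

@[simp] theorem syncCount_cons_sync (u : Unit) (τ : List (Act ⊕ (S ⊕ Unit))) :
    syncCount (Sum.inr (Sum.inr u) :: τ) = syncCount τ + 1 := by
  simp [syncCount]

/-- Some traces of the instrumentation contain `a` and `b` with fewer sync-points before `a` than
before `b`. -/
def SyncBefore (G' : CFG Act (S ⊕ Unit)) (a b : Act) : Prop :=
  ∃ τ σ τ' σ' : List (Act ⊕ (S ⊕ Unit)), τ ++ Sum.inl a :: σ ∈ G'.traces ∧
    τ' ++ Sum.inl b :: σ' ∈ G'.traces ∧ syncCount τ < syncCount τ'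

theorem minSync_lt_maxSync_iff (G' : CFG Act (S ⊕ Unit)) (a b : Act) :
    minSync G' a < maxSync G' b ↔ SyncBefore G' a b := by
  rw [minSync, maxSync, sInf_lt_iff]
  constructor
  · rintro ⟨_, ⟨τ, σ, h, rfl⟩, hlt⟩
    obtain ⟨_, ⟨τ', σ', h', rfl⟩, hlt⟩ := lt_sSup_iff.mp hlt
    exact ⟨τ, σ, τ', σ', h, h', by exact_mod_cast hlt⟩
  · rintro ⟨τ, σ, τ', σ', h, h', hlt⟩
    exact ⟨_, ⟨τ, σ, h, rfl⟩, lt_sSup_iff.mpr ⟨_, ⟨τ', σ', h', rfl⟩, by exact_mod_cast hlt⟩⟩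

/-- Only the part of the traces before the two actions matters, since the exit location is
reachable from every location. -/
theorem syncBefore_iff_exists_edges (G' : CFG Act (S ⊕ Unit)) (a b : Act) :
    SyncBefore G' a b ↔ ∃ p q p' q', (p, Sum.inl a, q) ∈ G'.edges ∧
      (p', Sum.inl b, q') ∈ G'.edges ∧ ∃ τ τ', LabeledPath G'.edges G'.init τ p ∧
        LabeledPath G'.edges G'.init τ' p' ∧ syncCount τ < syncCount τ' := by
  constructor
  · rintro ⟨τ, σ, τ', σ', h, h', hlt⟩
    obtain ⟨p, h₁, h₂⟩ := LabeledPath.exists_of_append h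
    obtain ⟨p', h₁', h₂'⟩ := LabeledPath.exists_of_append h'
    obtain ⟨q, he, _⟩ := h₂.exists_of_cons
    obtain ⟨q', he', _⟩ := h₂'.exists_of_cons
    exact ⟨p, q, p', q', he, he', τ, τ', h₁, h₁', hlt⟩
  · rintro ⟨p, q, p', q', he, he', τ, τ', h, h', hlt⟩
    obtain ⟨σ, hσ⟩ := G'.coreachable q
    obtain ⟨σ', hσ'⟩ := G'.coreachable q'
    exact ⟨τ, σ, τ', σ', h.append (.cons he hσ), h'.append (.cons he' hσ'), hlt⟩

end syncCount

/-! ### Correctness of the decision procedure -/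

/-- A bit string as a word of input symbols. -/
def bitWord (w : List Bool) : List InputSymbol := w.map InputSymbol.bit

theorem bitWord_injective : Function.Injective bitWord :=
  List.map_injective_iff.mpr fun _ _ h => by simpa using h

theorem bitWord_ne_syncWord (w : List Bool) : bitWord w ≠ syncWord := by
  rcases w with _ | ⟨b, w⟩ <;> simp [bitWord, syncWord]

theorem bitWord_ne_stayWord (w : List Bool) : bitWord w ≠ stayWord := by
  rcases w with _ | ⟨b, w⟩ <;> simp [bitWord, stayWord]

/-- Names of locations as words of input symbols. -/
def locWord {n : ℕ} (p : Fin n) : List InputSymbol := bitWord (Computability.encodeNat p)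

theorem locWord_injective {n : ℕ} : Function.Injective (locWord (n := n)) := by
  intro p q h
  have := congrArg Computability.decodeNat (bitWord_injective h)
  rw [Computability.decode_encodeNat, Computability.decode_encodeNat] at this
  exact Fin.ext this

/-- Labels as words of input symbols. -/
def labelWord {Act S : Type} (name : Act → List Bool) : Act ⊕ S → List InputSymbol
  | Sum.inl a => bitWord (name a)
  | Sum.inr _ => syncWord

/-- Edges as triples of words of input symbols. -/
def wordEdge {Act S : Type} {n : ℕ} (name : Act → List Bool) (e : Fin n × (Act ⊕ S) × Fin n) :
    WordEdge :=
  (locWord e.1, labelWord name e.2.1, locWord e.2.2)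

section checkSound

variable {Act : Type} {name : Act → List Bool} {G : CFG Act (Empty ⊕ Unit)}

/-- The edges on which the decision procedure operates. -/
local notation "extended" => extendEdges (locWord G.init) (G.edges.map (wordEdge name))

/-- The pairs of edges that the decision procedure finds. -/
local notation "pairs" => reachablePairs (locWord G.init) (G.edges.map (wordEdge name))

theorem mem_extendEdges {init : List InputSymbol} {E : List WordEdge} {e : WordEdge} :
    e ∈ extendEdges init E ↔ e = (syncWord, syncWord, init) ∨ e ∈ E ∨
      ∃ d, (d = (syncWord, syncWord, init) ∨ d ∈ E) ∧
        (e = (d.1, stayWord, d.1) ∨ e = (d.2.2, stayWord, d.2.2)) := by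
  simp only [extendEdges, List.mem_append, List.mem_cons, List.mem_flatMap, List.not_mem_nil,
    or_false, or_assoc]

theorem wordEdge_mem_extendEdges {e : Fin G.numLoc × (Act ⊕ (Empty ⊕ Unit)) × Fin G.numLoc}
    (he : e ∈ G.edges) : wordEdge name e ∈ extended :=
  mem_extendEdges.mpr (Or.inr (Or.inl (List.mem_map_of_mem he)))

theorem stay_mem_extendEdges {p : Fin G.numLoc} {τ : List (Act ⊕ (Empty ⊕ Unit))}
    (h : LabeledPath G.edges G.init τ p) : (locWord p, stayWord, locWord p) ∈ extended := by
  rw [mem_extendEdges]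
  right; right
  rcases τ.eq_nil_or_concat with rfl | ⟨τ, x, rfl⟩
  · obtain rfl := h.eq_of_nil
    exact ⟨_, Or.inl rfl, Or.inr rfl⟩
  · rw [List.concat_eq_append] at h
    obtain ⟨q, _, he⟩ := h.exists_of_snoc
    exact ⟨_, Or.inr (List.mem_map_of_mem he), Or.inr rfl⟩

theorem stay_syncWord_mem_extendEdges : (syncWord, stayWord, syncWord) ∈ extended :=
  mem_extendEdges.mpr (Or.inr (Or.inr ⟨_, Or.inl rfl, Or.inl rfl⟩))

theorem mem_edgePairs {E : List WordEdge} {e e' : WordEdge} :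
    (e, e') ∈ edgePairs E ↔
      e ∈ E ∧ e' ∈ E ∧ (e.2.1 = syncWord → e'.2.1 = syncWord) := by
  simp only [edgePairs, List.mem_filter, List.mem_flatMap, List.mem_map, Prod.mk.injEq,
    Bool.or_eq_true, Bool.not_eq_true', decide_eq_false_iff_not, decide_eq_true_eq]
  constructor
  · rintro ⟨⟨e, he, e', he', rfl, rfl⟩, h⟩
    exact ⟨he, he', by tauto⟩
  · rintro ⟨he, he', h⟩
    exact ⟨⟨e, he, e', he', rfl, rfl⟩, by tauto⟩

theorem stayWord_ne_syncWord : stayWord ≠ syncWord := by simp [stayWord, syncWord]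

/-- The locations `x` and `y` can be reached simultaneously. -/
def ReachLoc (name : Act → List Bool) (G : CFG Act (Empty ⊕ Unit)) (x y : List InputSymbol) :
    Prop :=
  ∃ d ∈ reachablePairs (locWord G.init) (G.edges.map (wordEdge name)), d.1.2.2 = x ∧ d.2.2.2 = y

theorem ReachLoc.mem_reachablePairs {x y : List InputSymbol} (h : ReachLoc name G x y)
    {e e' : WordEdge} (he : e ∈ extended) (he' : e' ∈ extended) (hx : e.1 = x) (hy : e'.1 = y)
    (hs : e.2.1 = syncWord → e'.2.1 = syncWord) : (e, e') ∈ pairs := by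
  obtain ⟨d, hd, rfl, rfl⟩ := h
  exact mem_reachList_of_mem hd (mem_edgePairs.mpr ⟨he, he', hs⟩) (by simp [hx, hy])

theorem ReachLoc.step {x y : List InputSymbol} (h : ReachLoc name G x y)
    {e e' : WordEdge} (he : e ∈ extended) (he' : e' ∈ extended) (hx : e.1 = x) (hy : e'.1 = y)
    (hs : e.2.1 = syncWord → e'.2.1 = syncWord) : ReachLoc name G e.2.2 e'.2.2 :=
  ⟨_, h.mem_reachablePairs he he' hx hy hs, rfl, rfl⟩

theorem reachLoc_syncWord {p : Fin G.numLoc} {τ : List (Act ⊕ (Empty ⊕ Unit))}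
    (h : LabeledPath G.edges G.init τ p) : ReachLoc name G syncWord (locWord p) := by
  induction τ using List.reverseRecOn generalizing p with
  | nil =>
    obtain rfl := h.eq_of_nil
    refine ⟨_, mem_reachList_self (mem_edgePairs.mpr ⟨stay_syncWord_mem_extendEdges,
      stay_mem_extendEdges h, fun h => h⟩), rfl, rfl⟩
  | append_singleton τ x ih =>
    obtain ⟨q, h, he⟩ := h.exists_of_snoc
    exact (ih h).step stay_syncWord_mem_extendEdges (wordEdge_mem_extendEdges he) rfl rfl
      fun h => absurd h stayWord_ne_syncWord

/-- Two paths, the first one with fewer sync-points, are followed simultaneously by taking each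
sync-point of the first path together with one of the second path. -/
theorem reachLoc_of_syncCount_lt {p p' : Fin G.numLoc} {τ τ' : List (Act ⊕ (Empty ⊕ Unit))}
    (h : LabeledPath G.edges G.init τ p) (h' : LabeledPath G.edges G.init τ' p')
    (hlt : syncCount τ < syncCount τ') : ReachLoc name G (locWord p) (locWord p') := by
  induction τ' using List.reverseRecOn generalizing p p' τ with
  | nil => simp at hlt
  | append_singleton τ' x' ih' =>
    obtain ⟨q', hq', he'⟩ := h'.exists_of_snoc
    by_cases hlt' : syncCount τ < syncCount τ'
    · exact (ih' h hq' hlt').step (stay_mem_extendEdges h) (wordEdge_mem_extendEdges he') rfl rfl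
        fun h => absurd h stayWord_ne_syncWord
    rcases x' with b | s | ⟨⟩
    · simp only [syncCount_append, syncCount_cons_action, syncCount_nil] at hlt
      omega
    · exact s.elim
    simp only [syncCount_append, syncCount_cons_sync, syncCount_nil] at hlt
    induction τ using List.reverseRecOn generalizing p with
    | nil =>
      obtain rfl := h.eq_of_nil
      exact (reachLoc_syncWord hq').step (mem_extendEdges.mpr (Or.inl rfl))
        (wordEdge_mem_extendEdges he') rfl rfl fun _ => rfl
    | append_singleton τ x ih =>
      obtain ⟨q, hq, he⟩ := h.exists_of_snoc
      rcases x with a | s | ⟨⟩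
      · simp only [syncCount_append, syncCount_cons_action, syncCount_nil] at hlt hlt'
        exact (ih hq (by omega) (by omega)).step (wordEdge_mem_extendEdges he)
          (stay_mem_extendEdges h') rfl rfl fun h => absurd h (bitWord_ne_syncWord _)
      · exact s.elim
      · simp only [syncCount_append, syncCount_cons_sync, syncCount_nil] at hlt hlt'
        exact (ih' hq hq' (by omega)).step (wordEdge_mem_extendEdges he)
          (wordEdge_mem_extendEdges he') rfl rfl fun _ => rfl

theorem exists_path_of_mem_extendEdges {e : WordEdge} (he : e ∈ extended) {p : Fin G.numLoc}
    (hp : e.1 = locWord p) {τ : List (Act ⊕ (Empty ⊕ Unit))}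
    (h : LabeledPath G.edges G.init τ p) :
    ∃ q τ', e.2.2 = locWord q ∧ LabeledPath G.edges G.init τ' q ∧
      syncCount τ' = syncCount τ + if e.2.1 = syncWord then 1 else 0 := by
  have stay : ∀ x, e = (x, stayWord, x) → ∃ q τ', e.2.2 = locWord q ∧
      LabeledPath G.edges G.init τ' q ∧
      syncCount τ' = syncCount τ + if e.2.1 = syncWord then 1 else 0 := by
    rintro x rfl
    exact ⟨p, τ, hp, h, by simp [stayWord_ne_syncWord]⟩
  rcases mem_extendEdges.mp he with rfl | he | ⟨d, _, rfl | rfl⟩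
  · exact absurd hp (bitWord_ne_syncWord _).symm
  · obtain ⟨⟨q, x, r⟩, hmem, rfl⟩ := List.mem_map.mp he
    obtain rfl : q = p := locWord_injective hp
    refine ⟨r, _, rfl, h.snoc hmem, ?_⟩
    rcases x with a | s | ⟨⟩
    · simp [wordEdge, labelWord, bitWord_ne_syncWord]
    · exact s.elim
    · simp [wordEdge, labelWord]
  · exact stay _ rfl
  · exact stay _ rfl

/-- What it means for two locations to be simultaneously reachable: a path to the additional
location counts as one sync-point less than none. -/
def SyncBeforeLoc (G : CFG Act (Empty ⊕ Unit)) (x y : List InputSymbol) : Prop :=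
  ∃ p' τ', y = locWord p' ∧ LabeledPath G.edges G.init τ' p' ∧
    (x = syncWord ∨ ∃ p τ, x = locWord p ∧ LabeledPath G.edges G.init τ p ∧
      syncCount τ < syncCount τ')

theorem SyncBeforeLoc.step {e e' : WordEdge} (h : SyncBeforeLoc G e.1 e'.1) (he : e ∈ extended)
    (he' : e' ∈ extended) (hs : e.2.1 = syncWord → e'.2.1 = syncWord) :
    SyncBeforeLoc G e.2.2 e'.2.2 := by
  obtain ⟨p', τ', hp', h', h⟩ := h
  obtain ⟨q', σ', hq', hpath', hcount'⟩ := exists_path_of_mem_extendEdges he' hp' h'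
  refine ⟨q', σ', hq', hpath', ?_⟩
  rcases h with hx | ⟨p, τ, hp, h, hlt⟩
  · have stay : ∀ x, e = (x, stayWord, x) → e.2.2 = syncWord := by
      rintro x rfl
      exact hx
    rcases mem_extendEdges.mp he with rfl | he | ⟨d, _, rfl | rfl⟩
    · right
      refine ⟨G.init, [], rfl, .nil _, ?_⟩
      rw [hcount', if_pos (hs rfl)]
      exact Nat.succ_pos _
    · obtain ⟨d, _, rfl⟩ := List.mem_map.mp he
      exact absurd hx (bitWord_ne_syncWord _)
    · exact Or.inl (stay _ rfl)
    · exact Or.inl (stay _ rfl)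
  · obtain ⟨q, σ, hq, hpath, hcount⟩ := exists_path_of_mem_extendEdges he hp h
    refine Or.inr ⟨q, σ, hq, hpath, ?_⟩
    rw [hcount, hcount']
    split_ifs with h₁ h₂
    · omega
    · exact absurd (hs h₁) h₂
    · omega
    · omega

theorem syncBeforeLoc_of_mem_reachablePairs :
    ∀ d ∈ pairs, SyncBeforeLoc G d.1.1 d.2.1 ∧ SyncBeforeLoc G d.1.2.2 d.2.2.2 := by
  refine reachList_induction ?_ ?_
  · have h : SyncBeforeLoc G syncWord (locWord G.init) :=
      ⟨G.init, [], rfl, .nil _, Or.inl rfl⟩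
    exact ⟨h, h⟩
  · rintro ⟨d, d'⟩ ⟨e, e'⟩ ⟨_, h⟩ hmem hr
    simp only [Bool.and_eq_true, decide_eq_true_eq] at hr
    obtain ⟨he, he', hs⟩ := mem_edgePairs.mp hmem
    dsimp only at h
    rw [hr.1, hr.2] at h
    exact ⟨h, h.step he he' hs⟩

theorem isAction_iff {l : List InputSymbol} :
    isAction l = true ↔ l ≠ syncWord ∧ l ≠ stayWord := by
  simp [isAction]

theorem exists_edge_of_isAction {e : WordEdge} (he : e ∈ extended) (ha : isAction e.2.1 = true) :
    ∃ p a q, (p, Sum.inl a, q) ∈ G.edges ∧ e = (locWord p, bitWord (name a), locWord q) := by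
  rw [isAction_iff] at ha
  rcases mem_extendEdges.mp he with rfl | he | ⟨d, _, rfl | rfl⟩
  · exact absurd rfl ha.1
  · obtain ⟨⟨p, a | s, q⟩, hmem, rfl⟩ := List.mem_map.mp he
    · exact ⟨p, a, q, hmem, rfl⟩
    · exact absurd rfl ha.1
  · exact absurd rfl ha.2
  · exact absurd rfl ha.2

theorem checkSound_iff (hname : Function.Injective name) (comm : List (Act × Act)) :
    checkSound (locWord G.init) (G.edges.map (wordEdge name))
      (comm.map fun p => (bitWord (name p.1), bitWord (name p.2))) = true ↔
    ∀ a b, SyncBefore G a b → (b, a) ∈ comm := by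
  have hword : Function.Injective fun p : Act × Act => (bitWord (name p.1), bitWord (name p.2)) :=
    fun p q h => by
      simp only [Prod.mk.injEq] at h
      exact Prod.ext (hname (bitWord_injective h.1)) (hname (bitWord_injective h.2))
  have hcomm : ∀ a b, (bitWord (name b), bitWord (name a)) ∈
      (comm.map fun p => (bitWord (name p.1), bitWord (name p.2))) ↔ (b, a) ∈ comm :=
    fun a b => List.mem_map_of_injective hword (a := (b, a))
  have haction : ∀ a, isAction (bitWord (name a)) = true := fun a =>
    isAction_iff.mpr ⟨bitWord_ne_syncWord _, bitWord_ne_stayWord _⟩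
  simp only [checkSound, List.all_eq_true, Bool.or_eq_true, Bool.not_eq_true', decide_eq_true_eq]
  constructor
  · intro h a b hab
    obtain ⟨p, q, p', q', he, he', τ, τ', hτ, hτ', hlt⟩ :=
      (syncBefore_iff_exists_edges G a b).mp hab
    have hmem := (reachLoc_of_syncCount_lt (name := name) hτ hτ' hlt).mem_reachablePairs
      (wordEdge_mem_extendEdges he) (wordEdge_mem_extendEdges he') rfl rfl
      fun h => absurd h (bitWord_ne_syncWord _)
    have := h _ hmem
    simp only [wordEdge, labelWord, haction, Bool.true_eq_false, false_or] at this
    exact (hcomm a b).mp this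
  · rintro h ⟨e, e'⟩ hmem
    by_cases ha : isAction e.2.1 = true
    · by_cases hb : isAction e'.2.1 = true
      · right; right
        have hE : e ∈ extended ∧ e' ∈ extended := by
          have := (iterate_reachStep_sublist _).subset hmem
          exact ⟨(mem_edgePairs.mp this).1, (mem_edgePairs.mp this).2.1⟩
        obtain ⟨⟨p₁, τ', hp₁, hτ', h₁⟩, _⟩ := syncBeforeLoc_of_mem_reachablePairs _ hmem
        obtain ⟨p, a, q, he, rfl⟩ := exists_edge_of_isAction hE.1 ha
        obtain ⟨p', b, q', he', rfl⟩ := exists_edge_of_isAction hE.2 hb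
        obtain rfl : p' = p₁ := locWord_injective hp₁
        rcases h₁ with h₁ | ⟨p₂, τ, hp₂, hτ, hlt⟩
        · exact absurd h₁ (bitWord_ne_syncWord _)
        · obtain rfl : p = p₂ := locWord_injective hp₂
          exact (hcomm a b).mpr (h a b ((syncBefore_iff_exists_edges G a b).mpr
            ⟨p, q, p', q', he, he', τ, τ', hτ, hτ', hlt⟩))
      · exact Or.inr (Or.inl (by simpa using hb))
    · exact Or.inl (by simpa using ha)

end checkSound

/-! ### Correctness of the parser -/

/-- The parsed input. -/
def parse (w : List InputSymbol) : List (List (List (List InputSymbol))) :=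
  w.foldr InputSymbol.parseCons []

theorem parseReverse_reverse (w : List InputSymbol) : parseReverse w.reverse = parse w := by
  simp [parseReverse, parse]

theorem parse_encodeName (w : List Bool) {rest : List InputSymbol} {r s t}
    (h : parse rest = (r :: s) :: t) :
    parse (encodeName w ++ rest) = ((bitWord w :: r) :: s) :: t := by
  induction w with
  | nil => simpa [encodeName, parse, bitWord, parseCons] using congrArg (comma.parseCons) h
  | cons b w ih =>
    have : parse (encodeName (b :: w) ++ rest) =
        (bit b).parseCons (parse (encodeName w ++ rest)) := rfl
    rw [this, ih]
    simp [parseCons, bitWord]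

theorem parse_encodeLabel {Act S : Type} (name : Act → List Bool) (x : Act ⊕ S)
    {rest : List InputSymbol} {r s t} (h : parse rest = (r :: s) :: t) :
    parse (encodeLabel name x ++ rest) = ((labelWord name x :: r) :: s) :: t := by
  rcases x with a | x
  · exact parse_encodeName _ h
  · have : parse (encodeLabel name (Sum.inr x : Act ⊕ S) ++ rest) =
        sync.parseCons (comma.parseCons (parse rest)) := rfl
    rw [this, h]
    simp [parseCons, labelWord, syncWord]

theorem parse_semicolon {rest : List InputSymbol} {s t} (h : parse rest = s :: t) :
    parse ([semicolon] ++ rest) = ([] :: s) :: t := by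
  have : parse ([semicolon] ++ rest) = semicolon.parseCons (parse rest) := rfl
  rw [this, h]
  simp [parseCons]

theorem parse_bar (rest : List InputSymbol) : parse ([bar] ++ rest) = [] :: parse rest := by
  have : parse ([bar] ++ rest) = bar.parseCons (parse rest) := rfl
  rw [this]
  simp [parseCons]

theorem parse_flatMap {X : Type} {encode : X → List InputSymbol}
    {record : X → List (List InputSymbol)}
    (hencode : ∀ x rest s t, parse rest = s :: t →
      parse (encode x ++ rest) = (record x :: s) :: t)
    (l : List X) (rest : List InputSymbol) :
    parse (l.flatMap encode ++ ([bar] ++ rest)) = l.map record :: parse rest := by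
  induction l with
  | nil => exact parse_bar rest
  | cons x l ih =>
    rw [List.flatMap_cons, List.append_assoc, hencode _ _ _ _ ih]
    rfl

/-- The record of an edge. -/
def edgeRecord {Act S : Type} {n : ℕ} (name : Act → List Bool)
    (e : Fin n × (Act ⊕ S) × Fin n) : List (List InputSymbol) :=
  [locWord e.1, labelWord name e.2.1, locWord e.2.2]

theorem CFG.edges_ne_nil {Act S : Type} (G : CFG Act S) : G.edges ≠ [] := by
  intro h
  obtain ⟨w, hw⟩ := G.reachable G.exit
  rcases w with _ | ⟨x, w⟩
  · exact G.init_ne_exit hw.eq_of_nil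
  · obtain ⟨q, he, _⟩ := hw.exists_of_cons
    rw [h] at he
    exact absurd he List.not_mem_nil

theorem parse_encodeCFG {Act S : Type} (name : Act → List Bool) (G : CFG Act S)
    (rest : List InputSymbol) : ∃ e E, G.edges = e :: E ∧
    parse (encodeCFG name G ++ rest) =
      ((bitWord (Computability.encodeNat G.numLoc) :: locWord G.init :: locWord G.exit ::
        edgeRecord name e) :: E.map (edgeRecord name)) :: parse rest := by
  obtain ⟨e, E, hE⟩ := List.exists_cons_of_ne_nil G.edges_ne_nil
  refine ⟨e, E, hE, ?_⟩
  have h := parse_flatMap (record := edgeRecord name)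
    (encode := fun e : Fin G.numLoc × (Act ⊕ S) × Fin G.numLoc =>
      encodeName (Computability.encodeNat e.1) ++ encodeLabel name e.2.1 ++
      encodeName (Computability.encodeNat e.2.2) ++ [semicolon])
    (fun x rest s t h => by
      simp only [List.append_assoc]
      exact parse_encodeName _ (parse_encodeLabel name _ (parse_encodeName _ (parse_semicolon h))))
    G.edges rest
  simp only [encodeCFG, List.append_assoc] at h ⊢
  refine parse_encodeName _ (parse_encodeName _ (parse_encodeName _ ?_))
  rw [h, hE, List.map_cons]

theorem checkParsed_parse_encodeInput {Act : Type} {name : Act → List Bool}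
    (hname : Function.Injective name) (x : SoundnessInput Act) :
    checkParsed (parse (encodeInput name x)) = true ↔
      ∀ a b, SyncBefore x.G' a b → (b, a) ∈ x.comm := by
  have hcomm := parse_flatMap
    (record := fun p : Act × Act => [bitWord (name p.1), bitWord (name p.2)])
    (encode := fun p : Act × Act => encodeName (name p.1) ++ encodeName (name p.2) ++ [semicolon])
    (fun x rest s t h => by
      simp only [List.append_assoc]
      exact parse_encodeName _ (parse_encodeName _ (parse_semicolon h)))
    x.comm []
  rw [List.append_nil] at hcomm
  rw [← checkSound_iff hname]
  simp only [encodeInput, List.append_assoc] at hcomm ⊢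
  obtain ⟨_, _, _, h₁⟩ := parse_encodeCFG name x.G (encodeCFG name x.G' ++
    ((x.comm.flatMap fun p => encodeName (name p.1) ++ (encodeName (name p.2) ++ [semicolon])) ++
      [bar]))
  obtain ⟨e, E, hE, h₂⟩ := parse_encodeCFG name x.G'
    ((x.comm.flatMap fun p => encodeName (name p.1) ++ (encodeName (name p.2) ++ [semicolon])) ++
      [bar])
  rw [h₁, h₂, hcomm, hE]
  simp only [checkParsed, List.tail_cons, List.headI_cons, List.map_cons, List.map_map]
  rfl

/-! ### Projections of indexed traces -/

namespace IndexedTrace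

variable {X Y Z : Type}

@[simp] theorem local_nil (i : ℕ) : IndexedTrace.local ([] : IndexedTrace X) i = [] := rfl

theorem local_cons (s : X × ℕ) (τ : IndexedTrace X) (i : ℕ) :
    IndexedTrace.local (s :: τ) i =
      if s.2 = i then s.1 :: IndexedTrace.local τ i else IndexedTrace.local τ i := by
  unfold IndexedTrace.local
  rw [List.filterMap_cons]
  split_ifs <;> rfl

@[simp] theorem local_append (τ σ : IndexedTrace X) (i : ℕ) :
    IndexedTrace.local (τ ++ σ) i = IndexedTrace.local τ i ++ IndexedTrace.local σ i :=
  List.filterMap_append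

theorem local_cons_self (x : X) (τ : IndexedTrace X) (i : ℕ) :
    IndexedTrace.local ((x, i) :: τ) i = x :: IndexedTrace.local τ i := by
  simp [local_cons]

theorem local_cons_of_ne (x : X) (τ : IndexedTrace X) {i j : ℕ} (h : j ≠ i) :
    IndexedTrace.local ((x, j) :: τ) i = IndexedTrace.local τ i := by
  simp [local_cons, h]

theorem mem_local {x : X} {τ : IndexedTrace X} {i : ℕ} :
    x ∈ IndexedTrace.local τ i ↔ (x, i) ∈ τ := by
  simp only [IndexedTrace.local, List.mem_filterMap]
  constructor
  · rintro ⟨⟨y, j⟩, h, he⟩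
    split_ifs at he with hj
    cases he
    cases hj
    exact h
  · intro h
    exact ⟨_, h, by simp⟩

theorem local_map (f : X → Y) (τ : IndexedTrace X) (i : ℕ) :
    IndexedTrace.local (τ.map fun s => (f s.1, s.2)) i = (IndexedTrace.local τ i).map f := by
  induction τ with
  | nil => rfl
  | cons s τ ih =>
    rw [List.map_cons, local_cons, local_cons, ih]
    split_ifs <;> rfl

/-- A word executed by one thread. -/
theorem local_map_pair (w : List X) (i j : ℕ) :
    IndexedTrace.local (w.map fun x => (x, i)) j = if i = j then w else [] := by
  induction w with
  | nil => simp
  | cons x w ih =>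
    rw [List.map_cons, local_cons, ih]
    split_ifs <;> rfl

@[simp] theorem project_append (f : X → Option Y) (τ σ : IndexedTrace X) :
    IndexedTrace.project f (τ ++ σ) = IndexedTrace.project f τ ++ IndexedTrace.project f σ :=
  List.filterMap_append

theorem local_project (f : X → Option Y) (τ : IndexedTrace X) (i : ℕ) :
    (IndexedTrace.project f τ).local i = (τ.local i).filterMap f := by
  unfold IndexedTrace.project IndexedTrace.local
  rw [List.filterMap_filterMap, List.filterMap_filterMap]
  congr 1
  funext s
  rcases s with ⟨x, j⟩
  cases h : f x <;> by_cases hj : j = i <;> simp [h, hj]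

theorem project_project (f : X → Option Y) (g : Y → Option Z) (τ : IndexedTrace X) :
    (τ.project f).project g = τ.project fun x => (f x).bind g := by
  unfold IndexedTrace.project
  rw [List.filterMap_filterMap]
  congr 1
  funext s
  cases h : f s.1 <;> simp [h]

theorem project_map_pair (f : X → Option Y) (w : List X) (i : ℕ) :
    IndexedTrace.project f (w.map fun x => (x, i)) = (w.filterMap f).map fun y => (y, i) := by
  unfold IndexedTrace.project
  rw [List.filterMap_map, List.map_filterMap]
  rfl

end IndexedTrace

section Instrumentation

variable {Act : Type}

/-- The actions in a word. -/
def actionsOf {S : Type} (w : List (Act ⊕ S)) : List Act := w.filterMap Sum.getLeft?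

@[simp] theorem actionsOf_append {S : Type} (u v : List (Act ⊕ S)) :
    actionsOf (u ++ v) = actionsOf u ++ actionsOf v := List.filterMap_append

@[simp] theorem actionsOf_nil {S : Type} : actionsOf ([] : List (Act ⊕ S)) = [] := rfl

@[simp] theorem actionsOf_cons_inl {S : Type} (a : Act) (w : List (Act ⊕ S)) :
    actionsOf (Sum.inl a :: w) = a :: actionsOf w := rfl

@[simp] theorem actionsOf_cons_inr {S : Type} (s : S) (w : List (Act ⊕ S)) :
    actionsOf (Sum.inr s :: w) = actionsOf w := rfl

@[simp] theorem actionsOf_map_inl {S : Type} (w : List Act) :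
    actionsOf (w.map (Sum.inl : Act → Act ⊕ S)) = w := by
  induction w with
  | nil => rfl
  | cons a w ih => rw [List.map_cons, actionsOf_cons_inl, ih]

theorem mem_actionsOf {S : Type} {a : Act} {w : List (Act ⊕ S)} :
    a ∈ actionsOf w ↔ Sum.inl a ∈ w := by
  simp [actionsOf]

theorem syncCount_map_inl (w : List Act) :
    syncCount (w.map (Sum.inl : Act → Act ⊕ (Empty ⊕ Unit))) = 0 := by
  induction w with
  | nil => rfl
  | cons a w ih => rw [List.map_cons, syncCount_cons_action, ih]

/-! ### The order of sync-points -/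

/-- The number of sync-points that thread `i` passes. -/
def threadSyncs (i : ℕ) (τ : IndexedTrace (Act ⊕ Unit)) : ℕ :=
  τ.countP fun s => s.1.isRight && decide (s.2 = i)

theorem threadSyncs_append (i : ℕ) (τ σ : IndexedTrace (Act ⊕ Unit)) :
    threadSyncs i (τ ++ σ) = threadSyncs i τ + threadSyncs i σ := List.countP_append

theorem threadSyncs_eq_zero {T : Finset ℕ} {w : IndexedTrace (Act ⊕ Unit)}
    (hw : ∀ s ∈ w, (∃ a : Act, s.1 = Sum.inl a) ∧ s.2 ∈ T) (i : ℕ) : threadSyncs i w = 0 := by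
  refine List.countP_eq_zero.mpr fun s hs => ?_
  obtain ⟨a, ha⟩ := (hw s hs).1
  simp [ha]

theorem threadSyncs_syncWord {l : List ℕ} (hl : l.Nodup) {i : ℕ} (hi : i ∈ l) :
    threadSyncs i (l.map fun t => ((Sum.inr () : Act ⊕ Unit), t)) = 1 := by
  rw [threadSyncs, List.countP_map, ← List.count_eq_one_of_mem hl hi, List.count]
  congr 1

theorem threadSyncs_eq_of_mem {T : Finset ℕ} {w : IndexedTrace (Act ⊕ Unit)}
    (hw : w ∈ actionWords Act T + syncWords Act T) {i j : ℕ} (hi : i ∈ T) (hj : j ∈ T) :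
    threadSyncs i w = threadSyncs j w := by
  rcases (Language.mem_add _ _ _).mp hw with h | ⟨l, hl, rfl, rfl⟩
  · rw [threadSyncs_eq_zero h, threadSyncs_eq_zero h]
  · rw [threadSyncs_syncWord hl (by simpa using hi), threadSyncs_syncWord hl (by simpa using hj)]

theorem threadSyncs_eq_of_mem_kstar {T : Finset ℕ} {τ : IndexedTrace (Act ⊕ Unit)}
    (hτ : τ ∈ KStar.kstar (actionWords Act T + syncWords Act T)) {i j : ℕ} (hi : i ∈ T)
    (hj : j ∈ T) : threadSyncs i τ = threadSyncs j τ := by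
  obtain ⟨L, rfl, hL⟩ := Language.mem_kstar.mp hτ
  clear hτ
  induction L with
  | nil => rfl
  | cons w L ih =>
    have hL' : ∀ y ∈ L, y ∈ actionWords Act T + syncWords Act T := fun y hy =>
      hL y (List.mem_cons_of_mem _ hy)
    rw [List.flatten_cons, threadSyncs_append, threadSyncs_append,
      threadSyncs_eq_of_mem (hL w List.mem_cons_self) hi hj,
      ih hL']

theorem threadSyncs_eq_of_append_mem_kstar {T : Finset ℕ} {ρ σ : IndexedTrace (Act ⊕ Unit)}
    {b : Act} {k : ℕ}
    (h : ρ ++ (Sum.inl b, k) :: σ ∈ KStar.kstar (actionWords Act T + syncWords Act T))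
    {i j : ℕ} (hi : i ∈ T) (hj : j ∈ T) : threadSyncs i ρ = threadSyncs j ρ := by
  obtain ⟨L, hL, hmem⟩ := Language.mem_kstar.mp h
  clear h
  induction L generalizing ρ with
  | nil => simp at hL
  | cons w L ih =>
    rw [List.flatten_cons] at hL
    have hw := hmem w List.mem_cons_self
    have hmem' : ∀ y ∈ L, y ∈ actionWords Act T + syncWords Act T := fun y hy =>
      hmem y (List.mem_cons_of_mem _ hy)
    rcases List.append_eq_append_iff.mp hL with ⟨ρ', rfl, hρ'⟩ | ⟨ρ', rfl, hρ'⟩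
    · rcases ρ' with _ | ⟨s, ρ'⟩
      · rw [List.append_nil] at hw
        exact threadSyncs_eq_of_mem hw hi hj
      · obtain ⟨rfl, -⟩ := List.cons.inj hρ'
        rcases (Language.mem_add _ _ _).mp hw with h | ⟨l, -, -, hl⟩
        · have h' : ∀ s ∈ ρ, (∃ a : Act, s.1 = Sum.inl a) ∧ s.2 ∈ T := fun s hs =>
            h s (List.mem_append_left _ hs)
          rw [threadSyncs_eq_zero h', threadSyncs_eq_zero h']
        · have : ((Sum.inl b : Act ⊕ Unit), k) ∈ l.map fun t => ((Sum.inr () : Act ⊕ Unit), t) := by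
            rw [← hl]
            simp
          simp at this
    · rw [threadSyncs_append, threadSyncs_append, threadSyncs_eq_of_mem hw hi hj,
        ih hρ'.symm hmem']

theorem mem_of_mem_kstar {T : Finset ℕ} {τ : IndexedTrace (Act ⊕ Unit)}
    (hτ : τ ∈ KStar.kstar (actionWords Act T + syncWords Act T)) {s : (Act ⊕ Unit) × ℕ}
    (hs : s ∈ τ) : s.2 ∈ T := by
  obtain ⟨L, rfl, hL⟩ := Language.mem_kstar.mp hτ
  obtain ⟨w, hw, hs⟩ := List.mem_flatten.mp hs
  rcases (Language.mem_add _ _ _).mp (hL w hw) with h | ⟨l, -, rfl, rfl⟩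
  · exact (h s hs).2
  · obtain ⟨t, ht, rfl⟩ := List.mem_map.mp hs
    simpa using ht

theorem SyncPointTrace.mem {T : Finset ℕ} {τ : IndexedTrace (Act ⊕ Unit)}
    (h : SyncPointTrace T τ) {s : (Act ⊕ Unit) × ℕ} (hs : s ∈ τ) : s.2 ∈ T := by
  induction h with
  | done => simp at hs
  | phase h₁ hT _ ih =>
    rcases List.mem_append.mp hs with hs | hs
    · exact mem_of_mem_kstar h₁ hs
    · exact hT.1 (ih hs)

/-- When a thread `j` executes an action, every thread that still has to execute an action has
passed the same number of sync-points as `j`. -/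
theorem SyncPointTrace.threadSyncs_eq {T : Finset ℕ} {τ : IndexedTrace (Act ⊕ Unit)}
    (h : SyncPointTrace T τ) {ρ σ : IndexedTrace (Act ⊕ Unit)} {a b : Act} {i j : ℕ}
    (hτ : τ = ρ ++ (Sum.inl b, j) :: σ) (ha : (Sum.inl a, i) ∈ σ) :
    threadSyncs i ρ = threadSyncs j ρ := by
  induction h generalizing ρ with
  | done => simp at hτ
  | @phase T T' τ₁ τ₂ h₁ hT h₂ ih =>
    rcases List.append_eq_append_iff.mp hτ with ⟨ρ', rfl, hρ'⟩ | ⟨ρ', rfl, hρ'⟩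
    · have hi : i ∈ T' := h₂.mem (s := (Sum.inl a, i)) (by rw [hρ']; simp [ha])
      have hj : j ∈ T' := h₂.mem (s := (Sum.inl b, j)) (by rw [hρ']; simp)
      rw [threadSyncs_append, threadSyncs_append,
        threadSyncs_eq_of_mem_kstar h₁ (hT.1 hi) (hT.1 hj), ih hρ']
    · rcases ρ' with _ | ⟨s, ρ'⟩
      · rw [List.nil_append] at hρ'
        have hi : i ∈ T' := h₂.mem (s := (Sum.inl a, i)) (by rw [← hρ']; simp [ha])
        have hj : j ∈ T' := h₂.mem (s := (Sum.inl b, j)) (by rw [← hρ']; simp)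
        rw [List.append_nil] at h₁
        exact threadSyncs_eq_of_mem_kstar h₁ (hT.1 hi) (hT.1 hj)
      · obtain ⟨rfl, hσ⟩ := List.cons.inj hρ'
        have hj : j ∈ T := mem_of_mem_kstar h₁ (s := (Sum.inl b, j)) (by simp)
        have hi : i ∈ T := by
          rw [hσ] at ha
          rcases List.mem_append.mp ha with ha | ha
          · exact mem_of_mem_kstar h₁ (s := (Sum.inl a, i)) (by simp [ha])
          · exact hT.1 (h₂.mem (s := (Sum.inl a, i)) ha)
        exact threadSyncs_eq_of_append_mem_kstar h₁ hi hj

theorem threadSyncs_project (τ : IndexedTrace (Act ⊕ (Empty ⊕ Unit))) (i : ℕ) :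
    threadSyncs i (τ.project SyncAlphabet.eraseLeft) = syncCount (τ.local i) := by
  induction τ with
  | nil => rfl
  | cons s τ ih =>
    have h : ∀ s : (Act ⊕ (Empty ⊕ Unit)) × ℕ,
        threadSyncs i (IndexedTrace.project SyncAlphabet.eraseLeft [s]) =
          syncCount (IndexedTrace.local [s] i) := by
      rintro ⟨a | e | u, j⟩
      · by_cases hj : j = i <;>
          simp [IndexedTrace.project, SyncAlphabet.eraseLeft, threadSyncs, IndexedTrace.local_cons,
            hj]
      · exact e.elim
      · by_cases hj : j = i <;>
          simp [IndexedTrace.project, SyncAlphabet.eraseLeft, threadSyncs, IndexedTrace.local_cons,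
            hj]
    rw [← List.singleton_append, IndexedTrace.project_append, IndexedTrace.local_append,
      threadSyncs_append, syncCount_append, ih, h]

/-! ### Separating the first phase of a trace -/

theorem CoveredBy.append_left {I : Set (Act × Act)} {τ τ' : IndexedTrace Act}
    (h : CoveredBy I τ τ') (ρ : IndexedTrace Act) : CoveredBy I (ρ ++ τ) (ρ ++ τ') := by
  induction h with
  | refl => exact .refl
  | tail _ hstep ih =>
    obtain ⟨ρ', σ, a, b, i, j, hI, hij⟩ := hstep
    refine ih.tail ?_
    simpa using SwapStep.swap (ρ ++ ρ') σ a b i j hI hij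

theorem coveredBy_move_right {I : Set (Act × Act)} {c : Act} {k : ℕ} (ρ σ : IndexedTrace Act)
    (h : ∀ s ∈ ρ, (c, s.1) ∈ I ∧ k ≠ s.2) :
    CoveredBy I ((c, k) :: (ρ ++ σ)) (ρ ++ (c, k) :: σ) := by
  induction ρ with
  | nil => exact .refl
  | cons s ρ ih =>
    have hs := h s List.mem_cons_self
    have h₁ : CoveredBy I ((c, k) :: (s :: ρ ++ σ)) (s :: (c, k) :: (ρ ++ σ)) :=
      .single (.swap [] (ρ ++ σ) c s.1 k s.2 hs.1 hs.2)
    exact h₁.trans ((ih fun s hs => h s (List.mem_cons_of_mem _ hs)).append_left [s])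

/-- If the local traces are split into first parts `u i` and second parts `v i`, and the actions of
the second parts commute to the right of the actions of the first parts of other threads, then all
first parts can be executed before all second parts. -/
theorem exists_coveredBy_append {I : Set (Act × Act)} (τ : IndexedTrace Act) (u v : ℕ → List Act)
    (hτ : ∀ i, τ.local i = u i ++ v i)
    (hI : ∀ i j, i ≠ j → ∀ a ∈ u i, ∀ b ∈ v j, (b, a) ∈ I) :
    ∃ τ₀ τ₁ : IndexedTrace Act, (∀ i, τ₀.local i = u i) ∧ (∀ i, τ₁.local i = v i) ∧
      CoveredBy I τ (τ₀ ++ τ₁) := by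
  induction τ generalizing u v with
  | nil =>
    refine ⟨[], [], fun i => ?_, fun i => ?_, .refl⟩
    · exact (List.append_eq_nil_iff.mp (hτ i).symm).1.symm
    · exact (List.append_eq_nil_iff.mp (hτ i).symm).2.symm
  | cons s τ ih =>
    obtain ⟨c, k⟩ := s
    have hk := hτ k
    rw [IndexedTrace.local_cons_self] at hk
    have hne : ∀ i, i ≠ k → IndexedTrace.local τ i = u i ++ v i := fun i hi => by
      rw [← hτ i, IndexedTrace.local_cons_of_ne _ _ hi.symm]
    rcases hu : u k with _ | ⟨c', u'⟩
    · rw [hu, List.nil_append] at hk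
      obtain ⟨τ₀, τ₁, h₀, h₁, hcov⟩ := ih u (Function.update v k (IndexedTrace.local τ k)) (fun i => by
        rcases eq_or_ne i k with rfl | hi
        · simp [hu]
        · simp [hi, hne i hi]) (fun i j hij a ha b hb => by
        rcases eq_or_ne j k with rfl | hj
        · refine hI i j hij a ha b ?_
          rw [← hk]
          exact List.mem_cons_of_mem _ (by simpa using hb)
        · exact hI i j hij a ha b (by simpa [hj] using hb))
      refine ⟨τ₀, (c, k) :: τ₁, h₀, fun i => ?_, ?_⟩
      · rcases eq_or_ne i k with rfl | hi
        · rw [IndexedTrace.local_cons_self, h₁, Function.update_self, hk]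
        · rw [IndexedTrace.local_cons_of_ne _ _ hi.symm, h₁, Function.update_of_ne hi]
      · refine (hcov.append_left [(c, k)]).trans (coveredBy_move_right τ₀ τ₁ ?_)
        rintro ⟨a, i⟩ hs
        have ha : a ∈ u i := by
          rw [← h₀]
          exact IndexedTrace.mem_local.mpr hs
        have hik : i ≠ k := by
          rintro rfl
          simp [hu] at ha
        exact ⟨hI i k hik a ha c (by rw [← hk]; simp), hik.symm⟩
    · rw [hu, List.cons_append, List.cons.injEq] at hk
      obtain ⟨rfl, hk⟩ := hk
      obtain ⟨τ₀, τ₁, h₀, h₁, hcov⟩ := ih (Function.update u k u') v (fun i => by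
        rcases eq_or_ne i k with rfl | hi
        · simp [hk]
        · simp [hi, hne i hi]) (fun i j hij a ha b hb => by
        rcases eq_or_ne i k with rfl | hi
        · refine hI i j hij a ?_ b hb
          rw [hu]
          exact List.mem_cons_of_mem _ (by simpa using ha)
        · exact hI i j hij a (by simpa [hi] using ha) b hb)
      refine ⟨(c, k) :: τ₀, τ₁, fun i => ?_, h₁, hcov.append_left [(c, k)]⟩
      rcases eq_or_ne i k with rfl | hi
      · rw [IndexedTrace.local_cons_self, h₀, Function.update_self, hu]
      · rw [IndexedTrace.local_cons_of_ne _ _ hi.symm, h₀, Function.update_of_ne hi]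

/-! ### Construction of executions -/

theorem SyncPointTrace.append_left {T : Finset ℕ} (hT : T.Nonempty)
    {w τ : IndexedTrace (Act ⊕ Unit)} (hw : w ∈ actionWords Act T + syncWords Act T)
    (h : SyncPointTrace T τ) : SyncPointTrace T (w ++ τ) := by
  rcases h with _ | ⟨h₁, hT', h₂⟩
  · simp at hT
  · rw [← List.append_assoc]
    refine .phase ?_ hT' h₂
    obtain ⟨L, rfl, hL⟩ := Language.mem_kstar.mp h₁
    refine Language.mem_kstar.mpr ⟨w :: L, rfl, fun y hy => ?_⟩
    rcases List.mem_cons.mp hy with rfl | hy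
    · exact hw
    · exact hL y hy

/-- One phase: the threads in `T` execute actions, then the threads in `T'` pass a sync-point while
the other threads terminate. -/
theorem SyncPointTrace.phase_sync {T T' : Finset ℕ} (hT : T.Nonempty) (hT' : T' ⊆ T)
    {w τ : IndexedTrace (Act ⊕ Unit)} (hw : w ∈ actionWords Act T) (h : SyncPointTrace T' τ) :
    SyncPointTrace T (w ++ ((T'.toList.map fun t => (Sum.inr (), t)) ++ τ)) := by
  have hw' : w ∈ actionWords Act T + syncWords Act T := (Language.mem_add _ _ _).mpr (Or.inl hw)
  have hsync : SyncPointTrace T' ((T'.toList.map fun t => (Sum.inr (), t)) ++ τ) := by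
    rcases T'.eq_empty_or_nonempty with rfl | hne
    · simpa using h
    · refine h.append_left hne ((Language.mem_add _ _ _).mpr (Or.inr ?_))
      exact ⟨T'.toList, T'.nodup_toList, by simp, rfl⟩
  rcases eq_or_ne T' T with rfl | hne
  · exact hsync.append_left hT hw'
  · exact .phase (Language.mem_kstar.mpr ⟨[w], by simp, by simpa using hw'⟩)
      (hT'.ssubset_of_ne hne) hsync

theorem local_map_sync {X : Type} (x : X) {l : List ℕ} (hl : l.Nodup) (i : ℕ) :
    IndexedTrace.local (l.map fun t => (x, t)) i = if i ∈ l then [x] else [] := by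
  induction l with
  | nil => rfl
  | cons t l ih =>
    rw [List.nodup_cons] at hl
    rw [List.map_cons, IndexedTrace.local_cons, ih hl.2]
    by_cases ht : t = i
    · subst ht
      simp [hl.1]
    · simp [ht, Ne.symm ht]

/-- A word is split into its actions `u` before the first sync-point, that sync-point if there is one
(`c = true`), and the rest. -/
theorem exists_first_phase (w : List (Act ⊕ (Empty ⊕ Unit))) :
    ∃ (u : List Act) (w' : List (Act ⊕ (Empty ⊕ Unit))) (c : Bool),
      (c = false → w' = []) ∧
      w = u.map Sum.inl ++ ((if c then [Sum.inr (Sum.inr ())] else []) ++ w') := by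
  induction w with
  | nil => exact ⟨[], [], false, fun _ => rfl, rfl⟩
  | cons x w ih =>
    rcases x with a | e | ⟨⟩
    · obtain ⟨u, w', c, hc, rfl⟩ := ih
      exact ⟨a :: u, w', c, hc, rfl⟩
    · exact e.elim
    · exact ⟨[], w, true, by simp, rfl⟩

/-- Given lifts `w i` of the local traces of `τ` to words with sync-points, `τ` can be rearranged so
that the sync-points are respected, provided that this only moves actions as permitted by `I`. -/
theorem exists_execution {I : Set (Act × Act)} (n : ℕ) (T : Finset ℕ) (τ : IndexedTrace Act)
    (w : ℕ → List (Act ⊕ (Empty ⊕ Unit))) (hn : ∀ i ∈ T, syncCount (w i) < n)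
    (hT : ∀ i ∉ T, w i = []) (hw : ∀ i, actionsOf (w i) = τ.local i)
    (hI : ∀ i j, i ≠ j → ∀ a b τ₁ σ₁ τ₂ σ₂, w i = τ₁ ++ Sum.inl a :: σ₁ →
      w j = τ₂ ++ Sum.inl b :: σ₂ → syncCount τ₁ < syncCount τ₂ → (b, a) ∈ I) :
    ∃ τ' : IndexedTrace (Act ⊕ (Empty ⊕ Unit)),
      SyncPointTrace T (τ'.project SyncAlphabet.eraseLeft) ∧ (∀ i, τ'.local i = w i) ∧
      CoveredBy I τ (τ'.project Sum.getLeft?) := by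
  rcases T.eq_empty_or_nonempty with rfl | hne
  · have hτ : τ = [] := by
      refine List.eq_nil_iff_forall_not_mem.mpr ?_
      rintro ⟨a, i⟩ ha
      have := IndexedTrace.mem_local.mpr ha
      rw [← hw, hT i (by simp)] at this
      simp at this
    subst hτ
    exact ⟨[], .done, fun i => (hT i (by simp)).symm, .refl⟩
  induction n generalizing T τ w with
  | zero =>
    obtain ⟨i, hi⟩ := hne
    exact absurd (hn i hi) (Nat.not_lt_zero _)
  | succ n ih =>
    choose u w' c hc hsplit using fun i => exists_first_phase (w i)
    have hcount : ∀ i, syncCount (w i) = (if c i then 1 else 0) + syncCount (w' i) := by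
      intro i
      rw [hsplit i, syncCount_append, syncCount_append, syncCount_map_inl]
      cases c i <;> simp
    have hactions : ∀ i, τ.local i = u i ++ actionsOf (w' i) := by
      intro i
      rw [← hw i, hsplit i, actionsOf_append, actionsOf_append, actionsOf_map_inl]
      cases c i <;> simp
    obtain ⟨τ₀, τ₁, h₀, h₁, hcov⟩ := exists_coveredBy_append (I := I) τ u
      (fun i => actionsOf (w' i)) hactions (by
        intro i j hij a ha b hb
        obtain ⟨α, β, hu⟩ := List.append_of_mem ha
        obtain ⟨α', β', hw'⟩ := List.append_of_mem (mem_actionsOf.mp hb)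
        have hcj : c j = true := by
          by_contra h
          rw [hc j (by simpa using h)] at hb
          simp at hb
        refine hI i j hij a b (α.map Sum.inl)
          (β.map Sum.inl ++ ((if c i then [Sum.inr (Sum.inr ())] else []) ++ w' i))
          ((u j).map Sum.inl ++ [Sum.inr (Sum.inr ())] ++ α') β' ?_ ?_ ?_
        · rw [hsplit i, hu]
          simp
        · rw [hsplit j, hcj, hw']
          simp
        · simp [syncCount_map_inl])
    let T' := T.filter fun i => c i = true
    have hT' : ∀ i ∉ T', w' i = [] := by
      intro i hi
      by_cases hiT : i ∈ T
      · exact hc i (by simpa [T', hiT] using hi)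
      · have := hsplit i
        rw [hT i hiT] at this
        simp only [List.nil_eq, List.append_eq_nil_iff] at this
        exact this.2.2
    have hcT : ∀ i, c i = true → i ∈ T' := by
      intro i hi
      refine Finset.mem_filter.mpr ⟨?_, hi⟩
      by_contra hiT
      have := hsplit i
      rw [hT i hiT, hi] at this
      simp at this
    have hI' : ∀ i j, i ≠ j → ∀ a b τ₁ σ₁ τ₂ σ₂, w' i = τ₁ ++ Sum.inl a :: σ₁ →
        w' j = τ₂ ++ Sum.inl b :: σ₂ → syncCount τ₁ < syncCount τ₂ → (b, a) ∈ I := by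
      intro i j hij a b τ₁ σ₁ τ₂ σ₂ hi hj hlt
      have hci : c i = true := by
        by_contra h
        rw [hc i (by simpa using h)] at hi
        simp at hi
      have hcj : c j = true := by
        by_contra h
        rw [hc j (by simpa using h)] at hj
        simp at hj
      refine hI i j hij a b ((u i).map Sum.inl ++ [Sum.inr (Sum.inr ())] ++ τ₁) σ₁
        ((u j).map Sum.inl ++ [Sum.inr (Sum.inr ())] ++ τ₂) σ₂ ?_ ?_ ?_
      · rw [hsplit i, hci, hi]
        simp
      · rw [hsplit j, hcj, hj]
        simp
      · simpa [syncCount_map_inl] using hlt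
    obtain ⟨τ', hsync, hlocal, hcov'⟩ : ∃ τ' : IndexedTrace (Act ⊕ (Empty ⊕ Unit)),
        SyncPointTrace T' (τ'.project SyncAlphabet.eraseLeft) ∧ (∀ i, τ'.local i = w' i) ∧
        CoveredBy I τ₁ (τ'.project Sum.getLeft?) := by
      rcases T'.eq_empty_or_nonempty with hemp | hne'
      · rw [hemp] at hT' ⊢
        have hτ : τ₁ = [] := by
          refine List.eq_nil_iff_forall_not_mem.mpr ?_
          rintro ⟨a, i⟩ ha
          have := IndexedTrace.mem_local.mpr ha
          rw [h₁, hT' i (by simp)] at this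
          simp at this
        subst hτ
        exact ⟨[], .done, fun i => (hT' i (by simp)).symm, .refl⟩
      · refine ih T' τ₁ w' (fun i hi => ?_) hT' (fun i => (h₁ i).symm) hI' hne'
        have h₂ := hcount i
        rw [(Finset.mem_filter.mp hi).2] at h₂
        have h₃ := hn i (Finset.mem_filter.mp hi).1
        simp only [if_true] at h₂
        omega
    refine ⟨(τ₀.map fun s => (Sum.inl s.1, s.2)) ++
      ((T'.toList.map fun t => (Sum.inr (Sum.inr ()), t)) ++ τ'), ?_, fun i => ?_, ?_⟩
    · have hp₁ : IndexedTrace.project SyncAlphabet.eraseLeft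
          (τ₀.map fun s => ((Sum.inl s.1 : Act ⊕ (Empty ⊕ Unit)), s.2)) =
          τ₀.map fun s => (Sum.inl s.1, s.2) := by
        simp only [IndexedTrace.project, List.filterMap_map]
        rw [← List.filterMap_eq_map]
        rfl
      have hp₂ : IndexedTrace.project SyncAlphabet.eraseLeft
          (T'.toList.map fun t => ((Sum.inr (Sum.inr ()) : Act ⊕ (Empty ⊕ Unit)), t)) =
          T'.toList.map fun t => (Sum.inr (), t) := by
        simp only [IndexedTrace.project, List.filterMap_map]
        rw [← List.filterMap_eq_map]
        rfl
      rw [IndexedTrace.project_append, IndexedTrace.project_append, hp₁, hp₂]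
      refine SyncPointTrace.phase_sync hne (Finset.filter_subset _ _) ?_ hsync
      intro s hs
      obtain ⟨⟨a, i⟩, hs', rfl⟩ := List.mem_map.mp hs
      refine ⟨⟨a, rfl⟩, ?_⟩
      by_contra hi
      have ha : a ∈ u i := by
        rw [← h₀]
        exact IndexedTrace.mem_local.mpr hs'
      have := hsplit i
      rw [hT i hi] at this
      simp only [List.nil_eq, List.append_eq_nil_iff, List.map_eq_nil_iff] at this
      simp [this.1] at ha
    · rw [IndexedTrace.local_append, IndexedTrace.local_append, IndexedTrace.local_map, h₀,
        local_map_sync _ T'.nodup_toList, hlocal, hsplit i]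
      have hiff : i ∈ T'.toList ↔ c i = true := by
        rw [Finset.mem_toList]
        exact ⟨fun hi => (Finset.mem_filter.mp hi).2, hcT i⟩
      simp only [hiff]
    · have hp₁ : IndexedTrace.project Sum.getLeft?
          (τ₀.map fun s => ((Sum.inl s.1 : Act ⊕ (Empty ⊕ Unit)), s.2)) = τ₀ := by
        simp only [IndexedTrace.project, List.filterMap_map]
        exact List.filterMap_some
      have hp₂ : IndexedTrace.project Sum.getLeft?
          (T'.toList.map fun t => ((Sum.inr (Sum.inr ()) : Act ⊕ (Empty ⊕ Unit)), t)) = [] := by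
        simp [IndexedTrace.project, List.filterMap_map]
      rw [IndexedTrace.project_append, IndexedTrace.project_append, hp₁, hp₂, List.nil_append]
      exact hcov.trans (hcov'.append_left τ₀)

end Instrumentation

section PhaseOrder

variable {Act : Type}

/-! ### Invariants of swaps -/

theorem IndexedTrace.local_swap {X : Type} (x y : X) {i j : ℕ} (h : i ≠ j) (τ : IndexedTrace X)
    (k : ℕ) : IndexedTrace.local ((x, i) :: (y, j) :: τ) k =
      IndexedTrace.local ((y, j) :: (x, i) :: τ) k := by
  simp only [IndexedTrace.local_cons]
  split_ifs with h₁ h₂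
  · exact absurd (h₁.trans h₂.symm) h
  all_goals rfl

theorem CoveredBy.local_eq {I : Set (Act × Act)} {τ τ' : IndexedTrace Act}
    (h : CoveredBy I τ τ') (k : ℕ) : τ'.local k = τ.local k := by
  induction h with
  | refl => rfl
  | tail _ hstep ih =>
    obtain ⟨ρ, σ, a, b, i, j, -, hij⟩ := hstep
    rw [← ih, IndexedTrace.local_append, IndexedTrace.local_append,
      IndexedTrace.local_swap a b hij]

/-- In `τ`, thread `j` executes `b` after the actions `β`, and at that time thread `i` has executed
only actions from `α` and still has to execute `a`, which comes after `α`. -/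
def ExecutesBefore (b a : Act) (j i : ℕ) (β α : List Act) (τ : IndexedTrace Act) : Prop :=
  ∃ (ρ σ : IndexedTrace Act) (α' γ : List Act), τ = ρ ++ (b, j) :: σ ∧ ρ.local j = β ∧
    α = ρ.local i ++ α' ∧ σ.local i = α' ++ a :: γ

/-- If `b` may not be swapped with a later `a`, then it stays before `a`. -/
theorem ExecutesBefore.swapStep {I : Set (Act × Act)} {b a : Act} {j i : ℕ} {β α : List Act}
    {τ τ' : IndexedTrace Act} (h : ExecutesBefore b a j i β α τ) (hij : i ≠ j)
    (hI : (b, a) ∉ I) (hstep : SwapStep I τ τ') : ExecutesBefore b a j i β α τ' := by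
  obtain ⟨ρ', σ', c, d, k, l, hcd, hkl⟩ := hstep
  obtain ⟨ρ, σ, α', γ, hτ, rfl, rfl, hσ⟩ := h
  -- the pair is swapped before `b`, at `b`, or after `b`
  have hcases : (∃ as, ρ = ρ' ++ as ∧ (c, k) :: (d, l) :: σ' = as ++ (b, j) :: σ) ∨
      ∃ bs, ρ' = ρ ++ (b, j) :: bs ∧ σ = bs ++ (c, k) :: (d, l) :: σ' := by
    rcases List.append_eq_append_iff.mp hτ with ⟨as, h₁, h₂⟩ | ⟨bs, h₁, h₂⟩
    · exact Or.inl ⟨as, h₁, h₂⟩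
    · rcases bs with _ | ⟨s, bs⟩
      · exact Or.inl ⟨[], by simpa using h₁.symm, h₂.symm⟩
      · rw [List.cons_append] at h₂
        obtain ⟨rfl, h₃⟩ := List.cons.inj h₂
        exact Or.inr ⟨bs, h₁, h₃⟩
  rcases hcases with ⟨_ | ⟨s, _ | ⟨t, as⟩⟩, rfl, h⟩ | ⟨bs, rfl, rfl⟩
  · obtain ⟨h₁, rfl⟩ := List.cons.inj h
    obtain ⟨rfl, rfl⟩ := Prod.mk.inj h₁
    by_cases hl : l = i
    · subst hl
      rw [IndexedTrace.local_cons_self] at hσ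
      rcases α' with _ | ⟨d', α'⟩
      · obtain ⟨rfl, -⟩ := List.cons.inj hσ
        exact absurd hcd hI
      · obtain ⟨rfl, hσ'⟩ := List.cons.inj hσ
        exact ⟨ρ' ++ [(d, l)], σ', α', γ, by simp,
          by simp [IndexedTrace.local_cons, hij], by simp [IndexedTrace.local_cons], hσ'⟩
    · rw [IndexedTrace.local_cons_of_ne _ _ hl] at hσ
      exact ⟨ρ' ++ [(d, l)], σ', α', γ, by simp,
        by simp [IndexedTrace.local_cons, hkl.symm], by simp [IndexedTrace.local_cons, hl], hσ⟩
  · rw [List.cons_append, List.nil_append] at h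
    obtain ⟨rfl, h'⟩ := List.cons.inj h
    obtain ⟨h₁, rfl⟩ := List.cons.inj h'
    obtain ⟨rfl, rfl⟩ := Prod.mk.inj h₁
    by_cases hk : k = i
    · subst hk
      exact ⟨ρ', (c, k) :: σ', c :: α', γ, rfl, by simp [IndexedTrace.local_cons, hkl],
        by simp [IndexedTrace.local_cons], by simp [IndexedTrace.local_cons, hσ]⟩
    · exact ⟨ρ', (c, k) :: σ', α', γ, rfl, by simp [IndexedTrace.local_cons, hkl],
        by simp [IndexedTrace.local_cons, hk], by simpa [IndexedTrace.local_cons, hk] using hσ⟩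
  · rw [List.cons_append, List.cons_append] at h
    obtain ⟨rfl, h'⟩ := List.cons.inj h
    obtain ⟨rfl, rfl⟩ := List.cons.inj h'
    refine ⟨ρ' ++ (d, l) :: (c, k) :: as, σ, α', γ, by simp, ?_, ?_, hσ⟩
    · rw [IndexedTrace.local_append, IndexedTrace.local_append, IndexedTrace.local_swap c d hkl]
    · rw [IndexedTrace.local_append, IndexedTrace.local_append, IndexedTrace.local_swap c d hkl]
  · refine ⟨ρ, bs ++ (d, l) :: (c, k) :: σ', α', γ, by simp, rfl, rfl, ?_⟩
    rw [← hσ, IndexedTrace.local_append, IndexedTrace.local_append,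
      IndexedTrace.local_swap c d hkl]

theorem ExecutesBefore.coveredBy {I : Set (Act × Act)} {b a : Act} {j i : ℕ} {β α : List Act}
    {τ τ' : IndexedTrace Act} (h : ExecutesBefore b a j i β α τ) (hij : i ≠ j)
    (hI : (b, a) ∉ I) (hcov : CoveredBy I τ τ') : ExecutesBefore b a j i β α τ' := by
  induction hcov with
  | refl => exact h
  | tail _ hstep ih => exact ih.swapStep hij hI hstep

/-! ### The phase order -/

theorem actionsOf_filterMap_eraseRight (w : List (Act ⊕ (Empty ⊕ Unit))) :
    actionsOf (w.filterMap SyncAlphabet.eraseRight) = actionsOf w := by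
  rw [actionsOf, actionsOf, List.filterMap_filterMap]
  congr 1
  funext s
  rcases s with a | e | u <;> rfl

/-- A prefix with at most as many actions as there are before a given action ends before that
action. -/
theorem prefix_of_length_actionsOf_le {S : Type} {u v u' v' : List (Act ⊕ S)} {a : Act}
    (h : u ++ v = u' ++ Sum.inl a :: v') (hle : (actionsOf u).length ≤ (actionsOf u').length) :
    u <+: u' := by
  rcases List.append_eq_append_iff.mp h with ⟨as, h₁, -⟩ | ⟨bs, h₁, h₂⟩
  · exact ⟨as, h₁.symm⟩
  · rcases bs with _ | ⟨s, bs⟩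
    · exact ⟨[], by simpa using h₁⟩
    · obtain ⟨rfl, -⟩ := List.cons.inj h₂
      rw [h₁, actionsOf_append, actionsOf_cons_inl, List.length_append, List.length_cons] at hle
      omega

theorem syncCount_le_of_prefix {S : Type} {u v : List (Act ⊕ (S ⊕ Unit))} (h : u <+: v) :
    syncCount u ≤ syncCount v := h.sublist.countP_le

namespace SoundnessInput

variable (x : SoundnessInput Act)

/-- An execution of the instrumented program consists of traces of the instrumentation, scheduled
such that the sync-points are respected. -/
theorem isExecution_iff (τ : IndexedTrace (Act ⊕ (Empty ⊕ Unit))) :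
    (x.program.withSyncPoints x.G').IsExecution τ ↔
      (∃ T, SyncPointTrace T (τ.project SyncAlphabet.eraseLeft)) ∧
        ∀ i, τ.local i ∈ x.G'.traces ∪ {[]} :=
  ⟨fun h => ⟨h.1.2, h.2⟩, fun h => ⟨⟨trivial, h.1⟩, h.2⟩⟩

theorem mem_traces_of_local_eq {τ : IndexedTrace (Act ⊕ (Empty ⊕ Unit))}
    (hτ : (x.program.withSyncPoints x.G').IsExecution τ) {i : ℕ} {a : Act}
    (ha : a ∈ actionsOf (τ.local i)) : τ.local i ∈ x.G'.traces := by
  rcases hτ.2 i with h | h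
  · exact h
  · rw [Set.mem_singleton_iff.mp h] at ha
    simp at ha

/-- Two traces can always be executed together: their sync-points match up to the point where the
shorter one terminates. -/
theorem mem_phaseOrder_of_syncBefore {a b : Act} (h : SyncBefore x.G' a b) :
    (a, b) ∈ PhaseOrder x.program x.G' := by
  obtain ⟨τ₁, σ₁, τ₂, σ₂, h₁, h₂, hlt⟩ := h
  let w : ℕ → List (Act ⊕ (Empty ⊕ Unit)) := fun i =>
    if i = 0 then τ₁ ++ Sum.inl a :: σ₁ else if i = 1 then τ₂ ++ Sum.inl b :: σ₂ else []
  obtain ⟨τ, hsync, hlocal, -⟩ := exists_execution (I := Set.univ)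
    (syncCount (w 0) + syncCount (w 1) + 1) {0, 1}
    ((actionsOf (w 0)).map (fun a => (a, 0)) ++ (actionsOf (w 1)).map (fun a => (a, 1))) w
    (by
      intro i hi
      rcases Finset.mem_insert.mp hi with rfl | hi
      · omega
      · rw [Finset.mem_singleton.mp hi]
        omega)
    (by
      intro i hi
      simp only [Finset.mem_insert, Finset.mem_singleton, not_or] at hi
      simp [w, hi])
    (by
      intro i
      rw [IndexedTrace.local_append, IndexedTrace.local_map_pair, IndexedTrace.local_map_pair]
      by_cases h0 : i = 0
      · subst h0
        simp
      · by_cases h1 : i = 1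
        · subst h1
          simp
        · simp [w, h0, h1, Ne.symm h0, Ne.symm h1])
    (fun _ _ _ _ _ _ _ _ _ _ _ _ => Set.mem_univ _)
  refine ⟨τ, (x.isExecution_iff τ).mpr ⟨⟨_, hsync⟩, fun i => ?_⟩, 0, 1, by simp, τ₁, σ₁, τ₂, σ₂,
    hlocal 0, hlocal 1, hlt⟩
  rw [hlocal i]
  by_cases h0 : i = 0
  · exact Or.inl (by simpa [w, h0] using h₁)
  · by_cases h1 : i = 1
    · exact Or.inl (by simpa [w, h0, h1] using h₂)
    · exact Or.inr (by simp [w, h0, h1])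

theorem mem_phaseOrder_iff (a b : Act) :
    (a, b) ∈ PhaseOrder x.program x.G' ↔ SyncBefore x.G' a b := by
  refine ⟨?_, x.mem_phaseOrder_of_syncBefore⟩
  rintro ⟨τ, hτ, i, j, -, τ₁, σ₁, τ₂, σ₂, hi, hj, hlt⟩
  refine ⟨τ₁, σ₁, τ₂, σ₂, ?_, ?_, hlt⟩
  · rw [← hi]
    exact x.mem_traces_of_local_eq hτ (a := a) (mem_actionsOf.mpr (by rw [hi]; simp))
  · rw [← hj]
    exact x.mem_traces_of_local_eq hτ (a := b) (mem_actionsOf.mpr (by rw [hj]; simp))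

/-! ### Soundness -/

theorem lang_withSyncPoints_subset :
    (x.program.withSyncPoints x.G').lang ⊆ x.program.lang := by
  rintro _ ⟨τ, rfl, hτ⟩
  refine ⟨τ.project SyncAlphabet.eraseRight, ?_, trivial, fun i => ?_⟩
  · rw [IndexedTrace.project_project]
    congr 1
    funext s
    rcases s with a | e | u <;> rfl
  · rw [IndexedTrace.local_project]
    rcases hτ.2 i with h | h
    · left
      have := x.isInstrumentation.1
      exact this ▸ ⟨_, h, rfl⟩
    · right
      rw [Set.mem_singleton_iff.mp h]
      rfl

/-- If the phase order is contained in the inverse of the commutativity relation, then every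
interleaving can be rearranged phase by phase. -/
theorem sound_of_syncBefore (h : ∀ a b, SyncBefore x.G' a b → (b, a) ∈ x.I) : x.Sound := by
  refine ⟨x.lang_withSyncPoints_subset, ?_⟩
  rintro _ ⟨τ, rfl, hτ⟩
  have hlift : ∀ i, ∃ w : List (Act ⊕ (Empty ⊕ Unit)), (τ.local i = [] → w = []) ∧
      w ∈ x.G'.traces ∪ {[]} ∧ actionsOf w = actionsOf (τ.local i) := by
    intro i
    by_cases hi : τ.local i = []
    · exact ⟨[], fun _ => rfl, Or.inr rfl, by rw [hi]; rfl⟩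
    · rcases hτ.2 i with h' | h'
      · have := x.isInstrumentation.1
        obtain ⟨w, hw, hwi⟩ : τ.local i ∈
            (fun τ : List (Act ⊕ (Empty ⊕ Unit)) => τ.filterMap SyncAlphabet.eraseRight) ''
              x.G'.traces := this ▸ h'
        exact ⟨w, fun h => absurd h hi, Or.inl hw, by
          rw [← hwi, actionsOf_filterMap_eraseRight]⟩
      · exact absurd h' hi
  choose w hw₀ hwG hw using hlift
  have hmem : ∀ i a τ₁ σ₁, w i = τ₁ ++ Sum.inl a :: σ₁ → τ₁ ++ Sum.inl a :: σ₁ ∈ x.G'.traces := by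
    intro i a τ₁ σ₁ hi
    rcases hwG i with h | h
    · exact hi ▸ h
    · rw [hi] at h
      simp at h
  let T : Finset ℕ := (τ.map Prod.snd).toFinset
  obtain ⟨τ', hsync, hlocal, hcov⟩ := exists_execution (I := x.I)
    (T.sup (fun i => syncCount (w i)) + 1) T (τ.project Sum.getLeft?) w
    (fun i hi => Nat.lt_succ_of_le (Finset.le_sup (f := fun i => syncCount (w i)) hi))
    (fun i hi => hw₀ i (List.eq_nil_iff_forall_not_mem.mpr fun s hs => hi
      (List.mem_toFinset.mpr (List.mem_map.mpr ⟨_, IndexedTrace.mem_local.mp hs, rfl⟩))))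
    (fun i => by rw [hw i, IndexedTrace.local_project]; rfl)
    (fun i j _ a b τ₁ σ₁ τ₂ σ₂ hi hj hlt =>
      h a b ⟨τ₁, σ₁, τ₂, σ₂, hmem i a τ₁ σ₁ hi, hmem j b τ₂ σ₂ hj, hlt⟩)
  exact ⟨_, ⟨τ', rfl, (x.isExecution_iff τ').mpr ⟨⟨T, hsync⟩, fun i => hlocal i ▸ hwG i⟩⟩, hcov⟩

/-- If thread `j` executes `b` in a later phase than thread `i` executes `a`, then the interleaving
in which `j` runs to completion before `i` starts is covered only if `b` can be moved past `a`. -/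
theorem Sound.mem_of_mem_phaseOrder {x : SoundnessInput Act} (h : x.Sound) {a b : Act}
    (hab : (a, b) ∈ PhaseOrder x.program x.G') : (b, a) ∈ x.I := by
  obtain ⟨τ, hτ, i, j, hij, τ₁, σ₁, τ₂, σ₂, hi, hj, hlt⟩ := hab
  dsimp only at hi hj
  by_contra hI
  have hiG : τ₁ ++ Sum.inl a :: σ₁ ∈ x.G'.traces := by
    rw [← hi]
    exact x.mem_traces_of_local_eq hτ (a := a) (mem_actionsOf.mpr (by rw [hi]; simp))
  have hjG : τ₂ ++ Sum.inl b :: σ₂ ∈ x.G'.traces := by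
    rw [← hj]
    exact x.mem_traces_of_local_eq hτ (a := b) (mem_actionsOf.mpr (by rw [hj]; simp))
  clear hτ hi hj
  set wi := τ₁ ++ Sum.inl a :: σ₁ with hwi
  set wj := τ₂ ++ Sum.inl b :: σ₂ with hwj
  let τ₀ : IndexedTrace Act := (actionsOf wj).map (fun c => (c, j)) ++
    (actionsOf wi).map (fun c => (c, i))
  have hτ₀ : τ₀ ∈ x.program.lang := by
    refine ⟨(wj.filterMap SyncAlphabet.eraseRight).map (fun c => (c, j)) ++
      (wi.filterMap SyncAlphabet.eraseRight).map (fun c => (c, i)), ?_, trivial, fun k => ?_⟩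
    · rw [IndexedTrace.project_append, IndexedTrace.project_map_pair,
        IndexedTrace.project_map_pair]
      change _ = (actionsOf (wj.filterMap SyncAlphabet.eraseRight)).map _ ++
        (actionsOf (wi.filterMap SyncAlphabet.eraseRight)).map _
      rw [actionsOf_filterMap_eraseRight, actionsOf_filterMap_eraseRight]
    · rw [IndexedTrace.local_append, IndexedTrace.local_map_pair, IndexedTrace.local_map_pair]
      have himage : ∀ w ∈ x.G'.traces,
          w.filterMap SyncAlphabet.eraseRight ∈ x.program.template.traces := by
        intro w hw
        have := x.isInstrumentation.1
        exact this ▸ ⟨_, hw, rfl⟩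
      by_cases hk : j = k
      · subst hk
        left
        simpa [hij] using himage wj hjG
      · by_cases hk' : i = k
        · left
          simpa [hk, hk'] using himage wi hiG
        · right
          simp [hk, hk']
  have hlocal₀ : ∀ k, τ₀.local k =
      (if j = k then actionsOf wj else []) ++ if i = k then actionsOf wi else [] := fun k => by
    rw [IndexedTrace.local_append, IndexedTrace.local_map_pair, IndexedTrace.local_map_pair]
  have hbefore : ExecutesBefore b a j i (actionsOf τ₂) (actionsOf τ₁) τ₀ := by
    refine ⟨(actionsOf τ₂).map (fun c => (c, j)), (actionsOf σ₂).map (fun c => (c, j)) ++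
      (actionsOf wi).map (fun c => (c, i)), actionsOf τ₁, actionsOf σ₁, ?_, ?_, ?_, ?_⟩
    · simp [τ₀, hwj]
    · simp [IndexedTrace.local_map_pair]
    · simp [IndexedTrace.local_map_pair, hij.symm]
    · simp [IndexedTrace.local_map_pair, IndexedTrace.local_cons_self, hij.symm, hwi]
  obtain ⟨_, ⟨τ', rfl, hτ'⟩, hcov⟩ := h.2 τ₀ hτ₀
  obtain ⟨ρ, σ, α', γ, hsplit, hρj, hρi, hσ⟩ := hbefore.coveredBy hij hI hcov
  -- the execution consists of the given traces, since they are determined by their actions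
  have hlocal : ∀ k, actionsOf (τ'.local k) = τ₀.local k := fun k => by
    rw [← hcov.local_eq k, IndexedTrace.local_project]
    rfl
  have hτi : τ'.local i = wi := by
    have h₁ : actionsOf (τ'.local i) = actionsOf wi := by
      rw [hlocal, hlocal₀]
      simp [hij.symm]
    refine x.isInstrumentation.2 _ (x.mem_traces_of_local_eq hτ' (a := a) ?_) _ hiG h₁
    rw [h₁, hwi]
    simp
  have hτj : τ'.local j = wj := by
    have h₁ : actionsOf (τ'.local j) = actionsOf wj := by
      rw [hlocal, hlocal₀]
      simp [hij]
    refine x.isInstrumentation.2 _ (x.mem_traces_of_local_eq hτ' (a := b) ?_) _ hjG h₁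
    rw [h₁, hwj]
    simp
  obtain ⟨ρ', σ', rfl, hρ', hσ'⟩ : ∃ ρ' σ' : IndexedTrace (Act ⊕ (Empty ⊕ Unit)),
      τ' = ρ' ++ (Sum.inl b, j) :: σ' ∧ ρ'.project Sum.getLeft? = ρ ∧
        σ'.project Sum.getLeft? = σ := by
    obtain ⟨l₁, l₂, rfl, h₁, h₂⟩ := List.filterMap_eq_append_iff.mp hsplit
    obtain ⟨m₁, ⟨s, k⟩, m₂, rfl, h₃, h₄, h₅⟩ := List.filterMap_eq_cons_iff.mp h₂
    rcases s with c | s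
    · obtain ⟨rfl, rfl⟩ : c = b ∧ k = j := by simpa using h₄
      refine ⟨l₁ ++ m₁, m₂, by simp, ?_, h₅⟩
      rw [IndexedTrace.project_append]
      change l₁.filterMap _ ++ m₁.filterMap _ = ρ
      rw [h₁, List.filterMap_eq_nil_iff.mpr h₃, List.append_nil]
    · simp at h₄
  have hactions : ∀ k, actionsOf (ρ'.local k) = ρ.local k := fun k => by
    rw [← hρ', IndexedTrace.local_project]
    rfl
  rw [IndexedTrace.local_append, IndexedTrace.local_cons_self] at hτj
  rw [IndexedTrace.local_append, IndexedTrace.local_cons_of_ne _ _ hij.symm] at hτi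
  have hle_i : syncCount (ρ'.local i) ≤ syncCount τ₁ := by
    refine syncCount_le_of_prefix (prefix_of_length_actionsOf_le hτi ?_)
    rw [hactions, hρi, List.length_append]
    exact Nat.le_add_right _ _
  have hle_j : syncCount τ₂ ≤ syncCount (ρ'.local j) := by
    refine syncCount_le_of_prefix (prefix_of_length_actionsOf_le hτj.symm ?_)
    rw [hactions, hρj]
  obtain ⟨T, hT⟩ := hτ'.1.2
  rw [IndexedTrace.project_append] at hT
  have hmem : (Sum.inl a, i) ∈ σ'.project SyncAlphabet.eraseLeft := by
    have h₁ : (a, i) ∈ σ'.project Sum.getLeft? := by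
      rw [hσ']
      exact IndexedTrace.mem_local.mp (by rw [hσ]; simp)
    obtain ⟨⟨s, k⟩, hs, h₂⟩ := List.mem_filterMap.mp h₁
    rcases s with c | s
    · obtain ⟨rfl, rfl⟩ : c = a ∧ k = i := by simpa using h₂
      exact List.mem_filterMap.mpr ⟨_, hs, rfl⟩
    · simp at h₂
  have := hT.threadSyncs_eq rfl hmem
  rw [threadSyncs_project, threadSyncs_project] at this
  exact absurd this (hle_i.trans_lt (hlt.trans_le hle_j)).ne

theorem sound_iff : x.Sound ↔ ∀ a b, SyncBefore x.G' a b → (b, a) ∈ x.I :=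
  ⟨fun h a b hab => h.mem_of_mem_phaseOrder ((x.mem_phaseOrder_iff a b).mpr hab),
    x.sound_of_syncBefore⟩

end SoundnessInput

end PhaseOrder

/-! ### Complexity and characterization of soundness -/

theorem mainTheorem5 (Act : Type) (name : Act → List Bool)
    (name_injective : Function.Injective name) :
    Nonempty (Turing.TM2ComputableInPolyTime (encodeInput name) Computability.encodeBool
      (SoundnessInput.soundness : SoundnessInput Act → Bool)) ∧
    ∀ x : SoundnessInput Act,
      (x.Sound ↔ ∀ a b : Act, (a, b) ∈ PhaseOrder x.program x.G' → (b, a) ∈ x.I) ∧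
      ∀ a b : Act, (a, b) ∈ PhaseOrder x.program x.G' ↔ minSync x.G' a < maxSync x.G' b := by
  refine ⟨?_, fun x => ⟨?_, fun a b => ?_⟩⟩
  · refine PolyTime.nonempty_tm2ComputableInPolyTime
      (g := fun w => checkParsed (InputSymbol.parseReverse w))
      (PolyTime.checkParsed.comp PolyTime.parseReverse) fun x => ?_
    rw [parseReverse_reverse, Bool.eq_iff_iff, checkParsed_parse_encodeInput name_injective,
      SoundnessInput.soundness, @decide_eq_true_iff _ (Classical.propDecidable _), x.sound_iff]
    rfl
  · rw [x.sound_iff]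
    simp only [x.mem_phaseOrder_iff]
  · rw [x.mem_phaseOrder_iff, minSync_lt_maxSync_iff]
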